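/- Let $p$ be an odd prime, $K$ a number field, $G_K=\mathrm{Gal}(\overline K/K)$, $E/K$ an elliptic curve, and $\bar\rho:G_K\to \mathrm{GL}(E[p])\cong\mathrm{GL}_2(\mathbb F_p)$ the representation on its $p$-torsion. For $d\in K^*$ let $E^d$ be the quadratic twist of $E$ by $d$ (if $E: y^2=x^3+ax+b$, then $E^d: y^2=x^3+ad^2x+bd^3$). Two curves $E,E'$ over $K$ are $p$-congruent if there is an isomorphism of $G_K$-modules $\phi:E[p]\to E'[p]$. Such a $\phi$ is symplectic (resp. anti-symplectic) if $e_{E',p}(\phi(P),\phi(Q))=e_{E,p}(P,Q)^{d(\phi)}$ for all $P,Q\in E[p]$, where $e$ is the Weil pairing and $d(\phi)\in\mathbb F_p^*$ is a square (resp. a non-square). Write $p^*=(-1)^{(p-1)/2}p$. Suppose that $E[p]$ is absolutely irreducible and that $E$ is $p$-congruent to $E^d$ for some non-square $d\in K^*$. Then $j(E)\neq0$ if $p=3$, and the following hold. (1) There is a unique Cartan subgroup $C\subset\mathrm{GL}(E[p])$ such that $\bar\rho(G_K)$ is contained in the normaliser of $C$ and $\bar\rho^{-1}(C)=\mathrm{Gal}(\overline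 K/K(\sqrt d))$. Every isomorphism of $G_K$-modules $\phi:E[p]\to E^d[p]$ is symplectic if either $C$ is split and $p\equiv1\pmod 4$, or $C$ is non-split and $p\equiv3\pmod 4$; otherwise every such $\phi$ is anti-symplectic. No such $\phi$ is both symplectic and anti-symplectic. (2) Suppose that the image of $\bar\rho$ in $\mathrm{PGL}(E[p])$ is isomorphic to $C_2\times C_2$. Then there are exactly three non-trivial classes $e\in K^*/(K^*)^2$ (equivalently, three quadratic extensions $K(\sqrt e)/K$) such that $E^e$ is $p$-congruent to $E$. If $j(E)\ne1728$, the three twists are pairwise non-isomorphic over $K$, and none is isomorphic to $E$ over $K$. If $j(E)=1728$, one of the three classes is that of $-1$. If $\sqrt{p^*}\in K$, then for each of the three classes $e$ every isomorphism $E[p]\cong E^e[p]$ of $G_K$-modules is symplectic and not anti-symplectic. If $\sqrt{p^*}\notin K$, then one of the three classes is that of $p^*$; for this class every isomorphism $E[p]\cong E^{e}[p]$ of $G_K$-modules is symplectic and not anti-symplectic, while for the other two classes every such isomorphism is anti-symplectic and not symplectic. -/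

import Mathlib

noncomputable section

namespace EllipticCongruence

open WeierstrassCurve WeierstrassCurve.Affine TensorProduct

/-! ### The Weil pairing over an algebraically closed field -/

section WeilPairing

variable {F : Type*} [Field F] {W : WeierstrassCurve.Affine F}

/-- The value of a regular function on the affine part of `W` at an affine point.  (At the point at
infinity it is set to `0`; this value is never used below.) -/
def value (f : W.CoordinateRing) : W.Point → F
  | .zero => 0
  | .some _ _ h => AdjoinRoot.evalEval h.1 f

/-- The ideal of regular functions vanishing at a point; it is the unit ideal for the point at
infinity, which does not lie on the affine part. -/
def pointIdeal : W.Point → Ideal W.CoordinateRing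
  | .zero => ⊤
  | .some x y _ => CoordinateRing.XYIdeal W x (Polynomial.C y)

variable [DecidableEq F]

/-- `ζ` is the value `eₙ(S, T)` of the Weil pairing (for `n`-torsion points `S`, `T` on an elliptic
curve over an algebraically closed field): there are a function `f` with divisor `n(T) - n(O)`,
and a rational function `g = a / b` with `gⁿ = f ∘ [n]`, such that
`g(X + S) = ζ g(X)` for all points `X` where this makes sense.

As `f` is regular away from `O`, the condition `div f = n(T) - n(O)` says that the ideal
generated by `f` in the affine coordinate ring is the `n`-th power of the ideal of `T`. -/
def IsWeilPairingValue (n : ℕ) (S T : W.Point) (ζ : F) : Prop :=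
  ∃ f a b : W.CoordinateRing,
    Ideal.span {f} = pointIdeal T ^ n ∧ a ≠ 0 ∧ b ≠ 0 ∧
    (∀ X : W.Point, n • X ≠ 0 → value a X ^ n = value b X ^ n * value f (n • X)) ∧
    ∀ X : W.Point, X ≠ 0 → X + S ≠ 0 →
      value a (X + S) * value b X = ζ * (value a X * value b (X + S))

/-- The Weil pairing `eₙ(S, T)`. -/
def weilPairing (n : ℕ) (S T : W.Point) : F :=
  Classical.epsilon (IsWeilPairingValue n S T)

end WeilPairing

/-! ### Mod `p` Galois representations and congruences -/

section Galois

variable {K : Type*} [Field K] [DecidableEq (AlgebraicClosure K)]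

/-- The group of geometric points `E(K̄)`. -/
abbrev GeomPoint (E : WeierstrassCurve K) : Type _ :=
  (WeierstrassCurve.Affine.baseChange E (AlgebraicClosure K)).Point

/-- The group `E[p]` of `p`-torsion points of `E(K̄)`. -/
abbrev Torsion (p : ℕ) (E : WeierstrassCurve K) : Type _ :=
  AddSubgroup.torsionBy (GeomPoint E) (p : ℤ)

instance torsionModule (p : ℕ) (E : WeierstrassCurve K) : Module (ZMod p) (Torsion p E) :=
  AddSubgroup.torsionBy.zmodModule

/-- The action of a Galois automorphism on `E[p]`, through coordinates. -/
def galoisAct (p : ℕ) (E : WeierstrassCurve K) (σ : Gal(AlgebraicClosure K/K)) :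
    Torsion p E →+ Torsion p E where
  toFun P := ⟨Point.map (W' := E) σ.toAlgHom P.1, by
    have h := P.2
    rw [AddSubgroup.torsionBy.nsmul_iff] at h ⊢
    rw [← map_nsmul, h, map_zero]⟩
  map_zero' := by ext; simp
  map_add' P Q := by ext; simp

/-- The representation of `G_K = Gal(K̄/K)` on the `𝔽_p`-vector space `E[p]`. -/
def galoisRep (p : ℕ) (E : WeierstrassCurve K) :
    Representation (ZMod p) Gal(AlgebraicClosure K/K) (Torsion p E) where
  toFun σ := (galoisAct p E σ).toZModLinearMap p
  map_one' := by
    ext P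
    exact Point.map_id (W' := E) P.1
  map_mul' σ τ := by
    ext P
    exact (Point.map_map (W' := E) τ.toAlgHom σ.toAlgHom P.1).symm

/-- The homomorphism `ρ̄_{E,p} : G_K → GL(E[p])`. -/
def rho (p : ℕ) (E : WeierstrassCurve K) :
    Gal(AlgebraicClosure K/K) →* LinearMap.GeneralLinearGroup (ZMod p) (Torsion p E) :=
  MonoidHom.toHomUnits (galoisRep p E)

/-- A representation is absolutely irreducible if its extension of scalars to an algebraic closure
is irreducible. -/
def IsAbsolutelyIrreducible {G k V : Type*} [Group G] [Field k] [AddCommGroup V] [Module k V]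
    (ρ : Representation k G V) : Prop :=
  Representation.IsIrreducible
    (((Module.End.baseChangeHom k (AlgebraicClosure k) V : _ →* _).comp ρ :
      Representation (AlgebraicClosure k) G (AlgebraicClosure k ⊗[k] V)))

/-- The image of `ρ̄_{E,p}` in `PGL(E[p]) = GL(E[p]) / centre`. -/
def projectiveImage (p : ℕ) (E : WeierstrassCurve K) :
    Subgroup (LinearMap.GeneralLinearGroup (ZMod p) (Torsion p E) ⧸
      Subgroup.center (LinearMap.GeneralLinearGroup (ZMod p) (Torsion p E))) :=
  (rho p E).range.map (QuotientGroup.mk' _)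

/-- Isomorphisms `E[p] → E'[p]` of `G_K`-modules. -/
abbrev TorsionIso (p : ℕ) (E E' : WeierstrassCurve K) : Type _ :=
  (galoisRep p E).Equiv (galoisRep p E')

/-- `E` and `E'` are `p`-congruent. -/
def Congruent (p : ℕ) (E E' : WeierstrassCurve K) : Prop :=
  Nonempty (TorsionIso p E E')

/-- `e_{E',p}(φ P, φ Q) = e_{E,p}(P, Q) ^ d` for all `P, Q ∈ E[p]`. -/
def HasMultiplier {p : ℕ} {E E' : WeierstrassCurve K} (φ : TorsionIso p E E') (d : (ZMod p)ˣ) :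
    Prop :=
  ∀ P Q : Torsion p E,
    weilPairing p (φ P : GeomPoint E') (φ Q : GeomPoint E') =
      weilPairing p (P : GeomPoint E) (Q : GeomPoint E) ^ (d : ZMod p).val

/-- `φ` multiplies the Weil pairing by a square. -/
def IsSymplectic {p : ℕ} {E E' : WeierstrassCurve K} (φ : TorsionIso p E E') : Prop :=
  ∃ d : (ZMod p)ˣ, HasMultiplier φ d ∧ IsSquare d

/-- `φ` multiplies the Weil pairing by a non-square. -/
def IsAntisymplectic {p : ℕ} {E E' : WeierstrassCurve K} (φ : TorsionIso p E E') : Prop :=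
  ∃ d : (ZMod p)ˣ, HasMultiplier φ d ∧ ¬ IsSquare d

end Galois

/-! ### Quadratic twists -/

section Twist

variable {K : Type*} [Field K]

/-- The quadratic twist `E^d` (in characteristic `≠ 2`).  Completing the square turns `E` into
`y² = x³ + (b₂/4) x² + (b₄/2) x + b₆/4`, and `E^d` is
`y² = x³ + d (b₂/4) x² + d² (b₄/2) x + d³ (b₆/4)`. -/
def quadraticTwist (E : WeierstrassCurve K) (d : K) : WeierstrassCurve K where
  a₁ := 0
  a₂ := d * (E.b₂ / 4)
  a₃ := 0
  a₄ := d ^ 2 * (E.b₄ / 2)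
  a₆ := d ^ 3 * (E.b₆ / 4)

/-- On short Weierstrass equations, the twist by `d` sends `(a, b)` to `(a d², b d³)`. -/
theorem quadraticTwist_short (h2 : (2 : K) ≠ 0) (a b d : K) :
    quadraticTwist ⟨0, 0, 0, a, b⟩ d = ⟨0, 0, 0, a * d ^ 2, b * d ^ 3⟩ := by
  have h4 : (4 : K) ≠ 0 := by
    have : (4 : K) = 2 * 2 := by norm_num
    rw [this]; exact mul_ne_zero h2 h2
  simp only [quadraticTwist, WeierstrassCurve.b₂, WeierstrassCurve.b₄, WeierstrassCurve.b₆]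
  congr 1 <;> field_simp <;> ring

/-- `E` and `E'` are isomorphic over `K`. -/
def IsomorphicOver (E E' : WeierstrassCurve K) : Prop :=
  ∃ C : WeierstrassCurve.VariableChange K, C • E = E'

/-- The subgroup `Gal(K̄/K(√d))` of `G_K`. -/
def galSqrt (d : K) : Subgroup Gal(AlgebraicClosure K/K) :=
  (IntermediateField.adjoin K
    {r : AlgebraicClosure K | r ^ 2 = algebraMap K (AlgebraicClosure K) d}).fixingSubgroup

end Twist

/-! ### Cartan subgroups of `GL₂(𝔽_p)`, for odd `p` -/

section Cartan

variable {p : ℕ} {V : Type*} [AddCommGroup V] [Module (ZMod p) V]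

/-- Split Cartan subgroup: in some basis of the plane `V`, the group of all invertible diagonal
matrices. -/
def IsSplitCartan (C : Subgroup (LinearMap.GeneralLinearGroup (ZMod p) V)) : Prop :=
  ∃ b : Module.Basis (Fin 2) (ZMod p) V, ∀ g, g ∈ C ↔
    ∃ x y : ZMod p, LinearMap.toMatrix b b (g : V →ₗ[ZMod p] V) = !![x, 0; 0, y]

/-- Non-split Cartan subgroup: in some basis of the plane `V`, the unit group of the quadratic field
extension `𝔽_p(√δ)`, `δ` a non-square, acting on itself by multiplication. -/
def IsNonsplitCartan (C : Subgroup (LinearMap.GeneralLinearGroup (ZMod p) V)) : Prop :=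
  ∃ b : Module.Basis (Fin 2) (ZMod p) V, ∃ δ : ZMod p, ¬ IsSquare δ ∧ ∀ g, g ∈ C ↔
    ∃ x y : ZMod p, LinearMap.toMatrix b b (g : V →ₗ[ZMod p] V) = !![x, δ * y; y, x]

end Cartan

/-- `C` is a Cartan subgroup of `GL(E[p])` associated to the extension `K(√d)/K`: the image of
`ρ̄_{E,p}` lies in the normalizer of `C`, and the preimage of `C` in `G_K` is `Gal(K̄/K(√d))`. -/
structure IsAssociatedCartan {K : Type*} [Field K] [DecidableEq (AlgebraicClosure K)] (p : ℕ)
    (E : WeierstrassCurve K) (d : K)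
    (C : Subgroup (LinearMap.GeneralLinearGroup (ZMod p) (Torsion p E))) : Prop where
  cartan : IsSplitCartan C ∨ IsNonsplitCartan C
  range_le : (rho p E).range ≤ Subgroup.normalizer (C : Set _)
  comap_eq : C.comap (rho p E) = galSqrt d

/-- `p* = (-1)^((p-1)/2) p`, for odd `p`. -/
def pStar (p : ℕ) : ℤ := (-1) ^ ((p - 1) / 2) * p

end EllipticCongruence

end

open EllipticCongruence

set_option linter.unusedSectionVars false


/-! Over the algebraic closure a curve E and its twist E^d are isomorphic, and Galois respects the
isomorphism up to the quadratic character χ_d of K(√d) (`galoisRep_twist`). Following a congruence φ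
: E[p] → E^d[p] by the inverse of this isomorphism gives an automorphism A of E[p] with A ρ(σ) =
χ_d(σ) ρ(σ) A. The isomorphism preserves Weil pairings and an endomorphism of E[p] raises them to
its determinant, so φ is symplectic exactly when det A is a square
(`TorsionIso.exists_twistCommutes`). The rest is linear algebra of such A.

One twist. Since d is not a square, A is conjugate to −A. So A has trace zero, A² = −det A, and its
centralizer is a Cartan subgroup, split exactly when −det A is a square. This centralizer is
normalised by the image of ρ and meets it in ρ(ker χ_d). Absolute irreducibility provides a
non-scalar element in ρ(ker χ_d), and a Cartan subgroup is the centralizer of each of its non-scalar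
elements; hence uniqueness. The condition p mod 4 only translates between det A and −det A
(`associatedCartan_of_congruent`).

Projective image C₂ × C₂. Any two elements of the image commute up to sign, so for lifts s i of the
three non-trivial elements ρ(s i) is itself an operator A for some quadratic character, that of K(√D
i) say. By Schur's lemma A is unique up to scalars for a given character, and a non-trivial
character of C₂ × C₂ kills exactly one s i. So the D i are the only classes, and the type of a
congruence is that of det ρ(s i) modulo squares. As det ρ is the cyclotomic character, a Gauss sum
identifies its quadratic residue symbol with the character of K(√p*) (`quadChar_pStar_eq_one_iff`).

Most of the work is to show that the pairing, as defined, is well defined, bilinear, alternating,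
non-trivial, and compatible with Galois and with changes of coordinates. Functions are handled
through their values at almost all points. If f has divisor n(T) − n(O), the product of its values
at three collinear points is a constant times the n-th power of the value at T of the equation of
the line (`exists_value_line`). Hence f is additive modulo n-th powers, and f ∘ [n] is an n-th power
g^n. The pairing is alternating because a product of translates of f is constant. If it were trivial
in the first variable, g would be a function of nX, and the ideal of T would be principal.

For p = 3 and j = 0 a 3-torsion point with x-coordinate −b₂/12 spans a Galois-stable line. For j =
1728 the automorphism of order four gives the congruence with the twist by −1; for j ≠ 1728 the
invariant c₆ separates the twists. -/

noncomputable section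

namespace EllipticCongruence

open WeierstrassCurve WeierstrassCurve.Affine Polynomial
open scoped Polynomial.Bivariate

/-! ### Values of regular functions -/

section Values

variable {F : Type*} [Field F] {W : WeierstrassCurve.Affine F}

/-- The first coordinate of a point (`0` at infinity). -/
def xCoord : W.Point → F
  | .zero => 0
  | .some x _ _ => x

/-- The second coordinate of a point (`0` at infinity). -/
def yCoord : W.Point → F
  | .zero => 0
  | .some _ y _ => y

@[simp] lemma xCoord_some {x y : F} (h : W.Nonsingular x y) : xCoord (.some x y h) = x := rfl

@[simp] lemma yCoord_some {x y : F} (h : W.Nonsingular x y) : yCoord (.some x y h) = y := rfl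

lemma exists_eq_some {X : W.Point} (hX : X ≠ 0) :
    ∃ h : W.Nonsingular (xCoord X) (yCoord X), X = .some _ _ h := by
  cases X with
  | zero => exact absurd rfl hX
  | some x y h => exact ⟨h, rfl⟩

lemma nonsingular_coord {X : W.Point} (hX : X ≠ 0) : W.Nonsingular (xCoord X) (yCoord X) :=
  (exists_eq_some hX).1

lemma ext_coord {X P : W.Point} (hX : X ≠ 0) (hP : P ≠ 0) (hx : xCoord X = xCoord P)
    (hy : yCoord X = yCoord P) : X = P := by
  obtain ⟨_, h⟩ := exists_eq_some hX
  obtain ⟨_, h'⟩ := exists_eq_some hP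
  rw [h, h', Point.some.injEq]
  exact ⟨hx, hy⟩

lemma equation_coord {X : W.Point} (hX : X ≠ 0) :
    yCoord X ^ 2 + W.a₁ * xCoord X * yCoord X + W.a₃ * yCoord X =
      xCoord X ^ 3 + W.a₂ * xCoord X ^ 2 + W.a₄ * xCoord X + W.a₆ :=
  (W.equation_iff _ _).mp (nonsingular_coord hX).1

@[simp] lemma xCoord_neg (X : W.Point) : xCoord (-X) = xCoord X := by
  cases X <;> rfl

lemma yCoord_neg {X : W.Point} (hX : X ≠ 0) :
    yCoord (-X) = -yCoord X - W.a₁ * xCoord X - W.a₃ := by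
  cases X with
  | zero => exact absurd rfl hX
  | some x y h => rfl

/-- Evaluation at an affine point, as a ring homomorphism. -/
def valueHom (X : W.Point) (hX : X ≠ 0) : W.CoordinateRing →+* F :=
  AdjoinRoot.evalEval (nonsingular_coord hX).1

lemma valueHom_apply (X : W.Point) (hX : X ≠ 0) (f : W.CoordinateRing) :
    valueHom X hX f = value f X := by
  cases X with
  | zero => exact absurd rfl hX
  | some x y h => rfl

@[simp] lemma value_at_zero (f : W.CoordinateRing) : value f 0 = 0 := rfl

lemma value_add (f g : W.CoordinateRing) (X : W.Point) :
    value (f + g) X = value f X + value g X := by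
  by_cases hX : X = 0
  · simp [hX]
  · simp only [← valueHom_apply X hX, map_add]

lemma value_sub (f g : W.CoordinateRing) (X : W.Point) :
    value (f - g) X = value f X - value g X := by
  by_cases hX : X = 0
  · simp [hX]
  · simp only [← valueHom_apply X hX, map_sub]

lemma value_mul (f g : W.CoordinateRing) (X : W.Point) :
    value (f * g) X = value f X * value g X := by
  by_cases hX : X = 0
  · simp [hX]
  · simp only [← valueHom_apply X hX, map_mul]

@[simp] lemma value_zero (X : W.Point) : value (0 : W.CoordinateRing) X = 0 := by
  by_cases hX : X = 0
  · simp [hX]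
  · simp only [← valueHom_apply X hX, map_zero]

lemma value_one {X : W.Point} (hX : X ≠ 0) : value (1 : W.CoordinateRing) X = 1 := by
  simp only [← valueHom_apply X hX, map_one]

lemma value_pow {X : W.Point} (hX : X ≠ 0) (f : W.CoordinateRing) (n : ℕ) :
    value (f ^ n) X = value f X ^ n := by
  simp only [← valueHom_apply X hX, map_pow]

lemma value_mk_C {X : W.Point} (hX : X ≠ 0) (a : F[X]) :
    value (CoordinateRing.mk W (C a)) X = a.eval (xCoord X) := by
  cases X with
  | zero => exact absurd rfl hX
  | some x y h => simp [value, AdjoinRoot.evalEval]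

lemma value_mk_Y {X : W.Point} (hX : X ≠ 0) :
    value (CoordinateRing.mk W Y) X = yCoord X := by
  cases X with
  | zero => exact absurd rfl hX
  | some x y h => simp [value, AdjoinRoot.evalEval]

/-- The constant function `c`. -/
abbrev const (c : F) : W.CoordinateRing := algebraMap F W.CoordinateRing c

lemma const_eq_mk (c : F) : (const c : W.CoordinateRing) = CoordinateRing.mk W (C (C c)) := rfl

lemma value_const {X : W.Point} (hX : X ≠ 0) (c : F) :
    value (const c : W.CoordinateRing) X = c := by
  rw [const_eq_mk, value_mk_C hX, eval_C]

/-- The regular function `a(x) + b(x) y`. -/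
def ofPair (a b : F[X]) : W.CoordinateRing :=
  a • (1 : W.CoordinateRing) + b • CoordinateRing.mk W Y

lemma exists_ofPair (f : W.CoordinateRing) : ∃ a b, f = ofPair a b := by
  obtain ⟨a, b, h⟩ := CoordinateRing.exists_smul_basis_eq f
  exact ⟨a, b, h.symm⟩

lemma ofPair_eq (a b : F[X]) : (ofPair a b : W.CoordinateRing) =
    CoordinateRing.mk W (C a) + CoordinateRing.mk W (C b) * CoordinateRing.mk W Y := by
  rw [ofPair, CoordinateRing.smul, CoordinateRing.smul, mul_one]

lemma value_ofPair {X : W.Point} (hX : X ≠ 0) (a b : F[X]) :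
    value (ofPair a b) X = a.eval (xCoord X) + b.eval (xCoord X) * yCoord X := by
  rw [ofPair_eq, value_add, value_mul, value_mk_C hX, value_mk_C hX, value_mk_Y hX]

/-- The norm of `a + b y` from the function field to `F(x)`. -/
def pairNorm (W : WeierstrassCurve.Affine F) (a b : F[X]) : F[X] :=
  a ^ 2 - a * b * (C W.a₁ * X + C W.a₃) -
    b ^ 2 * (X ^ 3 + C W.a₂ * X ^ 2 + C W.a₄ * X + C W.a₆)

lemma norm_ofPair (a b : F[X]) :
    Algebra.norm F[X] (ofPair a b : W.CoordinateRing) = pairNorm W a b :=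
  CoordinateRing.norm_smul_basis a b

/-- The function `X ↦ f (-X)`. -/
def conjPair (W : WeierstrassCurve.Affine F) (a b : F[X]) : W.CoordinateRing :=
  ofPair (a - b * (C W.a₁ * X + C W.a₃)) (-b)

lemma neg_point_ne_zero {X : W.Point} (hX : X ≠ 0) : -X ≠ 0 := by
  cases X with
  | zero => exact absurd rfl hX
  | some x y h => exact Point.some_ne_zero _

lemma value_conjPair (a b : F[X]) (X : W.Point) :
    value (conjPair W a b) X = value (ofPair a b) (-X) := by
  by_cases hX : X = 0
  · simp [hX]
  · rw [conjPair, value_ofPair hX, value_ofPair (neg_point_ne_zero hX), xCoord_neg, yCoord_neg hX]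
    simp
    ring

/-- Conjugation over F(x) is composition with X ↦ −X. This reduces questions about zeros of a
function to polynomials in one variable. -/
lemma eval_pairNorm {X : W.Point} (hX : X ≠ 0) (a b : F[X]) :
    (pairNorm W a b).eval (xCoord X) = value (ofPair a b) X * value (ofPair a b) (-X) := by
  have hX' := neg_point_ne_zero hX
  rw [value_ofPair hX, value_ofPair hX', xCoord_neg, yCoord_neg hX, pairNorm]
  simp
  linear_combination (eval (xCoord X) b) ^ 2 * equation_coord hX

lemma pairNorm_ne_zero {a b : F[X]} (h : (ofPair a b : W.CoordinateRing) ≠ 0) :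
    pairNorm W a b ≠ 0 := by
  have : Module.Finite F[X] W.CoordinateRing := .of_basis (CoordinateRing.basis W)
  rw [← norm_ofPair]
  exact fun h' ↦ h (Algebra.norm_eq_zero_iff.mp h')

lemma degree_pairNorm (a b : F[X]) :
    (pairNorm W a b).degree = max (2 • a.degree) (2 • b.degree + 3) := by
  rw [← norm_ofPair]
  exact CoordinateRing.degree_norm_smul_basis a b

lemma xCoord_eq_iff {X P : W.Point} (hX : X ≠ 0) (hP : P ≠ 0) :
    xCoord X = xCoord P ↔ X = P ∨ X = -P := by
  cases X with
  | zero => exact absurd rfl hX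
  | some x y h =>
    cases P with
    | zero => exact absurd rfl hP
    | some x' y' h' => exact Point.X_eq_iff

lemma finite_xCoord_eq (x : F) : {X : W.Point | xCoord X = x}.Finite := by
  by_cases h : ∃ X₀ : W.Point, X₀ ≠ 0 ∧ xCoord X₀ = x
  · obtain ⟨X₀, h0, rfl⟩ := h
    refine (Set.toFinite {0, X₀, -X₀}).subset fun X hX ↦ ?_
    by_cases hX0 : X = 0
    · simp [hX0]
    · rcases (xCoord_eq_iff hX0 h0).mp hX with h | h <;> simp [h]
  · refine (Set.finite_singleton 0).subset fun X hX ↦ ?_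
    by_contra hX0
    exact h ⟨X, hX0, hX⟩

lemma finite_root_xCoord {a : F[X]} (ha : a ≠ 0) :
    {X : W.Point | a.eval (xCoord X) = 0}.Finite := by
  have : {X : W.Point | a.eval (xCoord X) = 0} ⊆
      ⋃ x ∈ (a.rootSet_finite F).toFinset, {X : W.Point | xCoord X = x} := by
    intro X hX
    simp only [Set.Finite.mem_toFinset, Set.mem_iUnion, Set.mem_ofPred_eq, exists_prop]
    exact ⟨xCoord X, by simpa [mem_rootSet, ha] using hX, rfl⟩
  exact (Set.Finite.biUnion (Finset.finite_toSet _) fun x _ ↦ finite_xCoord_eq x).subset this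

lemma finite_value_eq_zero {f : W.CoordinateRing} (hf : f ≠ 0) :
    {X : W.Point | value f X = 0}.Finite := by
  obtain ⟨a, b, rfl⟩ := exists_ofPair f
  refine ((finite_root_xCoord (pairNorm_ne_zero hf)).union (Set.finite_singleton 0)).subset ?_
  intro X hX
  by_cases h0 : X = 0
  · right; exact h0
  · left
    rw [Set.mem_ofPred_eq, eval_pairNorm h0, show value (ofPair a b) X = 0 from hX, zero_mul]

lemma exists_point [IsAlgClosed F] [W.IsElliptic] (x : F) :
    ∃ X : W.Point, X ≠ 0 ∧ xCoord X = x := by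
  obtain ⟨y, hy⟩ := IsAlgClosed.exists_root
    (C 1 * X ^ 2 + C (W.a₁ * x + W.a₃) * X + C (-(x ^ 3 + W.a₂ * x ^ 2 + W.a₄ * x + W.a₆)) : F[X])
    (by rw [degree_quadratic one_ne_zero]; decide)
  have : W.Equation x y := by
    rw [equation_iff]
    simp at hy
    linear_combination hy
  exact ⟨.some x y (equation_iff_nonsingular.mp this), Point.some_ne_zero _, rfl⟩

instance [IsAlgClosed F] [W.IsElliptic] : Infinite W.Point := by
  have : Infinite F := IsAlgClosed.instInfinite
  choose g hg using fun x : F ↦ exists_point (W := W) x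
  exact Infinite.of_injective g fun x y h ↦ by rw [← (hg x).2, h, (hg y).2]

/-- There are infinitely many points, and a nonzero function has finitely many zeros because its
norm does. Identities between functions may therefore be checked at almost all points. -/
lemma eq_zero_of_value [IsAlgClosed F] [W.IsElliptic] {f : W.CoordinateRing}
    (hf : ∀ᶠ X in Filter.cofinite, value f X = 0) : f = 0 := by
  by_contra h
  have h1 : ∀ᶠ X in Filter.cofinite, value f X ≠ 0 := by
    simpa [Filter.eventually_cofinite] using finite_value_eq_zero h
  obtain ⟨X, h2, h3⟩ := (hf.and h1).exists
  exact h3 h2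

lemma eventually_value_ne_zero {f : W.CoordinateRing} (hf : f ≠ 0) :
    ∀ᶠ X in Filter.cofinite, value f X ≠ 0 := by
  simpa [Filter.eventually_cofinite] using finite_value_eq_zero hf

lemma eventually_eval_xCoord_ne_zero {a : F[X]} (ha : a ≠ 0) :
    ∀ᶠ X : W.Point in Filter.cofinite, a.eval (xCoord X) ≠ 0 := by
  simpa [Filter.eventually_cofinite] using finite_root_xCoord ha

lemma eventually_ne (P : W.Point) : ∀ᶠ X : W.Point in Filter.cofinite, X ≠ P := by
  simp [Filter.eventually_cofinite]

/-! ### Ideals of points, constants -/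

lemma mem_pointIdeal {T : W.Point} (hT : T ≠ 0) (f : W.CoordinateRing) :
    f ∈ pointIdeal T ↔ value f T = 0 := by
  cases T with
  | zero => exact absurd rfl hT
  | some x y h =>
    set T : W.Point := .some x y h with hTdef
    have key : ∀ g ∈ pointIdeal T, value g T = 0 := by
      intro g hg
      have : pointIdeal T ≤ RingHom.ker (valueHom T hT) := by
        change CoordinateRing.XYIdeal W x (C y) ≤ _
        rw [CoordinateRing.XYIdeal, Ideal.span_le]
        rintro g (rfl | rfl)
        · rw [SetLike.mem_coe, RingHom.mem_ker, valueHom_apply, CoordinateRing.XClass,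
            value_mk_C hT]
          simp [T]
        · rw [SetLike.mem_coe, RingHom.mem_ker, valueHom_apply, CoordinateRing.YClass, map_sub,
            value_sub, value_mk_C hT, value_mk_Y hT]
          simp [T]
      rw [← valueHom_apply T hT]
      exact this hg
    refine ⟨key f, fun hf ↦ ?_⟩
    -- The quotient by the ideal is F, so f is a constant modulo the ideal; evaluation at T shows
    -- that the constant is 0.
    have hq := (CoordinateRing.quotientXYIdealEquiv (W' := W) (x := x) (y := C y) h.1)
    obtain ⟨c, hc⟩ : ∃ c : F, f - const c ∈ pointIdeal T := by
      refine ⟨hq (Ideal.Quotient.mk _ f), ?_⟩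
      change _ ∈ CoordinateRing.XYIdeal W x (C y)
      rw [← Ideal.Quotient.eq]
      apply hq.injective
      rw [← Ideal.Quotient.mkₐ_eq_mk F, AlgHom.commutes]
      simp
    have h0 := key _ hc
    rw [value_sub, hf, value_const hT, zero_sub, neg_eq_zero] at h0
    simpa [h0] using hc

lemma pointIdeal_zero : pointIdeal (0 : W.Point) = ⊤ := rfl

/-- The norm of a unit has degree 0, while that of a + b y has degree max(2 deg a, 2 deg b + 3).
This forces b = 0 and a constant. -/
lemma exists_const_of_isUnit {f : W.CoordinateRing} (hf : IsUnit f) :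
    ∃ c : F, c ≠ 0 ∧ f = const c := by
  obtain ⟨a, b, rfl⟩ := exists_ofPair f
  have h1 : IsUnit (pairNorm W a b) := by
    rw [← norm_ofPair]; exact hf.map _
  have h2 := Polynomial.degree_eq_zero_of_isUnit h1
  rw [degree_pairNorm] at h2
  have hb : b = 0 := by
    by_contra hb
    have h3 : 2 • b.degree + 3 ≤ 0 := h2 ▸ le_max_right _ _
    rw [degree_eq_natDegree hb] at h3
    have : ((2 • b.natDegree + 3 : ℕ) : WithBot ℕ) ≤ ((0 : ℕ) : WithBot ℕ) := by
      simpa using h3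
    rw [Nat.cast_le] at this
    omega
  subst hb
  have ha : a.degree ≤ 0 := by
    by_contra ha
    push Not at ha
    have h3 : 2 • a.degree ≤ 0 := h2 ▸ le_max_left _ _
    have ha0 : a ≠ 0 := by rintro rfl; simp at ha
    rw [degree_eq_natDegree ha0] at h3 ha
    have h4 : ((2 • a.natDegree : ℕ) : WithBot ℕ) ≤ ((0 : ℕ) : WithBot ℕ) := by
      simpa using h3
    rw [Nat.cast_le] at h4
    have : a.natDegree = 0 := by simpa using h4
    simp [this] at ha
  rw [eq_C_of_degree_le_zero ha] at hf ⊢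
  have e : (ofPair (C (a.coeff 0)) 0 : W.CoordinateRing) = const (a.coeff 0) := by
    rw [ofPair_eq, const_eq_mk]; simp
  rw [e] at hf ⊢
  refine ⟨_, ?_, rfl⟩
  intro h
  rw [h] at hf
  simp [const] at hf

end Values

end EllipticCongruence

end



noncomputable section

namespace EllipticCongruence

open WeierstrassCurve WeierstrassCurve.Affine Polynomial
open scoped Polynomial.Bivariate

/-! ### Multiplication by `n` on first coordinates -/

section AddSub

variable {F : Type*} [Field F] {W : WeierstrassCurve.Affine F}

lemma eval_addSubMap (s : Fin 3 → F) :
    (fun i ↦ (WeierstrassCurve.addSubMap W i).eval s) =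
      ![s 0 ^ 2 - W.b₄ * s 0 * s 2 - W.b₆ * s 1 * s 2 - W.b₈ * s 2 ^ 2,
        2 * s 1 * s 0 + W.b₂ * s 0 * s 2 + W.b₄ * s 1 * s 2 + W.b₆ * s 2 ^ 2,
        s 1 ^ 2 - 4 * s 0 * s 2] := by
  ext i
  fin_cases i <;> simp [WeierstrassCurve.addSubMap]

variable [DecidableEq F] [W.IsElliptic]

lemma addSubMap_sym2x_self (P : W.Point) : ∃ c : F, c ≠ 0 ∧
    (fun i ↦ (WeierstrassCurve.addSubMap W i).eval (P.sym2x P)) = c • (P + P).sym2x 0 := by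
  cases P with
  | zero =>
    refine ⟨1, one_ne_zero, ?_⟩
    rw [eval_addSubMap, ← Point.zero_def]
    ext i; fin_cases i <;> simp
  | some x y h =>
    have heq := (W.equation_iff _ _).mp h.1
    by_cases hy : y = W.negY x y
    · rw [Point.add_self_of_Y_eq hy]
      -- Here P has order 2. The last two coordinates vanish, so the first cannot: the map has no
      -- non-trivial common zero.
      have hne := WeierstrassCurve.addSubMap_ne_zero W (Point.sym2x_ne_zero (.some x y h) (.some x y h))
      rw [eval_addSubMap] at hne ⊢
      rw [negY] at hy
      have h1 : 2 * y + W.a₁ * x + W.a₃ = 0 := by linear_combination hy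
      have e1 : 2 * (x + x) * (x * x) + W.b₂ * (x * x) + W.b₄ * (x + x) + W.b₆ = 0 := by
        simp only [b₂, b₄, b₆]
        linear_combination (2 * y + W.a₁ * x + W.a₃) * h1 - 4 * heq
      have e2 : (x + x) ^ 2 - 4 * (x * x) = 0 := by ring
      simp only [Point.sym2x_some_some] at hne ⊢
      refine ⟨(x * x) ^ 2 - W.b₄ * (x * x) - W.b₆ * (x + x) - W.b₈, fun h0 ↦ hne ?_, ?_⟩
      · ext i; fin_cases i <;> simp [h0, e1, e2]
      · ext i; fin_cases i <;> simp [e1, e2]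
    · rw [Point.add_self_of_Y_ne hy, eval_addSubMap]
      have hy' : y - W.negY x y ≠ 0 := sub_ne_zero.mpr hy
      refine ⟨(y - W.negY x y) ^ 2, pow_ne_zero 2 hy', ?_⟩
      rw [Point.sym2x_some_some, Point.sym2x_some_zero, slope_of_Y_ne rfl hy, addX]
      set l := (3 * x ^ 2 + 2 * W.a₂ * x + W.a₄ - W.a₁ * y) / (y - W.negY x y) with hl
      have hl' : l * (y - W.negY x y) = 3 * x ^ 2 + 2 * W.a₂ * x + W.a₄ - W.a₁ * y := by
        rw [hl, div_mul_cancel₀ _ hy']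
      clear_value l
      ext i; fin_cases i
      · simp only [negY, b₄, b₆, b₈] at hl' ⊢
        simp
        grind
      · simp only [negY, b₂, b₄, b₆] at hy' ⊢
        simp
        linear_combination -4 * heq
      · simp
        ring

/-- An unordered pair of x-coordinates is recorded by (product : sum : 1). In these terms the
passage from {P, Q} to {P + Q, P − Q} is polynomial, which makes a recursion for x(nX) possible. -/
lemma exists_addSubMap_sym2x (P Q : W.Point) : ∃ c : F, c ≠ 0 ∧
    (fun i ↦ (WeierstrassCurve.addSubMap W i).eval (P.sym2x Q)) =
      c • (P + Q).sym2x (P - Q) := by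
  by_cases hPQ : P = Q
  · subst hPQ
    simpa using addSubMap_sym2x_self P
  by_cases hPQ' : P = -Q
  · subst hPQ'
    obtain ⟨c, hc, h⟩ := addSubMap_sym2x_self Q
    refine ⟨c, hc, ?_⟩
    rw [Point.sym2x_neg_left, h, neg_add_cancel, Point.sym2x_comm, ← neg_add',
      Point.sym2x_neg_right]
  cases P with
  | zero =>
    cases Q with
    | zero => exact absurd rfl hPQ
    | some x y h =>
      refine ⟨1, one_ne_zero, ?_⟩
      rw [eval_addSubMap, ← Point.zero_def, zero_add, zero_sub, Point.sym2x_neg_right]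
      ext i; fin_cases i <;> simp <;> ring
  | some x₁ y₁ h₁ =>
    cases Q with
    | zero =>
      refine ⟨1, one_ne_zero, ?_⟩
      rw [eval_addSubMap, ← Point.zero_def, add_zero, sub_zero]
      ext i; fin_cases i <;> simp <;> ring
    | some x₂ y₂ h₂ =>
      have hx : x₁ ≠ x₂ := fun h ↦ (Point.X_eq_iff.mp h).elim hPQ hPQ'
      have hx' : x₁ - x₂ ≠ 0 := sub_ne_zero.mpr hx
      have e1 := (W.equation_iff _ _).mp h₁.1
      have e2 := (W.equation_iff _ _).mp h₂.1
      refine ⟨(x₁ - x₂) ^ 2, pow_ne_zero 2 hx', ?_⟩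
      rw [eval_addSubMap, sub_eq_add_neg (Point.some _ _ h₁), Point.neg_some,
        Point.add_some fun h ↦ hx h.1, Point.add_some fun h ↦ hx h.1, Point.sym2x_some_some, Point.sym2x_some_some,
        slope_of_X_ne hx, slope_of_X_ne hx, addX, addX]
      set l := (y₁ - y₂) / (x₁ - x₂) with hl
      set m := (y₁ - W.negY x₂ y₂) / (x₁ - x₂) with hm
      have hl' : l * (x₁ - x₂) = y₁ - y₂ := by rw [hl, div_mul_cancel₀ _ hx']
      have hm' : m * (x₁ - x₂) = y₁ - W.negY x₂ y₂ := by rw [hm, div_mul_cancel₀ _ hx']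
      clear_value l m
      ext i; fin_cases i
      · simp only [negY, b₄, b₆, b₈] at hm' ⊢
        simp
        apply mul_right_cancel₀ (pow_ne_zero 2 hx')
        -- After clearing denominators the slopes l of P, Q and m of P, −Q occur only in the
        -- combinations l (x₁ − x₂) and m (x₁ − x₂), which are polynomial in the coordinates.
        trans ((l * (x₁ - x₂)) ^ 2 + W.a₁ * (l * (x₁ - x₂)) * (x₁ - x₂) -
          (W.a₂ + x₁ + x₂) * (x₁ - x₂) ^ 2) * ((m * (x₁ - x₂)) ^ 2 +
          W.a₁ * (m * (x₁ - x₂)) * (x₁ - x₂) - (W.a₂ + x₁ + x₂) * (x₁ - x₂) ^ 2)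
        · rw [hl', hm']
          linear_combination (-1 * y₁ ^ 2 - 1 * W.a₃ * y₁ + 2 * y₂ ^ 2
            + 2 * W.a₁ * x₂ * y₂ + 2 * W.a₃ * y₂ + W.a₁ * W.a₃ * x₂ - 1 * W.a₁ * x₁ * y₁ - 1 * W.a₁ ^ 2 * x₁ * x₂ - 1 * W.a₁ * W.a₃ * x₁ + W.a₂ * x₁ ^ 2 - 4 * W.a₂ * x₁ * x₂ +
            2 * W.a₂ * x₂ ^ 2 + x₁ ^ 3 - 2 * x₁ ^ 2 * x₂ - 2 * x₁ * x₂ ^ 2 + 2 * x₂ ^ 3 + W.a₁ ^ 2 * x₂ ^ 2 - 1 * W.a₄ * x₁ - 1 * W.a₆) * e1 + (-1 * y₂ ^ 2 - 1 * W.a₁ * x₂ * y₂ - 1 * W.a₃ * y₂ - 1 * W.a₁ * W.a₃ * x₂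
            - 1 * W.a₁ ^ 2 * x₁ * x₂ + W.a₁ * W.a₃ * x₁ + 4 * W.a₂ * x₁ ^ 2 - 4 * W.a₂ * x₁ * x₂ + W.a₂ * x₂ ^ 2 + 4 * x₁ ^ 3 - 2 * x₁ ^ 2 * x₂
            - 2 * x₁ * x₂ ^ 2 + x₂ ^ 3 + W.a₁ ^ 2 * x₁ ^ 2 + 2 * W.a₄ * x₁ + W.a₆ - 1 * W.a₄ * x₂) * e2
        · ring
      · simp only [negY, b₂, b₄, b₆] at hm' ⊢
        simp
        trans ((l * (x₁ - x₂)) ^ 2 + W.a₁ * (l * (x₁ - x₂)) * (x₁ - x₂) -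
          (W.a₂ + x₁ + x₂) * (x₁ - x₂) ^ 2) + ((m * (x₁ - x₂)) ^ 2 +
          W.a₁ * (m * (x₁ - x₂)) * (x₁ - x₂) - (W.a₂ + x₁ + x₂) * (x₁ - x₂) ^ 2)
        · rw [hl', hm']
          grind
        · ring
      · simp
        ring

end AddSub

/-! ### The polynomials that express x(nX) through x(X) -/

section MulPoly

variable {F : Type*} [Field F] [DecidableEq F] [IsAlgClosed F] {W : WeierstrassCurve.Affine F}
  [W.IsElliptic]

lemma isCoprime_of_no_common_root {u v : F[X]} (h : ∀ x, ¬ (u.eval x = 0 ∧ v.eval x = 0)) :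
    IsCoprime u v := by
  rw [Polynomial.isCoprime_iff_aeval_ne_zero_of_isAlgClosed F F]
  intro x
  by_contra! h'
  exact h x (by simpa using h')

lemma xRep_eq {X : W.Point} (hX : X ≠ 0) : X.xRep = ![xCoord X, 1] := by
  obtain ⟨h, h'⟩ := exists_eq_some hX
  conv_lhs => rw [h', Point.xRep_some]

/-- The hypothesis says that the binary form A s² − B r s + D r² vanishes at (r, s) = (a, b). So it
factors as (a s − b r)(c s − d r), and coprimality of a and b keeps c and d polynomial. -/
lemma exists_third_factor {a b A B D : F[X]} (hab : IsCoprime a b) (ha : a ≠ 0)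
    (h : b ^ 2 * A - a * b * B + a ^ 2 * D = 0) :
    ∃ c d, A = a * c ∧ B = a * d + b * c ∧ D = b * d := by
  by_cases hb : b = 0
  · subst hb
    obtain ⟨a', ha'⟩ := (isCoprime_zero_right.mp hab).exists_right_inv
    refine ⟨a' * A, a' * B, ?_, ?_, ?_⟩
    · linear_combination -A * ha'
    · linear_combination -B * ha'
    · have : D = 0 := by simpa [ha] using h
      simp [this]
  · obtain ⟨c, rfl⟩ : a ∣ A := (hab.pow_right (n := 2)).dvd_of_dvd_mul_left
      ⟨b * B - a * D, by linear_combination h⟩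
    obtain ⟨d, rfl⟩ : b ∣ D := (hab.symm.pow_right (n := 2)).dvd_of_dvd_mul_left
      ⟨a * B - b * (a * c), by linear_combination h⟩
    refine ⟨c, d, rfl, ?_, rfl⟩
    apply mul_left_cancel₀ (mul_ne_zero ha hb)
    linear_combination -h

/-- `u / v` expresses `x(n X)` in terms of `x(X)`. -/
structure IsMulPoly (W : WeierstrassCurve.Affine F) (n : ℕ) (u v : F[X]) : Prop where
  coprime : IsCoprime u v
  natDegree_left : u.natDegree = n ^ 2
  degree_right : v.degree < (n ^ 2 : ℕ)
  xRep : ∀ X : W.Point, X ≠ 0 →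
    ∃ c : F, c ≠ 0 ∧ (n • X).xRep = c • ![u.eval (xCoord X), v.eval (xCoord X)]

lemma IsMulPoly.left_ne_zero {n : ℕ} {u v : F[X]} (h : IsMulPoly W n u v) : u ≠ 0 := by
  rintro rfl
  have h1 := h.natDegree_left
  have h2 := h.degree_right
  have h3 := h.coprime
  rw [natDegree_zero] at h1
  rw [← h1, Nat.cast_zero, ← not_le, zero_le_degree_iff, not_not] at h2
  subst h2
  exact not_isUnit_zero (isCoprime_zero_left.mp h3)

lemma exists_isMulPoly (W : WeierstrassCurve.Affine F) [W.IsElliptic] (n : ℕ) :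
    ∃ u v, IsMulPoly W n u v := by
  induction n using Nat.twoStepInduction with
  | zero =>
    refine ⟨1, 0, isCoprime_one_left, by simp, by simp, fun X hX ↦ ⟨1, one_ne_zero, ?_⟩⟩
    simp
  | one =>
    refine ⟨X, 1, isCoprime_one_right, by simp, by simp, fun X hX ↦ ⟨1, one_ne_zero, ?_⟩⟩
    simp [xRep_eq hX]
  | more n ih1 ih2 =>
    obtain ⟨a, b, hab⟩ := ih1
    obtain ⟨u, v, huv⟩ := ih2
    -- With x((n+1)X) = u/v, the triple A, B, D represents the pair of x-coordinates of (n+2)X and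
    -- nX. The second is a/b, and dividing it out leaves x((n+2)X) = c/d.
    set A : F[X] := (u * X) ^ 2 - C W.b₄ * (u * X) * v - C W.b₆ * (u + v * X) * v - C W.b₈ * v ^ 2
      with hA
    set B : F[X] := 2 * (u + v * X) * (u * X) + C W.b₂ * (u * X) * v + C W.b₄ * (u + v * X) * v +
      C W.b₆ * v ^ 2 with hB
    set D : F[X] := (u + v * X) ^ 2 - 4 * (u * X) * v with hD
    have hev : ∀ x : F, (fun i ↦ (WeierstrassCurve.addSubMap W i).eval
        ![u.eval x * x, u.eval x + v.eval x * x, v.eval x]) =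
        ![A.eval x, B.eval x, D.eval x] := by
      intro x
      rw [eval_addSubMap]
      simp [hA, hB, hD]
    have hpt : ∀ X : W.Point, X ≠ 0 → ∃ c : F, c ≠ 0 ∧ ((n + 2) • X).sym2x (n • X) =
        c • ![A.eval (xCoord X), B.eval (xCoord X), D.eval (xCoord X)] := by
      intro X hX
      obtain ⟨c, hc, h⟩ := huv.xRep X hX
      obtain ⟨c', hc', h'⟩ := exists_addSubMap_sym2x ((n + 1) • X) X
      refine ⟨c'⁻¹ * c ^ 2, mul_ne_zero (inv_ne_zero hc') (pow_ne_zero 2 hc), ?_⟩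
      rw [show (n + 1) • X + X = (n + 2) • X by rw [← succ_nsmul],
        show (n + 1) • X - X = n • X by rw [succ_nsmul, add_sub_cancel_right]] at h'
      rw [mul_smul, eq_inv_smul_iff₀ hc', ← h', ← hev, eval_addSubMap, eval_addSubMap]
      have e : ((n + 1) • X).sym2x X = c • ![u.eval (xCoord X) * xCoord X,
          u.eval (xCoord X) + v.eval (xCoord X) * xCoord X, v.eval (xCoord X)] := by
        rw [Point.sym2x, h, xRep_eq hX]
        ext i; fin_cases i <;> simp <;> ring
      rw [e]
      ext i; fin_cases i <;> simp <;> ring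
    have hid : b ^ 2 * A - a * b * B + a ^ 2 * D = 0 := by
      refine Polynomial.funext fun x ↦ ?_
      obtain ⟨X, hX, rfl⟩ := exists_point (W := W) x
      obtain ⟨c, hc, h⟩ := hpt X hX
      obtain ⟨c', hc', h'⟩ := hab.xRep X hX
      rw [Point.sym2x, h'] at h
      have h0 := congrFun h 0
      have h1 := congrFun h 1
      have h2 := congrFun h 2
      simp at h0 h1 h2 ⊢
      apply mul_left_cancel₀ hc
      linear_combination -b.eval (xCoord X) ^ 2 * h0 +
        a.eval (xCoord X) * b.eval (xCoord X) * h1 - a.eval (xCoord X) ^ 2 * h2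
    obtain ⟨c, d, h0, h1, h2⟩ := exists_third_factor hab.coprime hab.left_ne_zero hid
    -- With N = (n+1)², A has degree 2N + 2 = n² + (n+2)². Removing the factor a of degree n² leaves
    -- degree (n+2)² for c.
    have hN : n ^ 2 + (n + 2) ^ 2 = 2 * (n + 1) ^ 2 + 2 := by ring
    have hvd : v.natDegree + 1 ≤ (n + 1) ^ 2 := by
      by_cases hv : v = 0
      · subst hv; exact Nat.one_le_pow _ _ n.succ_pos
      · exact (natDegree_lt_iff_degree_lt hv).mpr huv.degree_right
    have hud := huv.natDegree_left
    generalize (n + 1) ^ 2 = N at hvd hud hN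
    have hs : (u * X).natDegree = N + 1 := by
      rw [natDegree_mul_X huv.left_ne_zero, hud]
    have ht : (u + v * X).natDegree ≤ N := by
      refine natDegree_add_le_of_degree_le hud.le ?_
      exact (natDegree_mul_le.trans (by simpa using hvd))
    have hv : v.natDegree ≤ N - 1 := by omega
    have hAd : A.natDegree = 2 * N + 2 := by
      have e : A = (u * X) ^ 2 - (C W.b₄ * ((u * X) * v) + C W.b₆ * ((u + v * X) * v) +
        C W.b₈ * v ^ 2) := by rw [hA]; ring
      have h3 : (C W.b₄ * ((u * X) * v) + C W.b₆ * ((u + v * X) * v) +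
          C W.b₈ * v ^ 2).natDegree ≤ 2 * N := by
        refine natDegree_add_le_of_degree_le (natDegree_add_le_of_degree_le ?_ ?_) ?_
        · refine (natDegree_C_mul_le _ _).trans (natDegree_mul_le.trans ?_)
          omega
        · refine (natDegree_C_mul_le _ _).trans (natDegree_mul_le.trans ?_)
          omega
        · refine (natDegree_C_mul_le _ _).trans (natDegree_pow_le.trans ?_)
          omega
      have h4 : ((u * X) ^ 2).natDegree = 2 * N + 2 := by
        rw [natDegree_pow, hs]; ring
      rw [e, natDegree_sub_eq_left_of_natDegree_lt (by omega), h4]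
    have hBd : B.natDegree ≤ 2 * N + 1 := by
      have e : B = C 2 * ((u + v * X) * (u * X)) + C W.b₂ * ((u * X) * v) +
          C W.b₄ * ((u + v * X) * v) + C W.b₆ * v ^ 2 := by
        rw [hB, show (C 2 : F[X]) = 2 from map_ofNat C 2]; ring
      rw [e]
      refine natDegree_add_le_of_degree_le (natDegree_add_le_of_degree_le
        (natDegree_add_le_of_degree_le ?_ ?_) ?_) ?_
      · refine (natDegree_C_mul_le _ _).trans (natDegree_mul_le.trans ?_)
        omega
      · refine (natDegree_C_mul_le _ _).trans (natDegree_mul_le.trans ?_)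
        omega
      · refine (natDegree_C_mul_le _ _).trans (natDegree_mul_le.trans ?_)
        omega
      · refine (natDegree_C_mul_le _ _).trans (natDegree_pow_le.trans ?_)
        omega
    have hA0 : A ≠ 0 := by rintro h; rw [h] at hAd; simp at hAd
    have hc0 : c ≠ 0 := by rintro rfl; exact hA0 (by simp [h0])
    have hcd : c.natDegree = (n + 2) ^ 2 := by
      have := natDegree_mul hab.left_ne_zero hc0
      rw [← h0, hAd, hab.natDegree_left] at this
      omega
    refine ⟨c, d, isCoprime_of_no_common_root fun x ⟨hc, hd⟩ ↦ ?_, hcd, ?_, fun X hX ↦ ?_⟩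
    -- A common root of c and d would be a common root of A, B, D, hence a zero of `addSubMap` at a
    -- nonzero vector.
    · refine WeierstrassCurve.addSubMap_ne_zero W (x := ![u.eval x * x, u.eval x + v.eval x * x,
        v.eval x]) (fun h ↦ ?_) ?_
      · obtain ⟨α, β, hαβ⟩ := huv.coprime
        have h1 := congrFun h 1
        have h2 := congrFun h 2
        simp at h1 h2
        have := congrArg (eval x) hαβ
        rw [h2, zero_mul, add_zero] at h1
        simp [h1, h2] at this
      · rw [hev, h0, h1, h2]
        ext i; fin_cases i <;> simp [hc, hd]
    · by_cases hd0 : d = 0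
      · rw [hd0, degree_zero]; exact WithBot.bot_lt_coe _
      rw [← natDegree_lt_iff_degree_lt hd0]
      have h3 : (a * d).natDegree ≤ 2 * N + 1 := by
        rw [show a * d = B - b * c by rw [h1]; ring]
        refine (natDegree_sub_le_of_le hBd (n := 2 * N + 1) ?_).trans (max_self _).le
        by_cases hb : b = 0
        · simp [hb]
        · have := (natDegree_lt_iff_degree_lt hb).mpr hab.degree_right
          refine natDegree_mul_le.trans ?_
          rw [hcd]
          omega
      rw [natDegree_mul hab.left_ne_zero hd0, hab.natDegree_left] at h3
      omega
    · obtain ⟨κ, hκ, h⟩ := hpt X hX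
      obtain ⟨l, hl, h'⟩ := hab.xRep X hX
      refine ⟨κ / l, div_ne_zero hκ hl, ?_⟩
      rw [Point.sym2x, h', h0, h1, h2] at h
      have e0 := congrFun h 0
      have e1 := congrFun h 1
      have e2 := congrFun h 2
      have hne : ¬ (a.eval (xCoord X) = 0 ∧ b.eval (xCoord X) = 0) := by
        rintro ⟨ha, hb⟩
        obtain ⟨α, β, hαβ⟩ := hab.coprime
        have := congrArg (eval (xCoord X)) hαβ
        simp [ha, hb] at this
      simp at e0 e1 e2
      generalize eval (xCoord X) a = a' at *
      generalize eval (xCoord X) b = b' at *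
      generalize eval (xCoord X) c = c' at *
      generalize eval (xCoord X) d = d' at *
      have h3 : ((n + 2) • X).xRep = ![((n + 2) • X).xRep 0, ((n + 2) • X).xRep 1] := by
        ext i; fin_cases i <;> rfl
      rw [h3]
      generalize ((n + 2) • X).xRep 0 = p at *
      generalize ((n + 2) • X).xRep 1 = q at *
      have hp : p = κ / l * c' := by
        rw [div_mul_eq_mul_div, eq_div_iff hl]
        by_cases ha : a' = 0
        · have hb : b' ≠ 0 := fun hb ↦ hne ⟨ha, hb⟩
          subst ha
          apply mul_right_cancel₀ hb
          linear_combination e1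
        · apply mul_right_cancel₀ ha
          linear_combination e0
      have hq : q = κ / l * d' := by
        rw [div_mul_eq_mul_div, eq_div_iff hl]
        by_cases hb : b' = 0
        · have ha : a' ≠ 0 := fun ha ↦ hne ⟨ha, hb⟩
          subst hb
          apply mul_right_cancel₀ ha
          linear_combination e1
        · apply mul_right_cancel₀ hb
          linear_combination e2
      rw [hp, hq]
      ext i; fin_cases i <;> simp

end MulPoly

end EllipticCongruence

end



noncomputable section

namespace EllipticCongruence

open WeierstrassCurve WeierstrassCurve.Affine Polynomial
open scoped Polynomial.Bivariate

/-! ### Torsion points -/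

section TorsionCount

variable {F : Type*} [Field F] [DecidableEq F] [IsAlgClosed F] {W : WeierstrassCurve.Affine F}
  [W.IsElliptic]

namespace IsMulPoly

variable {n : ℕ} {u v : F[X]} (h : IsMulPoly W n u v)
include h

lemma nsmul_eq_zero_iff {X : W.Point} (hX : X ≠ 0) : n • X = 0 ↔ v.eval (xCoord X) = 0 := by
  obtain ⟨c, hc, h'⟩ := h.xRep X hX
  have h1 := congrFun h' 1
  by_cases h0 : n • X = 0
  · rw [h0] at h1
    simpa [h0, hc] using h1
  · rw [xRep_eq h0] at h1
    simp only [h0, false_iff]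
    intro h2
    simp [h2] at h1

lemma xCoord_nsmul {X : W.Point} (hX : n • X ≠ 0) :
    xCoord (n • X) * v.eval (xCoord X) = u.eval (xCoord X) := by
  have hX0 : X ≠ 0 := by rintro rfl; simp at hX
  obtain ⟨c, hc, h'⟩ := h.xRep X hX0
  rw [xRep_eq hX] at h'
  have h0 := congrFun h' 0
  have h1 := congrFun h' 1
  simp at h0 h1
  apply mul_left_cancel₀ hc
  rw [h0]
  linear_combination -c * u.eval (xCoord X) * h1

lemma natDegree_sub (t : F) : (u - C t * v).natDegree = n ^ 2 := by
  have hd : (C t * v).degree < u.degree := by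
    rw [degree_eq_natDegree h.left_ne_zero, h.natDegree_left]
    refine lt_of_le_of_lt ?_ h.degree_right
    rw [← smul_eq_C_mul]
    exact degree_smul_le _ _
  rw [natDegree_eq_of_degree_eq (degree_sub_eq_left_of_degree_lt hd), h.natDegree_left]

lemma sub_ne_zero (hn : n ≠ 0) (t : F) : u - C t * v ≠ 0 := by
  intro h0
  have := h.natDegree_sub t
  rw [h0, natDegree_zero] at this
  exact hn (pow_eq_zero_iff two_ne_zero |>.mp this.symm)

lemma right_ne_zero (hn : n ≠ 0) : v ≠ 0 := by
  rintro rfl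
  have h1 := natDegree_eq_zero_of_isUnit (isCoprime_zero_right.mp h.coprime)
  rw [h.natDegree_left] at h1
  exact hn (pow_eq_zero_iff two_ne_zero |>.mp h1)

lemma not_common_root {x : F} (hu : u.eval x = 0) (hv : v.eval x = 0) : False := by
  obtain ⟨α, β, hαβ⟩ := h.coprime
  have := congrArg (eval x) hαβ
  simp [hu, hv] at this

/-- A point X above r satisfies x(nX) = x(T), so nX = ±T; if the sign is wrong, −X does the job. -/
lemma exists_nsmul_eq {t r : F} (hr : (u - C t * v).eval r = 0) {T : W.Point} (hT : T ≠ 0)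
    (hTt : xCoord T = t) : ∃ X : W.Point, X ≠ 0 ∧ xCoord X = r ∧ n • X = T := by
  obtain ⟨X, hX, rfl⟩ := exists_point (W := W) r
  simp only [eval_sub, eval_mul, eval_C] at hr
  have hv : v.eval (xCoord X) ≠ 0 := fun hv ↦ h.not_common_root (by simpa [hv] using hr) hv
  have hnX : n • X ≠ 0 := fun h0 ↦ hv ((h.nsmul_eq_zero_iff hX).mp h0)
  have hx : xCoord (n • X) = xCoord T := by
    apply mul_right_cancel₀ hv
    rw [h.xCoord_nsmul hnX, hTt]
    linear_combination hr
  rcases (xCoord_eq_iff hnX hT).mp hx with h' | h'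
  · exact ⟨X, hX, rfl, h'⟩
  · exact ⟨-X, neg_point_ne_zero hX, xCoord_neg X, by rw [smul_neg, h', neg_neg]⟩

end IsMulPoly

lemma finite_nsmul_eq_zero {n : ℕ} (hn : n ≠ 0) : {X : W.Point | n • X = 0}.Finite := by
  obtain ⟨u, v, h⟩ := exists_isMulPoly W n
  refine ((finite_root_xCoord (h.right_ne_zero hn)).union (Set.finite_singleton 0)).subset ?_
  intro X hX
  by_cases h0 : X = 0
  · right; exact h0
  · left; exact (h.nsmul_eq_zero_iff h0).mp hX

lemma finite_nsmul_eq {n : ℕ} (hn : n ≠ 0) (P : W.Point) : {X : W.Point | n • X = P}.Finite := by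
  by_cases h : ∃ X₀ : W.Point, n • X₀ = P
  · obtain ⟨X₀, rfl⟩ := h
    refine ((finite_nsmul_eq_zero (W := W) hn).image (· + X₀)).subset fun X hX ↦ ?_
    refine ⟨X - X₀, ?_, sub_add_cancel _ _⟩
    simp only [Set.mem_ofPred_eq] at hX ⊢
    rw [nsmul_sub, hX, sub_self]
  · convert Set.finite_empty
    rw [Set.eq_empty_iff_forall_notMem]
    exact fun X hX ↦ h ⟨X, hX⟩

lemma tendsto_nsmul {n : ℕ} (hn : n ≠ 0) :
    Filter.Tendsto (fun X : W.Point ↦ n • X) Filter.cofinite Filter.cofinite :=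
  Filter.Tendsto.cofinite_of_finite_preimage_singleton fun P ↦ finite_nsmul_eq hn P

lemma tendsto_add (S : W.Point) :
    Filter.Tendsto (fun X : W.Point ↦ X + S) Filter.cofinite Filter.cofinite :=
  (add_left_injective S).tendsto_cofinite

lemma tendsto_neg : Filter.Tendsto (fun X : W.Point ↦ -X) Filter.cofinite Filter.cofinite :=
  neg_injective.tendsto_cofinite

lemma nsmul_surjective {n : ℕ} (hn : n ≠ 0) : Function.Surjective (fun X : W.Point ↦ n • X) := by
  intro T
  by_cases hT : T = 0
  · exact ⟨0, by simp [hT]⟩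
  obtain ⟨u, v, h⟩ := exists_isMulPoly W n
  obtain ⟨r, hr⟩ := IsAlgClosed.exists_root (u - C (xCoord T) * v) (by
    rw [degree_eq_natDegree (h.sub_ne_zero hn _), h.natDegree_sub]
    exact_mod_cast pow_ne_zero 2 hn)
  obtain ⟨X, -, -, hX⟩ := h.exists_nsmul_eq hr hT rfl
  exact ⟨X, hX⟩

/-- The n-torsion has as many points as the fibre of [n] over a general point nX₀. That fibre is
mapped by x onto the roots of u − t v, of degree n², where t = x(nX₀); injectivity follows from 2n
X₀ ≠ 0. Multiple roots occur only for values t = u(r)/v(r) with r a root of the Wronskian, which is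
nonzero in characteristic 0. -/
lemma ncard_nsmul_eq_zero [CharZero F] {n : ℕ} (hn : n ≠ 0) :
    {X : W.Point | n • X = 0}.ncard = n ^ 2 := by
  obtain ⟨u, v, h⟩ := exists_isMulPoly W n
  have hw : wronskian u v ≠ 0 := by
    rw [Ne, h.coprime.wronskian_eq_zero_iff]
    rintro ⟨hu, -⟩
    have := derivative_eq_zero.mp hu
    rw [h.natDegree_left] at this
    exact hn (pow_eq_zero_iff two_ne_zero |>.mp this)
  have hgen : ∀ᶠ X₀ : W.Point in Filter.cofinite,
      ∀ r ∈ (wronskian u v).roots.toFinset,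
        (u - C (u.eval r / v.eval r) * v).eval (xCoord X₀) ≠ 0 := by
    rw [Filter.eventually_all_finset]
    exact fun r _ ↦ eventually_eval_xCoord_ne_zero (h.sub_ne_zero hn _)
  have h2 : ∀ᶠ X₀ : W.Point in Filter.cofinite, (2 * n) • X₀ ≠ 0 := by
    simpa [Filter.eventually_cofinite] using
      finite_nsmul_eq_zero (W := W) (mul_ne_zero two_ne_zero hn)
  obtain ⟨X₀, hX₀, h2X₀⟩ := (hgen.and h2).exists
  have hnX₀ : n • X₀ ≠ 0 := fun h0 ↦ h2X₀ (by rw [mul_smul, h0, smul_zero])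
  have hX₀0 : X₀ ≠ 0 := by rintro rfl; simp at hnX₀
  set t := xCoord (n • X₀) with ht
  have hsep : (u - C t * v).Separable := by
    refine isCoprime_of_no_common_root fun r ⟨h0, h1⟩ ↦ ?_
    simp only [eval_sub, eval_mul, eval_C, derivative_sub, derivative_mul, derivative_C,
      zero_mul, zero_add] at h0 h1
    have hv : v.eval r ≠ 0 := fun hv ↦ h.not_common_root (by simpa [hv] using h0) hv
    have hr : (wronskian u v).eval r = 0 := by
      simp only [wronskian, eval_sub, eval_mul]
      linear_combination (derivative v).eval r * h0 - v.eval r * h1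
    refine hX₀ r (by simpa [hw] using hr) ?_
    have h3 := h.xCoord_nsmul hnX₀
    have h4 : u.eval r / v.eval r = t := by
      rw [div_eq_iff hv]; linear_combination h0
    simp only [h4, eval_sub, eval_mul, eval_C]
    rw [← h3, ht, sub_self]
  have hcard : ((u - C t * v).rootSet F).ncard = n ^ 2 := by
    rw [← Nat.card_coe_set_eq, Nat.card_eq_fintype_card,
      card_rootSet_eq_natDegree hsep (IsAlgClosed.splits _), h.natDegree_sub]
  have hbij : Set.BijOn xCoord {X : W.Point | n • X = n • X₀} ((u - C t * v).rootSet F) := by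
    have hne : ∀ X ∈ {X : W.Point | n • X = n • X₀}, X ≠ 0 := by
      rintro X hX rfl
      simp only [Set.mem_ofPred_eq, smul_zero] at hX
      exact hnX₀ hX.symm
    refine ⟨fun X hX ↦ ?_, fun X hX P hP hXP ↦ ?_, fun r hr ↦ ?_⟩
    · have hX' : n • X = n • X₀ := hX
      have := h.xCoord_nsmul (X := X) (by rw [hX']; exact hnX₀)
      rw [hX'] at this
      simp [mem_rootSet, h.sub_ne_zero hn, ← this, ht]
    · rcases (xCoord_eq_iff (hne X hX) (hne P hP)).mp hXP with h' | h'
      · exact h'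
      · have hX' : n • X = n • X₀ := hX
        have hP' : n • P = n • X₀ := hP
        rw [h', smul_neg, hP'] at hX'
        refine absurd ?_ h2X₀
        rw [mul_smul, two_nsmul]
        nth_rw 1 [← hX']
        rw [neg_add_cancel]
    · obtain ⟨X, _, hx, hX⟩ := h.exists_nsmul_eq (T := n • X₀)
        (by simpa [mem_rootSet, h.sub_ne_zero hn] using hr) hnX₀ rfl
      exact ⟨X, hX, hx⟩
  rw [← hcard, ← hbij.image_eq, hbij.injOn.ncard_image]
  rw [← Set.ncard_image_of_injective _ (add_left_injective X₀)]
  congr 1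
  ext X
  simp only [Set.mem_image, Set.mem_ofPred_eq]
  constructor
  · rintro ⟨S, hS, rfl⟩
    rw [nsmul_add, hS, zero_add]
  · intro hX
    exact ⟨X - X₀, by rw [nsmul_sub, hX, sub_self], sub_add_cancel _ _⟩

end TorsionCount

end EllipticCongruence

end



noncomputable section

namespace EllipticCongruence

open WeierstrassCurve WeierstrassCurve.Affine Polynomial Filter
open scoped Polynomial.Bivariate

/-! ### Rational functions as germs -/

section RationalFunctions

variable {F : Type*} [Field F] [DecidableEq F] [IsAlgClosed F] {W : WeierstrassCurve.Affine F}
  [W.IsElliptic]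

/-- The germ, along the cofinite filter, of a regular function. -/
def regularGerm (W : WeierstrassCurve.Affine F) :
    W.CoordinateRing →+* Germ (cofinite : Filter W.Point) F where
  toFun f := ↑(value f)
  map_one' := Germ.coe_eq.mpr ((eventually_ne 0).mono fun _ hX ↦ value_one hX)
  map_mul' f g := Germ.coe_eq.mpr (.of_forall fun X ↦ value_mul f g X)
  map_zero' := Germ.coe_eq.mpr (.of_forall fun X ↦ value_zero X)
  map_add' f g := Germ.coe_eq.mpr (.of_forall fun X ↦ value_add f g X)

/-- The germ, along the cofinite filter, of a rational function. -/
def ratGerm (W : WeierstrassCurve.Affine F) [W.IsElliptic] :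
    W.FunctionField →+* Germ (cofinite : Filter W.Point) F :=
  IsLocalization.lift (M := nonZeroDivisors W.CoordinateRing) (g := regularGerm W) fun f ↦ by
    refine IsUnit.of_mul_eq_one (↑(fun X ↦ (value f.1 X)⁻¹) : Germ _ F) ?_
    exact Germ.coe_eq.mpr ((eventually_value_ne_zero (nonZeroDivisors.ne_zero f.2)).mono
      fun X hX ↦ mul_inv_cancel₀ hX)

lemma ratGerm_algebraMap (f : W.CoordinateRing) :
    ratGerm W (algebraMap _ _ f) = ↑(value f) :=
  IsLocalization.lift_eq _ f

lemma ratGerm_injective : Function.Injective (ratGerm W) := RingHom.injective _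

/-- `h` agrees almost everywhere with a rational function. -/
def IsRat (h : W.Point → F) : Prop := ∃ q : W.FunctionField, ratGerm W q = ↑h

namespace IsRat

variable {h h' : W.Point → F}

lemma congr (hh : IsRat h) (e : h' =ᶠ[cofinite] h) : IsRat h' := by
  obtain ⟨q, hq⟩ := hh
  exact ⟨q, hq.trans (Germ.coe_eq.mpr e.symm)⟩

lemma value (f : W.CoordinateRing) : IsRat (value f) := ⟨_, ratGerm_algebraMap f⟩

lemma const (c : F) : IsRat (fun _ : W.Point ↦ c) :=
  (IsRat.value (EllipticCongruence.const c)).congr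
    ((eventually_ne 0).mono fun _ hX ↦ (value_const hX c).symm)

lemma xCoord : IsRat (W := W) xCoord :=
  (IsRat.value (CoordinateRing.mk W (C X))).congr
    ((eventually_ne 0).mono fun P hP ↦ by rw [value_mk_C hP, eval_X])

lemma yCoord : IsRat (W := W) yCoord :=
  (IsRat.value (CoordinateRing.mk W Y)).congr
    ((eventually_ne 0).mono fun _ hX ↦ (value_mk_Y hX).symm)

lemma add (hh : IsRat h) (hh' : IsRat h') : IsRat (fun X ↦ h X + h' X) := by
  obtain ⟨q, hq⟩ := hh
  obtain ⟨q', hq'⟩ := hh'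
  exact ⟨q + q', by rw [map_add, hq, hq']; rfl⟩

lemma mul (hh : IsRat h) (hh' : IsRat h') : IsRat (fun X ↦ h X * h' X) := by
  obtain ⟨q, hq⟩ := hh
  obtain ⟨q', hq'⟩ := hh'
  exact ⟨q * q', by rw [map_mul, hq, hq']; rfl⟩

lemma sub (hh : IsRat h) (hh' : IsRat h') : IsRat (fun X ↦ h X - h' X) := by
  obtain ⟨q, hq⟩ := hh
  obtain ⟨q', hq'⟩ := hh'
  exact ⟨q - q', by rw [map_sub, hq, hq']; rfl⟩

lemma neg (hh : IsRat h) : IsRat (fun X ↦ -h X) := by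
  obtain ⟨q, hq⟩ := hh
  exact ⟨-q, by rw [map_neg, hq]; rfl⟩

lemma pow (hh : IsRat h) (n : ℕ) : IsRat (fun X ↦ h X ^ n) := by
  obtain ⟨q, hq⟩ := hh
  exact ⟨q ^ n, by rw [map_pow, hq]; rfl⟩

/-- Rational functions form a field, so the germ of a nonzero one is invertible. -/
lemma eventually_eq_zero_or (hh : IsRat h) :
    (∀ᶠ X in cofinite, h X = 0) ∨ ∀ᶠ X in cofinite, h X ≠ 0 := by
  obtain ⟨q, hq⟩ := hh
  by_cases h0 : q = 0
  · left
    rw [h0, map_zero] at hq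
    exact Germ.coe_eq.mp hq.symm
  · right
    have : ratGerm W (q⁻¹) * ↑h = 1 := by
      rw [← hq, ← map_mul, inv_mul_cancel₀ h0, map_one]
    induction hg : ratGerm W q⁻¹ using Germ.inductionOn with
    | h g =>
      rw [hg] at this
      exact (Germ.coe_eq.mp this).mono fun X hX h0 ↦ by simp [h0] at hX

lemma inv (hh : IsRat h) : IsRat (fun X ↦ (h X)⁻¹) := by
  rcases hh.eventually_eq_zero_or with h0 | h0
  · exact (IsRat.const 0).congr (h0.mono fun X hX ↦ by simp [hX])
  obtain ⟨q, hq⟩ := hh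
  refine ⟨q⁻¹, ?_⟩
  have hq0 : q ≠ 0 := by
    rintro rfl
    rw [map_zero] at hq
    obtain ⟨X, h1, h2⟩ := (h0.and (Germ.coe_eq.mp hq.symm)).exists
    exact h1 h2
  have e1 : ratGerm W q⁻¹ * ↑h = 1 := by
    rw [← hq, ← map_mul, inv_mul_cancel₀ hq0, map_one]
  have e2 : Germ.ofFun (l := cofinite) h * Germ.ofFun (fun X ↦ (h X)⁻¹) = 1 := by
    change Germ.ofFun (l := cofinite) (fun X ↦ h X * (h X)⁻¹) =
      Germ.ofFun (fun _ : W.Point ↦ (1 : F))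
    exact Germ.coe_eq.mpr (h0.mono fun X hX ↦ mul_inv_cancel₀ hX)
  exact left_inv_eq_right_inv e1 e2

lemma div (hh : IsRat h) (hh' : IsRat h') : IsRat (fun X ↦ h X / h' X) := by
  simpa only [div_eq_mul_inv] using hh.mul hh'.inv

lemma prod {ι : Type*} (s : Finset ι) {g : ι → W.Point → F} (hg : ∀ i ∈ s, IsRat (g i)) :
    IsRat (fun X ↦ ∏ i ∈ s, g i X) := by
  classical
  induction s using Finset.induction_on with
  | empty => simpa using IsRat.const 1
  | insert i s hi ih =>
    simp only [Finset.prod_insert hi]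
    exact (hg i (Finset.mem_insert_self _ _)).mul
      (ih fun j hj ↦ hg j (Finset.mem_insert_of_mem hj))

lemma eval (hh : IsRat h) (a : F[X]) : IsRat (fun X ↦ a.eval (h X)) := by
  induction a using Polynomial.induction_on' with
  | add p q hp hq => simpa only [eval_add] using hp.add hq
  | monomial n c => simpa only [eval_monomial] using (IsRat.const c).mul (hh.pow n)

lemma exists_div (hh : IsRat h) : ∃ a b : W.CoordinateRing, b ≠ 0 ∧
    ∀ᶠ X in cofinite, h X * EllipticCongruence.value b X = EllipticCongruence.value a X := by
  obtain ⟨q, hq⟩ := hh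
  obtain ⟨a, b, hb, rfl⟩ := IsFractionRing.div_surjective (A := W.CoordinateRing) q
  have hb0 := nonZeroDivisors.ne_zero hb
  have e : Germ.ofFun (l := cofinite) (fun X ↦ h X * EllipticCongruence.value b X) =
      Germ.ofFun h * Germ.ofFun (EllipticCongruence.value b) := rfl
  refine ⟨a, b, hb0, Germ.coe_eq.mp ?_⟩
  rw [e]
  rw [← hq, ← ratGerm_algebraMap, ← ratGerm_algebraMap, ← map_mul, div_mul_cancel₀]
  simpa using hb0

/-- A rational function with constant `n`-th power is constant. -/
lemma eq_const_of_pow (hh : IsRat h) {n : ℕ} (hn : n ≠ 0) {c : F}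
    (hc : ∀ᶠ X in cofinite, h X ^ n = c) :
    ∃ c' : F, c' ^ n = c ∧ ∀ᶠ X in cofinite, h X = c' := by
  classical
  -- The product of h − r over the roots r of X^n − c vanishes almost everywhere. A factor that is
  -- not almost everywhere zero is almost everywhere nonzero, so some factor is the zero germ.
  have hprod : ∀ᶠ P in cofinite,
      (((X ^ n - C c : F[X]).roots).map fun r ↦ h P - r).prod = 0 := by
    filter_upwards [hc] with P hP
    have hs := (IsAlgClosed.splits (X ^ n - C c : F[X])).eq_prod_roots_of_monic
      (monic_X_pow_sub_C c hn)
    have := congrArg (Polynomial.eval (h P)) hs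
    rw [eval_multiset_prod, Multiset.map_map] at this
    simpa [hP] using this.symm
  by_contra hcon
  have hcon' : ∀ r : F, r ^ n = c → ¬ ∀ᶠ X in cofinite, h X = r := fun r h1 h2 ↦ hcon ⟨r, h1, h2⟩
  have hne : ∀ r ∈ ((X ^ n - C c : F[X]).roots).toFinset,
      ∀ᶠ P in cofinite, h P - r ≠ 0 := by
    intro r hr
    refine ((hh.sub (.const r)).eventually_eq_zero_or).resolve_left fun h0 ↦ ?_
    refine hcon' r ?_ (h0.mono fun X hX ↦ sub_eq_zero.mp hX)
    have hr' : (X ^ n - C c : F[X]).eval r = 0 := by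
      simpa [(monic_X_pow_sub_C c hn).ne_zero] using (Multiset.mem_toFinset.mp hr)
    simpa [sub_eq_zero] using hr'
  obtain ⟨X, h1, h2⟩ := (hprod.and ((eventually_all_finset _).mpr hne)).exists
  rw [Multiset.prod_eq_zero_iff, Multiset.mem_map] at h1
  obtain ⟨r, hr, h3⟩ := h1
  exact h2 r (Multiset.mem_toFinset.mpr hr) h3

end IsRat

/-! ### Rational maps from the curve to itself -/

/-- The coordinates of `m` are rational functions. -/
structure IsRatPoint (m : W.Point → W.Point) : Prop where
  xCoord : IsRat fun X ↦ xCoord (m X)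
  yCoord : IsRat fun X ↦ yCoord (m X)

/-- `m` is a nonconstant rational map with finite fibres. -/
structure IsRatMap (m : W.Point → W.Point) : Prop extends IsRatPoint m where
  tendsto : Tendsto m cofinite cofinite

lemma xCoord_add {P Q : W.Point} (hP : P ≠ 0) (hQ : Q ≠ 0) (hx : xCoord P ≠ xCoord Q) :
    xCoord (P + Q) = ((yCoord P - yCoord Q) / (xCoord P - xCoord Q)) ^ 2 +
      W.a₁ * ((yCoord P - yCoord Q) / (xCoord P - xCoord Q)) - W.a₂ - xCoord P - xCoord Q := by
  obtain ⟨h, h'⟩ := exists_eq_some hP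
  obtain ⟨k, k'⟩ := exists_eq_some hQ
  conv_lhs => rw [h', k', Point.add_some fun h ↦ hx h.1, xCoord_some, slope_of_X_ne hx]
  rfl

lemma yCoord_add {P Q : W.Point} (hP : P ≠ 0) (hQ : Q ≠ 0) (hx : xCoord P ≠ xCoord Q) :
    yCoord (P + Q) = -(((yCoord P - yCoord Q) / (xCoord P - xCoord Q)) *
      (xCoord (P + Q) - xCoord P) + yCoord P) - W.a₁ * xCoord (P + Q) - W.a₃ := by
  rw [xCoord_add hP hQ hx]
  obtain ⟨h, h'⟩ := exists_eq_some hP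
  obtain ⟨k, k'⟩ := exists_eq_some hQ
  conv_lhs => rw [h', k', Point.add_some fun h ↦ hx h.1, yCoord_some, slope_of_X_ne hx]
  rfl

lemma add_ne_zero {P Q : W.Point} (hx : xCoord P ≠ xCoord Q) : P + Q ≠ 0 := by
  intro h
  rw [eq_neg_of_add_eq_zero_left h, xCoord_neg] at hx
  exact hx rfl

namespace IsRatPoint

variable {m m' : W.Point → W.Point}

lemma id : IsRatPoint (W := W) fun X ↦ X := ⟨.xCoord, .yCoord⟩

lemma const (P : W.Point) : IsRatPoint fun _ : W.Point ↦ P := ⟨.const _, .const _⟩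

/-- This uses only the chord formula. Its later uses insert an auxiliary translation so that the two
summands have different x-coordinates almost everywhere. -/
lemma add (hm : IsRatPoint m) (hm' : IsRatPoint m') (h : ∀ᶠ X in cofinite, m X ≠ 0)
    (h' : ∀ᶠ X in cofinite, m' X ≠ 0)
    (hx : ∀ᶠ X in cofinite, EllipticCongruence.xCoord (m X) ≠ EllipticCongruence.xCoord (m' X)) :
    IsRatPoint fun X ↦ m X + m' X := by
  have hl := (hm.2.sub hm'.2).div (hm.1.sub hm'.1)
  have h1 : IsRat fun X ↦ EllipticCongruence.xCoord (m X + m' X) := by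
    refine (((((hl.pow 2).add ((IsRat.const W.a₁).mul hl)).sub (.const W.a₂)).sub hm.1).sub
      hm'.1).congr ?_
    filter_upwards [h, h', hx] with X hX hX' hx using xCoord_add hX hX' hx
  refine ⟨h1, ((((hl.mul (h1.sub hm.1)).add hm.2).neg.sub ((IsRat.const W.a₁).mul h1)).sub
    (.const W.a₃)).congr ?_⟩
  filter_upwards [h, h', hx] with X hX hX' hx using yCoord_add hX hX' hx

end IsRatPoint

lemma eventually_xCoord_ne {m m' : W.Point → W.Point} (h : ∀ᶠ X in cofinite, m X ≠ 0)
    (h' : ∀ᶠ X in cofinite, m' X ≠ 0) (h1 : ∀ᶠ X in cofinite, m X ≠ m' X)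
    (h2 : ∀ᶠ X in cofinite, m X ≠ -m' X) : ∀ᶠ X in cofinite, xCoord (m X) ≠ xCoord (m' X) := by
  filter_upwards [h, h', h1, h2] with X hX hX' h1 h2 hx
  exact ((xCoord_eq_iff hX hX').mp hx).elim h1 h2

namespace IsRatMap

variable {m : W.Point → W.Point}

lemma value (hm : IsRatMap m) (f : W.CoordinateRing) : IsRat fun X ↦ value f (m X) := by
  obtain ⟨a, b, rfl⟩ := exists_ofPair f
  refine ((hm.1.1.eval a).add ((hm.1.1.eval b).mul hm.1.2)).congr ?_
  filter_upwards [hm.tendsto.eventually (eventually_ne 0)] with X hX using value_ofPair hX a b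

lemma comp (hm : IsRatMap m) {h : W.Point → F} (hh : IsRat h) : IsRat fun X ↦ h (m X) := by
  obtain ⟨a, b, hb, hab⟩ := hh.exists_div
  refine ((hm.value a).div (hm.value b)).congr ?_
  filter_upwards [hm.tendsto.eventually hab, hm.tendsto.eventually (eventually_value_ne_zero hb)]
    with X h1 h2
  rw [eq_div_iff h2, h1]

lemma id : IsRatMap (W := W) fun X ↦ X := ⟨.id, tendsto_id⟩

lemma comp_map {m' : W.Point → W.Point} (hm : IsRatMap m) (hm' : IsRatMap m') :
    IsRatMap fun X ↦ m' (m X) :=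
  ⟨⟨hm.comp hm'.1.1, hm.comp hm'.1.2⟩, hm'.tendsto.comp hm.tendsto⟩

lemma addConst (S : W.Point) : IsRatMap fun X : W.Point ↦ X + S := by
  refine ⟨?_, tendsto_add S⟩
  by_cases hS : S = 0
  · simpa [hS] using IsRatPoint.id
  · exact IsRatPoint.id.add (.const S) (eventually_ne 0) (.of_forall fun _ ↦ hS)
      (eventually_xCoord_ne (eventually_ne 0) (.of_forall fun _ ↦ hS) (eventually_ne S)
        (eventually_ne (-S)))

lemma neg : IsRatMap fun X : W.Point ↦ -X := by
  refine ⟨⟨?_, ?_⟩, tendsto_neg⟩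
  · simpa using IsRat.xCoord
  · refine (((IsRat.yCoord.neg).sub ((IsRat.const W.a₁).mul .xCoord)).sub (.const W.a₃)).congr ?_
    filter_upwards [eventually_ne 0] with X hX using yCoord_neg hX

lemma eventually_nsmul_ne {n : ℕ} (hn : n ≠ 0) (P : W.Point) :
    ∀ᶠ X : W.Point in cofinite, n • X ≠ P :=
  (tendsto_nsmul hn).eventually (eventually_ne P)

lemma nsmul {n : ℕ} (hn : n ≠ 0) : IsRatMap fun X : W.Point ↦ n • X := by
  induction n, Nat.one_le_iff_ne_zero.mpr hn using Nat.le_induction with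
  | base => simpa using IsRatMap.id
  | succ n hn1 ih =>
    have hn0 : n ≠ 0 := by omega
    -- In (n+1)X = (nX + S) + (X − S) with 2S ≠ 0 the summands are neither equal nor opposite for
    -- almost all X, even when n = 1. No doubling formula is needed.
    obtain ⟨S, hS⟩ := (eventually_nsmul_ne (W := W) two_ne_zero 0).exists
    have h1 := (ih hn0).comp_map (addConst S)
    have h2 := addConst (-S)
    have e : (fun X : W.Point ↦ (n + 1) • X) = fun X ↦ (n • X + S) + (X + -S) := by
      ext1 X; rw [succ_nsmul]; abel
    refine ⟨?_, tendsto_nsmul hn⟩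
    rw [e]
    refine h1.1.add h2.1 (h1.tendsto.eventually (eventually_ne 0))
      (h2.tendsto.eventually (eventually_ne 0)) (eventually_xCoord_ne
      (h1.tendsto.eventually (eventually_ne 0)) (h2.tendsto.eventually (eventually_ne 0)) ?_ ?_)
    · rcases Nat.eq_or_lt_of_le hn1 with rfl | hn1
      · refine .of_forall fun X hX ↦ hS ?_
        rw [one_smul, add_right_inj] at hX
        rw [two_nsmul]
        nth_rw 1 [hX]
        rw [neg_add_cancel]
      · have hn2 : n - 1 ≠ 0 := by omega
        filter_upwards [eventually_nsmul_ne (W := W) hn2 (-S - S)] with X hX h3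
        apply hX
        have h4 : n • X = (n - 1) • X + X := by rw [← succ_nsmul]; congr 1; omega
        rw [h4] at h3
        have : (n - 1) • X = X + -S - (X + S) := by rw [← h3]; abel
        rw [this]; abel
    · filter_upwards [eventually_nsmul_ne (W := W) (n := n + 1) (by omega) 0] with X hX h3
      apply hX
      rw [succ_nsmul]
      have : n • X = -(X + -S) - S := by rw [← h3]; abel
      rw [this]; abel

end IsRatMap

/-! ### Regularity at a point -/

/-- `h` is, near `X₀` and at `X₀`, the quotient of two regular functions, the denominator not
vanishing at the affine point `X₀`. -/
def IsRegAt (h : W.Point → F) (X₀ : W.Point) : Prop :=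
  ∃ u v : W.CoordinateRing, value v X₀ ≠ 0 ∧ h X₀ * value v X₀ = value u X₀ ∧
    ∀ᶠ X in cofinite, h X * value v X = value u X

namespace IsRegAt

variable {h h' : W.Point → F} {X₀ : W.Point}

lemma ne_zero (hh : IsRegAt h X₀) : X₀ ≠ 0 := by
  obtain ⟨u, v, hv, -⟩ := hh
  rintro rfl
  simp at hv

lemma congr (hh : IsRegAt h X₀) (e : h' =ᶠ[cofinite] h) (e0 : h' X₀ = h X₀) :
    IsRegAt h' X₀ := by
  obtain ⟨u, v, hv, h0, h1⟩ := hh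
  exact ⟨u, v, hv, by rw [e0, h0], by filter_upwards [h1, e] with X hX he; rw [he, hX]⟩

lemma value (f : W.CoordinateRing) (hX₀ : X₀ ≠ 0) : IsRegAt (value f) X₀ :=
  ⟨f, 1, by simp [value_one hX₀], by simp [value_one hX₀],
    (eventually_ne 0).mono fun X hX ↦ by simp [value_one hX]⟩

lemma const (c : F) (hX₀ : X₀ ≠ 0) : IsRegAt (fun _ ↦ c) X₀ :=
  (IsRegAt.value (EllipticCongruence.const c) hX₀).congr
    ((eventually_ne 0).mono fun _ hX ↦ (value_const hX c).symm) (value_const hX₀ c).symm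

lemma add (hh : IsRegAt h X₀) (hh' : IsRegAt h' X₀) : IsRegAt (fun X ↦ h X + h' X) X₀ := by
  obtain ⟨u, v, hv, h0, h1⟩ := hh
  obtain ⟨u', v', hv', h0', h1'⟩ := hh'
  refine ⟨u * v' + u' * v, v * v', by simp [value_mul, hv, hv'], ?_, ?_⟩
  · simp only [value_add, value_mul, ← h0, ← h0']; ring
  · filter_upwards [h1, h1'] with X hX hX'
    simp only [value_add, value_mul, ← hX, ← hX']; ring

lemma mul (hh : IsRegAt h X₀) (hh' : IsRegAt h' X₀) : IsRegAt (fun X ↦ h X * h' X) X₀ := by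
  obtain ⟨u, v, hv, h0, h1⟩ := hh
  obtain ⟨u', v', hv', h0', h1'⟩ := hh'
  refine ⟨u * u', v * v', by simp [value_mul, hv, hv'], ?_, ?_⟩
  · simp only [value_mul, ← h0, ← h0']; ring
  · filter_upwards [h1, h1'] with X hX hX'
    simp only [value_mul, ← hX, ← hX']; ring

lemma neg (hh : IsRegAt h X₀) : IsRegAt (fun X ↦ -h X) X₀ := by
  simpa using (IsRegAt.const (-1) hh.ne_zero).mul hh

lemma sub (hh : IsRegAt h X₀) (hh' : IsRegAt h' X₀) : IsRegAt (fun X ↦ h X - h' X) X₀ := by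
  simpa only [sub_eq_add_neg] using hh.add hh'.neg

lemma pow (hh : IsRegAt h X₀) (n : ℕ) : IsRegAt (fun X ↦ h X ^ n) X₀ := by
  induction n with
  | zero => simpa using IsRegAt.const 1 hh.ne_zero
  | succ n ih => simpa only [pow_succ] using ih.mul hh

lemma inv (hh : IsRegAt h X₀) (hne : h X₀ ≠ 0) : IsRegAt (fun X ↦ (h X)⁻¹) X₀ := by
  obtain ⟨u, v, hv, h0, h1⟩ := hh
  have hu : EllipticCongruence.value u X₀ ≠ 0 := h0 ▸ mul_ne_zero hne hv
  have hu0 : u ≠ 0 := by rintro rfl; simp at hu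
  refine ⟨v, u, hu, ?_, ?_⟩
  · rw [← h0, ← mul_assoc, inv_mul_cancel₀ hne, one_mul]
  · filter_upwards [h1, eventually_value_ne_zero hu0] with X hX hX'
    have : h X ≠ 0 := fun h2 ↦ hX' (by rw [← hX, h2, zero_mul])
    rw [← hX, ← mul_assoc, inv_mul_cancel₀ this, one_mul]

lemma div (hh : IsRegAt h X₀) (hh' : IsRegAt h' X₀) (hne : h' X₀ ≠ 0) :
    IsRegAt (fun X ↦ h X / h' X) X₀ := by
  simpa only [div_eq_mul_inv] using hh.mul (hh'.inv hne)

lemma prod {ι : Type*} (s : Finset ι) {g : ι → W.Point → F} (hX₀ : X₀ ≠ 0)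
    (hg : ∀ i ∈ s, IsRegAt (g i) X₀) : IsRegAt (fun X ↦ ∏ i ∈ s, g i X) X₀ := by
  classical
  induction s using Finset.induction_on with
  | empty => simpa using IsRegAt.const 1 hX₀
  | insert i s hi ih =>
    simp only [Finset.prod_insert hi]
    exact (hg i (Finset.mem_insert_self _ _)).mul
      (ih fun j hj ↦ hg j (Finset.mem_insert_of_mem hj))

lemma eval (hh : IsRegAt h X₀) (a : F[X]) : IsRegAt (fun X ↦ a.eval (h X)) X₀ := by
  induction a using Polynomial.induction_on' with
  | add p q hp hq => simpa only [eval_add] using hp.add hq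
  | monomial n c => simpa only [eval_monomial] using (IsRegAt.const c hh.ne_zero).mul (hh.pow n)

lemma xCoord (hX₀ : X₀ ≠ 0) : IsRegAt xCoord X₀ :=
  (IsRegAt.value (CoordinateRing.mk W (C X)) hX₀).congr
    ((eventually_ne 0).mono fun P hP ↦ by rw [value_mk_C hP, eval_X]) (by rw [value_mk_C hX₀, eval_X])

lemma yCoord (hX₀ : X₀ ≠ 0) : IsRegAt yCoord X₀ :=
  (IsRegAt.value (CoordinateRing.mk W Y) hX₀).congr
    ((eventually_ne 0).mono fun _ hX ↦ (value_mk_Y hX).symm) (value_mk_Y hX₀).symm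

/-- The numerator vanishes almost everywhere, hence identically. This extends identities of germs to
every point at which both sides are regular. -/
lemma eq_zero (hh : IsRegAt h X₀) (h0 : ∀ᶠ X in cofinite, h X = 0) : h X₀ = 0 := by
  obtain ⟨u, v, hv, h1, h2⟩ := hh
  have : u = 0 := eq_zero_of_value (by filter_upwards [h0, h2] with X e1 e2; rw [← e2, e1, zero_mul])
  rw [this, value_zero, mul_eq_zero] at h1
  exact h1.resolve_right hv

end IsRegAt

lemma IsRat.eventually_isRegAt {h : W.Point → F} (hh : IsRat h) :
    ∀ᶠ X in cofinite, IsRegAt h X := by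
  obtain ⟨a, b, hb, hab⟩ := hh.exists_div
  filter_upwards [hab, eventually_value_ne_zero hb] with X h1 h2 using ⟨a, b, h2, h1, hab⟩

/-- The rational map `m` is defined at `X₀`, with an affine value. -/
structure IsRegMapAt (m : W.Point → W.Point) (X₀ : W.Point) : Prop extends IsRatMap m where
  ne_zero : m X₀ ≠ 0
  regX : IsRegAt (fun X ↦ EllipticCongruence.xCoord (m X)) X₀
  regY : IsRegAt (fun X ↦ EllipticCongruence.yCoord (m X)) X₀

namespace IsRegMapAt

variable {m m' : W.Point → W.Point} {X₀ : W.Point}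

lemma value (hm : IsRegMapAt m X₀) (f : W.CoordinateRing) :
    IsRegAt (fun X ↦ value f (m X)) X₀ := by
  obtain ⟨a, b, rfl⟩ := exists_ofPair f
  refine ((hm.regX.eval a).add ((hm.regX.eval b).mul hm.regY)).congr ?_ ?_
  · filter_upwards [hm.tendsto.eventually (eventually_ne 0)] with X hX using value_ofPair hX a b
  · exact value_ofPair hm.ne_zero a b

lemma comp (hm : IsRegMapAt m X₀) {h : W.Point → F} (hh : IsRegAt h (m X₀)) :
    IsRegAt (fun X ↦ h (m X)) X₀ := by
  obtain ⟨u, v, hv, h0, h1⟩ := hh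
  have hv0 : v ≠ 0 := by rintro rfl; simp at hv
  refine ((hm.value u).div (hm.value v) hv).congr ?_ ?_
  · filter_upwards [hm.tendsto.eventually h1, hm.tendsto.eventually (eventually_value_ne_zero hv0)]
      with X h1 h2
    rw [eq_div_iff h2, h1]
  · rw [eq_div_iff hv, h0]

lemma comp_map (hm : IsRegMapAt m X₀) (hm' : IsRegMapAt m' (m X₀)) :
    IsRegMapAt (fun X ↦ m' (m X)) X₀ :=
  ⟨hm.1.comp_map hm'.1, hm'.ne_zero, hm.comp hm'.regX, hm.comp hm'.regY⟩

lemma addConst_of_xCoord_ne {S : W.Point} (hX₀ : X₀ ≠ 0) (hS : S ≠ 0)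
    (hx : EllipticCongruence.xCoord X₀ ≠ EllipticCongruence.xCoord S) :
    IsRegMapAt (fun X ↦ X + S) X₀ := by
  have hl : IsRegAt (fun X ↦ (EllipticCongruence.yCoord X - EllipticCongruence.yCoord S) /
      (EllipticCongruence.xCoord X - EllipticCongruence.xCoord S)) X₀ :=
    ((IsRegAt.yCoord hX₀).sub (.const _ hX₀)).div ((IsRegAt.xCoord hX₀).sub (.const _ hX₀))
      (sub_ne_zero.mpr hx)
  have hev : ∀ᶠ X in cofinite, EllipticCongruence.xCoord X ≠ EllipticCongruence.xCoord S :=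
    eventually_xCoord_ne (eventually_ne 0) (.of_forall fun _ ↦ hS) (eventually_ne S)
        (eventually_ne (-S))
  have h1 : IsRegAt (fun X ↦ EllipticCongruence.xCoord (X + S)) X₀ := by
    refine (((((hl.pow 2).add ((IsRegAt.const W.a₁ hX₀).mul hl)).sub (.const W.a₂ hX₀)).sub
      (.xCoord hX₀)).sub (.const (EllipticCongruence.xCoord S) hX₀)).congr ?_ (xCoord_add hX₀ hS hx)
    filter_upwards [eventually_ne 0, hev] with X hX hx using xCoord_add hX hS hx
  refine ⟨.addConst S, add_ne_zero hx, h1, ((((hl.mul (h1.sub (.xCoord hX₀))).add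
    (.yCoord hX₀)).neg.sub ((IsRegAt.const W.a₁ hX₀).mul h1)).sub (.const W.a₃ hX₀)).congr ?_
    (yCoord_add hX₀ hS hx)⟩
  filter_upwards [eventually_ne 0, hev] with X hX hx using yCoord_add hX hS hx

/-- The chord formula fails at points with the x-coordinate of S. Translation by a general R
followed by translation by S − R avoids this. -/
lemma addConst {S : W.Point} (hX₀ : X₀ ≠ 0) (hS : X₀ + S ≠ 0) :
    IsRegMapAt (fun X ↦ X + S) X₀ := by
  obtain ⟨R, h1, h2, h3, h4, h5⟩ := ((eventually_ne 0).and ((eventually_ne X₀).and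
    ((eventually_ne (-X₀)).and ((eventually_ne S).and
    (IsRatMap.eventually_nsmul_ne two_ne_zero (S - X₀)))))).exists
  have hA : IsRegMapAt (fun X ↦ X + R) X₀ := by
    refine addConst_of_xCoord_ne hX₀ h1 fun hx ↦ ?_
    rcases (xCoord_eq_iff hX₀ h1).mp hx with h | h
    · exact h2 h.symm
    · exact h3 (by rw [h, neg_neg])
  have hB : IsRegMapAt (fun X ↦ X + (S - R)) (X₀ + R) := by
    refine addConst_of_xCoord_ne hA.ne_zero (sub_ne_zero.mpr h4.symm) fun hx ↦ ?_
    rcases (xCoord_eq_iff hA.ne_zero (sub_ne_zero.mpr h4.symm)).mp hx with h | h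
    · refine h5 ?_
      rw [two_nsmul]
      have : R = S - R - X₀ := by rw [← h]; abel
      nth_rw 1 [this]
      abel
    · refine hS ?_
      have : X₀ = -(S - R) - R := by rw [← h]; abel
      rw [this]
      abel
  simpa [add_assoc] using hA.comp_map hB

/-- A rational map is regular at almost all points, and nX = n(X + S) − nS moves X₀ to a general
point. -/
lemma nsmul {n : ℕ} (hn : n ≠ 0) (hX₀ : X₀ ≠ 0) (hnX₀ : n • X₀ ≠ 0) :
    IsRegMapAt (fun X ↦ n • X) X₀ := by
  have hrat := IsRatMap.nsmul (W := W) hn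
  have ht : Tendsto (fun S ↦ X₀ + S) cofinite cofinite := (add_right_injective X₀).tendsto_cofinite
  obtain ⟨S, h1, h2, h3, h4⟩ := ((eventually_ne 0).and
    ((ht.eventually (eventually_ne 0)).and
    ((ht.eventually (hrat.1.1.eventually_isRegAt.and hrat.1.2.eventually_isRegAt)).and
    (ht.eventually (IsRatMap.eventually_nsmul_ne hn 0))))).exists
  have hA : IsRegMapAt (fun X ↦ X + S) X₀ := addConst hX₀ h2
  have hB : IsRegMapAt (fun X ↦ n • X) (X₀ + S) := ⟨hrat, h4, h3.1, h3.2⟩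
  have hC : IsRegMapAt (fun X ↦ X + -(n • S)) (n • (X₀ + S)) :=
    addConst h4 (by rwa [nsmul_add, add_neg_cancel_right])
  simpa [nsmul_add] using (hA.comp_map hB).comp_map hC

end IsRegMapAt

end RationalFunctions

end EllipticCongruence

end



noncomputable section

namespace EllipticCongruence

open WeierstrassCurve WeierstrassCurve.Affine Polynomial Filter
open scoped Polynomial.Bivariate

/-! ### Functions with divisor `n (T) - n (O)` and their values on lines -/

section Reciprocity

variable {F : Type*} [Field F] [DecidableEq F] [IsAlgClosed F] {W : WeierstrassCurve.Affine F}
  [W.IsElliptic]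

lemma isPrime_pointIdeal {X : W.Point} (hX : X ≠ 0) : (pointIdeal X).IsPrime := by
  have : pointIdeal X = RingHom.ker (valueHom X hX) := by
    ext f; rw [mem_pointIdeal hX, RingHom.mem_ker, valueHom_apply]
  rw [this]
  exact RingHom.ker_isPrime _

lemma eq_of_pointIdeal_le {X T : W.Point} (hX : X ≠ 0) (hT : T ≠ 0)
    (h : pointIdeal T ≤ pointIdeal X) : X = T := by
  have h1 : CoordinateRing.mk W (C (Polynomial.X - C (xCoord T))) ∈ pointIdeal T := by
    rw [mem_pointIdeal hT, value_mk_C hT]; simp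
  have h2 : CoordinateRing.mk W Y - CoordinateRing.mk W (C (C (yCoord T))) ∈ pointIdeal T := by
    rw [mem_pointIdeal hT, value_sub, value_mk_C hT, value_mk_Y hT]; simp
  have h3 := (mem_pointIdeal hX _).mp (h h1)
  have h4 := (mem_pointIdeal hX _).mp (h h2)
  rw [value_mk_C hX] at h3
  rw [value_sub, value_mk_C hX, value_mk_Y hX] at h4
  exact ext_coord hX hT (by simpa [sub_eq_zero] using h3) (by simpa [sub_eq_zero] using h4)

variable {n : ℕ} {T : W.Point} {f : W.CoordinateRing}

lemma value_eq_zero_iff (hn : n ≠ 0) (hT : T ≠ 0) (hf : Ideal.span {f} = pointIdeal T ^ n)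
    {X : W.Point} (hX : X ≠ 0) : value f X = 0 ↔ X = T := by
  have := isPrime_pointIdeal hX
  rw [← mem_pointIdeal hX, ← Ideal.span_singleton_le_iff_mem, hf, Ideal.IsPrime.pow_le_iff hn]
  refine ⟨eq_of_pointIdeal_le hX hT, ?_⟩
  rintro rfl
  exact le_rfl

lemma ne_zero_of_span (hn : n ≠ 0) (hT : T ≠ 0) (hf : Ideal.span {f} = pointIdeal T ^ n) :
    f ≠ 0 := by
  rintro rfl
  obtain ⟨X, hX, h⟩ := ((eventually_ne (0 : W.Point)).and (eventually_ne T)).exists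
  exact h ((value_eq_zero_iff hn hT hf hX).mp (value_zero X))

lemma pointIdeal_neg_mul (hT : T ≠ 0) : pointIdeal (-T) * pointIdeal T =
    Ideal.span {CoordinateRing.mk W (C (X - C (xCoord T)))} := by
  cases T with
  | zero => exact absurd rfl hT
  | some x y h => exact CoordinateRing.XYIdeal_neg_mul h

lemma neg_ne_self_of_odd (hn : Odd n) (hT : T ≠ 0) (hnT : n • T = 0) : -T ≠ T := by
  intro h
  apply hT
  obtain ⟨k, rfl⟩ := hn
  have h2 : 2 • T = 0 := by
    rw [two_nsmul]; nth_rw 1 [← h]; exact neg_add_cancel T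
  rwa [add_nsmul, mul_comm, mul_smul, h2, smul_zero, zero_add, one_smul] at hnT

/-- The norm vanishes only at x(T), because f vanishes only at T; the point is that its exponent m
is n. Let g be the cofactor of f in (x − x(T))^n. Up to a constant, g and X ↦ f(−X) differ by a
power of x − x(T), and the one carrying an extra power would vanish at T. But both are nonzero
there, as −T ≠ T. -/
lemma pairNorm_eq_of_span {a b : F[X]} (hn : Odd n) (hT : T ≠ 0) (hnT : n • T = 0)
    (hf : Ideal.span {(ofPair a b : W.CoordinateRing)} = pointIdeal T ^ n) :
    ∃ c : F, c ≠ 0 ∧ pairNorm W a b = C c * (X - C (xCoord T)) ^ n := by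
  have hn0 : n ≠ 0 := hn.pos.ne'
  have hT' := neg_point_ne_zero hT
  have hne := neg_ne_self_of_odd hn hT hnT
  have hN0 := pairNorm_ne_zero (ne_zero_of_span hn0 hT hf)
  have hroots : ∀ r ∈ (pairNorm W a b).roots, r = xCoord T := by
    intro r hr
    obtain ⟨X, hX, rfl⟩ := exists_point (W := W) r
    have h0 := (mem_roots hN0).mp hr
    rw [IsRoot, eval_pairNorm hX, mul_eq_zero, value_eq_zero_iff hn0 hT hf hX,
      value_eq_zero_iff hn0 hT hf (neg_point_ne_zero hX)] at h0
    rcases h0 with rfl | rfl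
    · rfl
    · rw [xCoord_neg]
  set c := (pairNorm W a b).leadingCoeff with hc
  set m := Multiset.card (pairNorm W a b).roots with hm
  have hNm : pairNorm W a b = C c * (X - C (xCoord T)) ^ m := by
    conv_lhs => rw [(IsAlgClosed.splits (pairNorm W a b)).eq_prod_roots,
      Multiset.eq_replicate_of_mem hroots]
    simp [hc, hm]
  have hc0 : c ≠ 0 := leadingCoeff_ne_zero.mpr hN0
  refine ⟨c, hc0, ?_⟩
  have hvT : value (ofPair a b : W.CoordinateRing) T = 0 := (value_eq_zero_iff hn0 hT hf hT).mpr rfl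
  -- the cofactor of `f` in `(x - x_T) ^ n`
  have hp : Ideal.span {CoordinateRing.mk W (C (X - C (xCoord T))) ^ n} =
      pointIdeal (-T) ^ n * Ideal.span {(ofPair a b : W.CoordinateRing)} := by
    rw [hf, ← mul_pow, pointIdeal_neg_mul hT, Ideal.span_singleton_pow]
  obtain ⟨g, hg⟩ : (ofPair a b : W.CoordinateRing) ∣
      CoordinateRing.mk W (C (X - C (xCoord T))) ^ n := by
    rw [← Ideal.span_singleton_le_span_singleton, hp]
    exact Ideal.mul_le_inf.trans inf_le_right
  have hf0 : Ideal.span {(ofPair a b : W.CoordinateRing)} ≠ ⊥ := by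
    simpa using ne_zero_of_span hn0 hT hf
  have hgs : Ideal.span {g} = pointIdeal (-T) ^ n := by
    rw [hg, mul_comm (pointIdeal (-T) ^ n), ← Ideal.span_singleton_mul_span_singleton] at hp
    rw [Ideal.span_singleton_mul_right_inj (ne_zero_of_span hn0 hT hf)] at hp
    exact hp
  have hgv : ∀ {X : W.Point}, X ≠ 0 → (value g X = 0 ↔ X = -T) :=
    fun hX ↦ value_eq_zero_iff hn0 hT' hgs hX
  have hx : ∀ X : W.Point, X ≠ 0 → (xCoord X - xCoord T) ^ n =
      value (ofPair a b) X * value g X := by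
    intro X hX
    rw [← value_mul, ← hg, value_pow hX, value_mk_C hX]
    simp
  have hx' : ∀ X : W.Point, X ≠ 0 → c * (xCoord X - xCoord T) ^ m =
      value (ofPair a b) X * value (ofPair a b) (-X) := by
    intro X hX
    rw [← eval_pairNorm hX, hNm]
    simp
  have hXT : CoordinateRing.mk W (C (X - C (xCoord T))) ≠ 0 := CoordinateRing.XClass_ne_zero _
  rcases lt_trichotomy m n with hlt | heq | hlt
  · exfalso
    have : C c • g - CoordinateRing.mk W (C ((X - C (xCoord T)) ^ (n - m))) * conjPair W a b = 0 := by
      refine eq_zero_of_value ?_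
      filter_upwards [eventually_ne (0 : W.Point), eventually_value_ne_zero
        (ne_zero_of_span hn0 hT hf)] with X hX hfX
      rw [value_sub, CoordinateRing.smul, value_mul, value_mul, value_mk_C hX, value_mk_C hX,
        value_conjPair]
      apply mul_left_cancel₀ hfX
      have e1 := hx X hX
      have e2 := hx' X hX
      rw [← Nat.add_sub_of_le hlt.le, pow_add] at e1
      simp only [eval_C, eval_pow, eval_sub, eval_X]
      linear_combination -c * e1 + (xCoord X - xCoord T) ^ (n - m) * e2
    have h1 := congrArg (fun e ↦ value e T) this
    simp only [value_sub, CoordinateRing.smul, value_mul, value_mk_C hT, value_zero] at h1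
    simp only [eval_C, eval_pow, eval_sub, eval_X, sub_self] at h1
    rw [zero_pow (by omega), zero_mul, sub_zero, mul_eq_zero, hgv hT] at h1
    exact h1.elim hc0 fun h ↦ hne h.symm
  · rw [hNm, heq]
  · exfalso
    have : conjPair W a b - C c • CoordinateRing.mk W (C ((X - C (xCoord T)) ^ (m - n))) * g = 0 := by
      refine eq_zero_of_value ?_
      filter_upwards [eventually_ne (0 : W.Point), eventually_value_ne_zero
        (ne_zero_of_span hn0 hT hf)] with X hX hfX
      rw [value_sub, CoordinateRing.smul, value_mul, value_mul, value_mk_C hX, value_mk_C hX,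
        value_conjPair]
      apply mul_left_cancel₀ hfX
      have e1 := hx X hX
      have e2 := hx' X hX
      rw [← Nat.add_sub_of_le hlt.le, pow_add] at e2
      simp only [eval_C, eval_pow, eval_sub, eval_X]
      linear_combination c * (xCoord X - xCoord T) ^ (m - n) * e1 - e2
    have h1 := congrArg (fun e ↦ value e T) this
    simp only [value_sub, CoordinateRing.smul, value_mul, value_mk_C hT, value_zero,
      value_conjPair] at h1
    simp only [eval_C, eval_pow, eval_sub, eval_X, sub_self] at h1
    rw [zero_pow (by omega), mul_zero, zero_mul, sub_zero, value_eq_zero_iff hn0 hT hf hT'] at h1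
    exact hne h1

lemma exists_value_mul_value_neg (hn : Odd n) (hT : T ≠ 0) (hnT : n • T = 0)
    (hf : Ideal.span {f} = pointIdeal T ^ n) :
    ∃ c : F, c ≠ 0 ∧ ∀ X : W.Point, X ≠ 0 →
      value f X * value f (-X) = c * (xCoord X - xCoord T) ^ n := by
  obtain ⟨a, b, rfl⟩ := exists_ofPair f
  obtain ⟨c, hc, h⟩ := pairNorm_eq_of_span hn hT hnT hf
  refine ⟨c, hc, fun X hX ↦ ?_⟩
  rw [← eval_pairNorm hX, h]
  simp

/-- The monic cubic polynomial whose roots are the first coordinates of the points of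
intersection of `W` with the line `y = m(x)`. -/
def lineCubic (W : WeierstrassCurve.Affine F) (m : F[X]) : F[X] :=
  X ^ 3 + C W.a₂ * X ^ 2 + C W.a₄ * X + C W.a₆ - m ^ 2 - m * (C W.a₁ * X + C W.a₃)

lemma natDegree_lineCubic {m : F[X]} (hm : m.natDegree ≤ 1) : (lineCubic W m).natDegree = 3 := by
  have h1 : (m ^ 2 + m * (C W.a₁ * X + C W.a₃)).natDegree ≤ 2 := by
    refine natDegree_add_le_of_degree_le (natDegree_pow_le.trans (by omega))
      (natDegree_mul_le.trans ?_)
    have : (C W.a₁ * X + C W.a₃).natDegree ≤ 1 := natDegree_linear_le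
    omega
  have h2 : (X ^ 3 + C W.a₂ * X ^ 2 + C W.a₄ * X + C W.a₆ : F[X]).natDegree = 3 := by
    simpa using natDegree_cubic (R := F) (a := 1) (b := W.a₂) (c := W.a₄) (d := W.a₆) one_ne_zero
  rw [lineCubic, sub_sub, natDegree_sub_eq_left_of_natDegree_lt (by omega), h2]

/-- The norm has odd degree n, so of the two competing degrees 2 deg a and 2 deg b + 3 the second is
the larger. -/
lemma degree_pair_of_span {a b : F[X]} {k : ℕ} (hn : n = 2 * k + 1) {c x : F} (hc : c ≠ 0)
    (hN : pairNorm W a b = C c * (X - C x) ^ n) (hb0 : b ≠ 0) :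
    a.natDegree ≤ k ∧ b.natDegree + 1 = k := by
  have h1 : (pairNorm W a b).degree = (n : ℕ) := by
    rw [hN, degree_C_mul hc, degree_pow, degree_X_sub_C]; simp
  rw [degree_pairNorm, degree_eq_natDegree hb0] at h1
  by_cases ha : a = 0
  · subst ha
    have h2 : ((2 * b.natDegree + 3 : ℕ) : WithBot ℕ) = (n : ℕ) := by
      rw [← h1]; simp
    rw [Nat.cast_inj] at h2
    rw [natDegree_zero]
    omega
  · rw [degree_eq_natDegree ha] at h1
    have h2 : ((max (2 * a.natDegree) (2 * b.natDegree + 3) : ℕ) : WithBot ℕ) = (n : ℕ) := by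
      rw [← h1, Nat.cast_withBot, WithBot.coe_max]; simp; rfl
    rw [Nat.cast_inj] at h2
    omega

/-- Weil reciprocity for f and a line. On the line y = m(x) the function f restricts to q = a + b m,
and its norm is congruent to −b² times the line cubic modulo q. The resultant of q with the norm is
thus, from the norm as a power, a power of q at x(T) up to constants; and, from the congruence, the
resultant of q with the cubic times the squared resultant of q and b. The latter is that of a and b
and does not see the line. -/
lemma resultant_line {a b : F[X]} {k : ℕ} (hn : n = 2 * k + 1) {c x : F} (hc : c ≠ 0)
    (hN : pairNorm W a b = C c * (X - C x) ^ n) (hb0 : b ≠ 0) {m : F[X]} (hm : m.natDegree ≤ 1) :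
    c ^ k * ((-1) ^ (k * n) * (a + b * m).eval x ^ n) =
      resultant a b k b.natDegree ^ 2 * (-1) ^ k * resultant (a + b * m) (lineCubic W m) k 3 := by
  obtain ⟨ha, hb⟩ := degree_pair_of_span hn hc hN hb0
  have hq : (a + b * m).natDegree ≤ k :=
    natDegree_add_le_of_degree_le ha (natDegree_mul_le.trans (by omega))
  rw [← resultant_X_sub_C_pow_right _ _ _ _ hq, ← resultant_C_mul_right, ← hN]
  have e : pairNorm W a b = b * (b * (C (-1) * lineCubic W m)) +
      (a + b * m) * (a - b * m - b * (C W.a₁ * X + C W.a₃)) := by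
    rw [pairNorm, lineCubic, C_neg, C_1]
    ring
  have hd1 : (C (-1) * lineCubic W m).natDegree = 3 := by
    rw [natDegree_C_mul (by simp), natDegree_lineCubic hm]
  have hne : C (-1) * lineCubic W m ≠ 0 := by
    intro h; rw [h] at hd1; simp at hd1
  have hd2 : (b * (C (-1) * lineCubic W m)).natDegree = b.natDegree + 3 := by
    rw [natDegree_mul hb0 hne, hd1]
  have hdeg : (a - b * m - b * (C W.a₁ * X + C W.a₃)).natDegree + k ≤ n := by
    have : (a - b * m - b * (C W.a₁ * X + C W.a₃)).natDegree ≤ k := by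
      have h1 : (C W.a₁ * X + C W.a₃ : F[X]).natDegree ≤ 1 := natDegree_linear_le
      refine (natDegree_sub_le_of_le (natDegree_sub_le_of_le ha (n := k)
        (natDegree_mul_le.trans (by omega))) (n := k) (natDegree_mul_le.trans (by omega))).trans ?_
      simp
    omega
  have e1 : n = b.natDegree + (b * (C (-1) * lineCubic W m)).natDegree := by omega
  have e2 : resultant (a + b * m) (b * (b * (C (-1) * lineCubic W m))) k n =
      resultant (a + b * m) b k b.natDegree * (resultant (a + b * m) b k b.natDegree *
        ((-1) ^ k * resultant (a + b * m) (lineCubic W m) k 3)) := by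
    rw [e1, resultant_mul_right _ _ _ _ hq, hd2, ← hd1, resultant_mul_right _ _ _ _ hq, hd1,
      resultant_C_mul_right]
  rw [e, resultant_add_mul_right _ _ _ _ _ hdeg hq, e2,
    resultant_add_mul_left _ _ _ _ _ (by omega) le_rfl]
  ring

lemma value_of_line {a b : F[X]} {P : W.Point} (hP : P ≠ 0) {m : F[X]}
    (hm : m.eval (xCoord P) = yCoord P) :
    value (ofPair a b) P = (a + b * m).eval (xCoord P) := by
  rw [value_ofPair hP, eval_add, eval_mul, hm]

/-- The line through `P` and `Q`. -/
def lineThrough (P Q : W.Point) : F[X] :=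
  linePolynomial (xCoord P) (yCoord P) ((yCoord P - yCoord Q) / (xCoord P - xCoord Q))

lemma eval_lineThrough (P Q : W.Point) (x : F) : (lineThrough P Q).eval x =
    yCoord P + (yCoord P - yCoord Q) / (xCoord P - xCoord Q) * (x - xCoord P) := by
  simp [lineThrough, linePolynomial]
  ring

lemma lineCubic_lineThrough {P Q : W.Point} (hP : P ≠ 0) (hQ : Q ≠ 0)
    (hx : xCoord P ≠ xCoord Q) : lineCubic W (lineThrough P Q) =
      (X - C (xCoord P)) * (X - C (xCoord Q)) * (X - C (xCoord (P + Q))) := by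
  have h := addPolynomial_slope (nonsingular_coord hP).1 (nonsingular_coord hQ).1
    (fun h ↦ hx h.1)
  have hx3 : xCoord (P + Q) = W.addX (xCoord P) (xCoord Q)
      (W.slope (xCoord P) (xCoord Q) (yCoord P) (yCoord Q)) := by
    rw [xCoord_add hP hQ hx, slope_of_X_ne hx, addX]
  rw [← hx3, slope_of_X_ne hx, addPolynomial] at h
  rw [← neg_inj, ← h, lineCubic, lineThrough, WeierstrassCurve.Affine.polynomial]
  simp
  ring

/-- Values of a function with divisor `n (T) - n (O)` on the three points of a line. -/
theorem exists_value_line (hn : Odd n) (hT : T ≠ 0) (hnT : n • T = 0)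
    (hf : Ideal.span {f} = pointIdeal T ^ n) :
    ∃ c : F, c ≠ 0 ∧ ∀ P Q : W.Point, P ≠ 0 → Q ≠ 0 → xCoord P ≠ xCoord Q →
      value f P * value f Q * value f (-(P + Q)) =
        c * (yCoord T - (lineThrough P Q).eval (xCoord T)) ^ n := by
  have hn0 : n ≠ 0 := hn.pos.ne'
  have hT' := neg_point_ne_zero hT
  have hne := neg_ne_self_of_odd hn hT hnT
  obtain ⟨a, b, rfl⟩ := exists_ofPair f
  obtain ⟨c, hc, hN⟩ := pairNorm_eq_of_span hn hT hnT hf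
  have hvT := (value_eq_zero_iff hn0 hT hf hT).mpr rfl
  have hvT' : value (ofPair a b) (-T) ≠ 0 := fun h ↦ hne ((value_eq_zero_iff hn0 hT hf hT').mp h)
  rw [value_ofPair hT] at hvT
  rw [value_ofPair hT', xCoord_neg] at hvT'
  have hbT : b.eval (xCoord T) ≠ 0 := by
    intro h
    rw [h] at hvT hvT'
    exact hvT' (by linear_combination hvT)
  have hb0 : b ≠ 0 := by rintro rfl; simp at hbT
  obtain ⟨k, hk⟩ := hn
  set B := resultant a b k b.natDegree ^ 2 * (-1) ^ k with hB
  have hres : ∀ {m : F[X]}, m.natDegree ≤ 1 → _ := fun {m} hm ↦ resultant_line hk hc hN hb0 hm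
  -- From f(T) = 0: the restriction of f to the line, taken at x(T), is proportional to the vertical
  -- distance from T to the line.
  have hqT : ∀ m : F[X], (a + b * m).eval (xCoord T) =
      -(b.eval (xCoord T) * (yCoord T - m.eval (xCoord T))) := by
    intro m
    rw [eval_add, eval_mul]
    linear_combination hvT
  -- B depends on f alone, so a single line missing T suffices: y = y(T) − 1.
  have hB0 : B ≠ 0 := by
    intro h
    have := hres (m := C (yCoord T - 1)) ((natDegree_C _).le.trans (by omega))
    rw [← hB, h, hqT] at this
    simp [hc, hbT] at this
  refine ⟨B⁻¹ * c ^ k * (-1) ^ (k * n) * (-b.eval (xCoord T)) ^ n * (-1) ^ (3 * k), ?_, ?_⟩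
  · simp [hB0, hc, hbT, hn0]
  intro P Q hP hQ hx
  have hm : (lineThrough P Q).natDegree ≤ 1 := by
    rw [lineThrough, linePolynomial]
    compute_degree
  have hPQ := add_ne_zero hx
  have h1 := hres hm
  obtain ⟨ha, hb⟩ := degree_pair_of_span hk hc hN hb0
  have hq : (a + b * lineThrough P Q).natDegree ≤ k :=
    natDegree_add_le_of_degree_le ha (natDegree_mul_le.trans (by omega))
  have hx' : xCoord P - xCoord Q ≠ 0 := sub_ne_zero.mpr hx
  -- The cubic has roots x(P), x(Q) and x(P + Q), which belong to the points P, Q and −(P + Q) of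
  -- the line, so its resultant with q is the product of the values of f there, up to sign.
  have hcub : resultant (a + b * lineThrough P Q) (lineCubic W (lineThrough P Q)) k 3 =
      (-1) ^ (3 * k) * (value (ofPair a b) P * value (ofPair a b) Q *
        value (ofPair a b) (-(P + Q))) := by
    rw [value_of_line hP (m := lineThrough P Q), value_of_line hQ (m := lineThrough P Q),
      value_of_line (neg_point_ne_zero hPQ) (m := lineThrough P Q), lineCubic_lineThrough hP hQ hx,
      xCoord_neg]
    · have e1 : (3 : ℕ) = ((X - C (xCoord P)) * (X - C (xCoord Q))).natDegree +
          (X - C (xCoord (P + Q))).natDegree := by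
        rw [natDegree_mul (X_sub_C_ne_zero _) (X_sub_C_ne_zero _)]; simp
      have e2 : ((X - C (xCoord P)) * (X - C (xCoord Q))).natDegree = (X - C (xCoord P)).natDegree +
          (X - C (xCoord Q)).natDegree := by
        rw [natDegree_mul (X_sub_C_ne_zero _) (X_sub_C_ne_zero _)]
      rw [e1, resultant_mul_right _ _ _ _ hq, e2, resultant_mul_right _ _ _ _ hq]
      simp only [natDegree_X_sub_C]
      rw [resultant_X_sub_C_right _ _ _ hq, resultant_X_sub_C_right _ _ _ hq,
        resultant_X_sub_C_right _ _ _ hq]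
      ring
    · rw [xCoord_neg, yCoord_neg hPQ, yCoord_add hP hQ hx, eval_lineThrough]
      ring
    · rw [eval_lineThrough]
      field_simp
      ring
    · rw [eval_lineThrough]; ring
  rw [hcub, ← hB, hqT] at h1
  have h3 : ((-1 : F) ^ (3 * k)) ^ 2 = 1 := by
    rw [← pow_mul, mul_comm _ 2, pow_mul]; simp
  rw [show -(b.eval (xCoord T) * (yCoord T - (lineThrough P Q).eval (xCoord T))) =
    (-b.eval (xCoord T)) * (yCoord T - (lineThrough P Q).eval (xCoord T)) by ring, mul_pow] at h1
  apply mul_left_cancel₀ hB0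
  set V := value (ofPair a b) P * value (ofPair a b) Q * value (ofPair a b) (-(P + Q))
  have h4 : B * B⁻¹ = 1 := mul_inv_cancel₀ hB0
  linear_combination -(-1) ^ (3 * k) * h1 - B * V * h3 -
    (c ^ k * (-1) ^ (k * n) * (-b.eval (xCoord T)) ^ n * (-1) ^ (3 * k) *
      (yCoord T - (lineThrough P Q).eval (xCoord T)) ^ n) * h4

end Reciprocity

end EllipticCongruence

end



noncomputable section

namespace EllipticCongruence

open WeierstrassCurve WeierstrassCurve.Affine Polynomial Filter
open scoped Polynomial.Bivariate nonZeroDivisors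

/-! ### Existence and uniqueness of the values of the Weil pairing -/

section ClassGroup

variable {F : Type*} [Field F] [DecidableEq F] {W : WeierstrassCurve.Affine F}

lemma exists_pointUnit (T : W.Point) :
    ∃ I : (FractionalIdeal W.CoordinateRing⁰ W.FunctionField)ˣ,
      (I : FractionalIdeal W.CoordinateRing⁰ W.FunctionField) = (pointIdeal T : Ideal _) ∧
      Point.toClass T = Additive.ofMul (ClassGroup.mk W.FunctionField I) := by
  cases T with
  | zero =>
    refine ⟨1, by simp [pointIdeal], ?_⟩
    rw [map_one]
    exact Point.toClass_zero
  | some x y h => exact ⟨CoordinateRing.XYIdeal' (W := W) h, CoordinateRing.XYIdeal'_eq h,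
      Point.toClass_some h⟩

/-- An `n`-torsion point is the zero of a function with divisor `n (T) - n (O)`. -/
lemma exists_span_eq_pow {n : ℕ} {T : W.Point} (hT : n • T = 0) :
    ∃ f : W.CoordinateRing, f ≠ 0 ∧ Ideal.span {f} = pointIdeal T ^ n := by
  obtain ⟨I, hI, hIT⟩ := exists_pointUnit T
  have h1 : ClassGroup.mk W.FunctionField (I ^ n) = 1 := by
    have := congrArg Point.toClass hT
    rw [map_nsmul, hIT, map_zero, ← ofMul_pow] at this
    rw [map_pow]
    exact this
  obtain ⟨f, hf, h⟩ := (ClassGroup.mk_eq_one_of_coe_ideal (I' := pointIdeal T ^ n)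
    (by rw [Units.val_pow_eq_pow_val, hI, FractionalIdeal.coeIdeal_pow])).mp h1
  exact ⟨f, hf, h.symm⟩

/-- Addition of points is multiplication of ideal classes, so the two ideals differ by the principal
fractional ideal of β/α. -/
lemma exists_span_mul_pointIdeal (T T' : W.Point) :
    ∃ α β : W.CoordinateRing, α ≠ 0 ∧ β ≠ 0 ∧
      Ideal.span {α} * pointIdeal (T + T') = Ideal.span {β} * (pointIdeal T * pointIdeal T') := by
  obtain ⟨I, hI, hIT⟩ := exists_pointUnit T
  obtain ⟨I', hI', hIT'⟩ := exists_pointUnit T'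
  obtain ⟨J, hJ, hJT⟩ := exists_pointUnit (T + T')
  refine (ClassGroup.mk_eq_mk_of_coe_ideal (I := J) (J := I * I') hJ
    (by rw [Units.val_mul, hI, hI', FractionalIdeal.coeIdeal_mul])).mp ?_
  have := map_add Point.toClass T T'
  rw [hIT, hIT', hJT, ← ofMul_mul, ← map_mul] at this
  exact Additive.ofMul.injective this

end ClassGroup

/-! ### Roots of f ∘ [n], and bilinearity of the pairing -/

section Existence

variable {F : Type*} [Field F] [DecidableEq F] [IsAlgClosed F] {W : WeierstrassCurve.Affine F}
  [W.IsElliptic] {n : ℕ} {S T : W.Point} {f : W.CoordinateRing}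

lemma IsRatMap.eventually_value_ne_zero {m : W.Point → W.Point} (hm : IsRatMap m) (hf : f ≠ 0) :
    ∀ᶠ X in cofinite, EllipticCongruence.value f (m X) ≠ 0 :=
  hm.tendsto.eventually (EllipticCongruence.eventually_value_ne_zero hf)

/-- Modulo n-th powers of rational functions f is additive. The line formula makes f(P) f(Q)
f(−(P+Q)) a constant times an n-th power, and so is f(R) f(−R) for R = P + Q; dividing removes the
sign. The remaining constant has an n-th root. -/
lemma exists_value_add (hn : Odd n) (hT : T ≠ 0) (hnT : n • T = 0)
    (hf : Ideal.span {f} = pointIdeal T ^ n) {m m' : W.Point → W.Point} (hm : IsRatMap m)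
    (hm' : IsRatPoint m') (hv' : ∀ᶠ X in cofinite, value f (m' X) ≠ 0)
    (hs : IsRatMap fun X ↦ m X + m' X)
    (hx : ∀ᶠ X in cofinite, xCoord (m X) ≠ xCoord (m' X)) :
    ∃ k : W.Point → F, IsRat k ∧
      ∀ᶠ X in cofinite, value f (m X + m' X) = value f (m X) * value f (m' X) * k X ^ n := by
  obtain ⟨c, hc, h1⟩ := exists_value_mul_value_neg hn hT hnT hf
  obtain ⟨c', hc', h2⟩ := exists_value_line hn hT hnT hf
  have hf0 := ne_zero_of_span hn.pos.ne' hT hf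
  obtain ⟨r, hr⟩ := IsAlgClosed.exists_pow_nat_eq (c / c') hn.pos
  let l : W.Point → F := fun X ↦ yCoord T - (yCoord (m X) +
    (yCoord (m X) - yCoord (m' X)) / (xCoord (m X) - xCoord (m' X)) * (xCoord T - xCoord (m X)))
  have hl : IsRat l := (IsRat.const _).sub (hm.1.2.add (((hm.1.2.sub hm'.2).div
    (hm.1.1.sub hm'.1)).mul ((IsRat.const _).sub hm.1.1)))
  refine ⟨fun X ↦ r * (xCoord (m X + m' X) - xCoord T) / l X,
    ((IsRat.const r).mul (hs.1.1.sub (.const _))).div hl, ?_⟩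
  filter_upwards [hx, hm.eventually_value_ne_zero hf0, hv',
    (hs.comp_map .neg).eventually_value_ne_zero hf0] with X hx hv hv' hvs
  have hm0 : m X ≠ 0 := by intro h; simp [h] at hv
  have hm0' : m' X ≠ 0 := by intro h; simp [h] at hv'
  have e1 := h1 _ (add_ne_zero hx)
  have e2 := h2 _ _ hm0 hm0' hx
  rw [eval_lineThrough] at e2
  change _ = c' * l X ^ n at e2
  have hl0 : l X ^ n ≠ 0 := by
    intro h
    rw [h, mul_zero] at e2
    exact mul_ne_zero (mul_ne_zero hv hv') hvs e2
  rw [div_pow, mul_pow, hr]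
  field_simp
  apply mul_right_cancel₀ hvs
  linear_combination (l X ^ n * c') * e1 - c * (xCoord (m X + m' X) - xCoord T) ^ n * e2

/-- The case m = n makes f ∘ [n] an n-th power. The induction splits (m+1)X as (mX + S) + (X − S),
so that the addition formula applies from m = 1 on. -/
lemma exists_value_nsmul (hn : Odd n) (hT : T ≠ 0) (hnT : n • T = 0)
    (hf : Ideal.span {f} = pointIdeal T ^ n) {m : ℕ} (hm : 1 ≤ m) :
    ∃ k : W.Point → F, IsRat k ∧
      ∀ᶠ X in cofinite, value f (m • X) = value f X ^ m * k X ^ n := by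
  have hf0 := ne_zero_of_span hn.pos.ne' hT hf
  induction m, hm using Nat.le_induction with
  | base => exact ⟨_, .const 1, .of_forall fun X ↦ by simp⟩
  | succ m hm ih =>
    obtain ⟨k, hk, ih⟩ := ih
    have hm0 : m ≠ 0 := by omega
    obtain ⟨S, hS2, hSv, hSv'⟩ := ((IsRatMap.eventually_nsmul_ne (W := W) two_ne_zero 0).and
      ((eventually_value_ne_zero hf0).and (IsRatMap.neg.eventually_value_ne_zero hf0))).exists
    have hS : S ≠ 0 := by rintro rfl; simp at hS2
    have hS' : -S ≠ 0 := neg_point_ne_zero hS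
    have hmS : IsRatMap fun X : W.Point ↦ m • X + S := (IsRatMap.nsmul hm0).comp_map (.addConst S)
    have e1 : ∀ X : W.Point, (m + 1) • X = (m • X + S) + (X + -S) := fun X ↦ by
      rw [add_nsmul, one_nsmul]; abel
    obtain ⟨k₁, hk₁, h₁⟩ := exists_value_add hn hT hnT hf (IsRatMap.nsmul hm0) (.const S)
      (.of_forall fun _ ↦ hSv) hmS (eventually_xCoord_ne (IsRatMap.eventually_nsmul_ne hm0 0)
        (.of_forall fun _ ↦ hS) (IsRatMap.eventually_nsmul_ne hm0 _)
        (IsRatMap.eventually_nsmul_ne hm0 _))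
    obtain ⟨k₂, hk₂, h₂⟩ := exists_value_add hn hT hnT hf .id (.const (-S))
      (.of_forall fun _ ↦ hSv') (.addConst (-S)) (eventually_xCoord_ne (eventually_ne 0)
        (.of_forall fun _ ↦ hS') (eventually_ne _) (eventually_ne _))
    have hx : ∀ᶠ X in cofinite, xCoord (m • X + S) ≠ xCoord (X + -S) := by
      refine eventually_xCoord_ne (hmS.tendsto.eventually (eventually_ne 0))
        ((tendsto_add (-S)).eventually (eventually_ne 0)) ?_ ?_
      · rcases hm.eq_or_lt with rfl | hm1
        · refine .of_forall fun X h ↦ hS2 ?_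
          have : S = -S := by simpa using h
          rw [two_nsmul]
          exact eq_neg_iff_add_eq_zero.mp this
        · filter_upwards [IsRatMap.eventually_nsmul_ne (W := W) (n := m - 1) (by omega) (-S - S)]
            with X hX h
          apply hX
          have : m • X = (m - 1) • X + X := by
            conv_lhs => rw [← Nat.sub_add_cancel hm, add_nsmul, one_nsmul]
          rw [this] at h
          rw [show (m - 1) • X = (m - 1) • X + X + S - X - S by abel, h]
          abel
      · filter_upwards [IsRatMap.eventually_nsmul_ne (W := W) (n := m + 1) (by omega) 0] with X hX h
        exact hX (by rw [e1, h]; abel)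
    obtain ⟨k₃, hk₃, h₃⟩ := exists_value_add hn hT hnT hf hmS (IsRatMap.addConst (-S)).1
      ((IsRatMap.addConst (-S)).eventually_value_ne_zero hf0)
      (by simpa only [e1] using IsRatMap.nsmul (W := W) (n := m + 1) (by omega)) hx
    obtain ⟨r, hr⟩ := IsAlgClosed.exists_pow_nat_eq (value f S * value f (-S)) hn.pos
    refine ⟨_, (((IsRat.const r).mul hk).mul hk₁).mul (hk₂.mul hk₃), ?_⟩
    filter_upwards [ih, h₁, h₂, h₃] with X h h₁ h₂ h₃
    rw [e1, h₃, h₂, h₁, h]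
    simp only [mul_pow, hr]
    ring

/-- `g` is an `n`-th root of `f ∘ [n]`, where `f` is a function with divisor `n (T) - n (O)`. -/
structure IsTorsionRoot (n : ℕ) (T : W.Point) (g : W.Point → F) : Prop where
  isRat : IsRat g
  exists_pow_eq : ∃ f : W.CoordinateRing, f ≠ 0 ∧ Ideal.span {f} = pointIdeal T ^ n ∧
    ∀ᶠ X in cofinite, g X ^ n = value f (n • X)

theorem exists_isTorsionRoot (hn : Odd n) (hnT : n • T = 0) :
    ∃ g : W.Point → F, IsTorsionRoot n T g := by
  by_cases hT : T = 0
  · refine ⟨fun _ ↦ 1, .const 1, 1, one_ne_zero, by rw [hT, pointIdeal_zero, Ideal.one_eq_top.symm,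
      one_pow, Ideal.span_singleton_one, Ideal.one_eq_top], ?_⟩
    filter_upwards [IsRatMap.eventually_nsmul_ne (W := W) hn.pos.ne' 0] with X hX
    rw [one_pow, value_one hX]
  · obtain ⟨f, hf0, hf⟩ := exists_span_eq_pow hnT
    obtain ⟨k, hk, h⟩ := exists_value_nsmul hn hT hnT hf hn.pos
    exact ⟨_, (IsRat.value f).mul hk, f, hf0, hf, h.mono fun X hX ↦ by rw [hX, mul_pow]⟩

namespace IsTorsionRoot

variable {g g' : W.Point → F}

lemma eventually_ne_zero (hg : IsTorsionRoot n T g) (hn : n ≠ 0) : ∀ᶠ X in cofinite, g X ≠ 0 := by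
  obtain ⟨f, hf0, -, h⟩ := hg.2
  filter_upwards [h, (IsRatMap.nsmul hn).eventually_value_ne_zero hf0] with X h1 h2 h3
  rw [h3, zero_pow hn] at h1
  exact h2 h1.symm

/-- Two choices of f differ by a unit, that is a constant; the quotient of two roots then has
constant n-th power. This makes the pairing independent of choices. -/
lemma exists_eq_const_mul (hn : n ≠ 0) (hg : IsTorsionRoot n T g) (hg' : IsTorsionRoot n T g') :
    ∃ c : F, c ≠ 0 ∧ ∀ᶠ X in cofinite, g' X = c * g X := by
  have hne := hg.eventually_ne_zero hn
  have hne' := hg'.eventually_ne_zero hn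
  obtain ⟨hr, f, hf0, hf, h⟩ := hg
  obtain ⟨hr', f', hf0', hf', h'⟩ := hg'
  obtain ⟨w, hw⟩ := Ideal.span_singleton_eq_span_singleton.mp (hf.trans hf'.symm)
  obtain ⟨c, hc, hwc⟩ := exists_const_of_isUnit w.isUnit
  obtain ⟨c', hc', h1⟩ := (hr'.div hr).eq_const_of_pow hn (c := c) (by
    filter_upwards [h, h', hne, IsRatMap.eventually_nsmul_ne hn 0] with X h1 h2 h3 h4
    rw [div_pow, h1, h2, ← hw, value_mul, hwc, value_const h4]
    have : value f (n • X) ≠ 0 := h1 ▸ pow_ne_zero n h3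
    field_simp)
  refine ⟨c', ?_, ?_⟩
  · rintro rfl
    rw [zero_pow hn] at hc'
    exact hc hc'.symm
  · filter_upwards [h1, hne] with X h1 h2
    rw [← h1]; field_simp

/-- Translation by S does not change nX, so g(X + S)/g(X) has n-th power 1 and is constant. -/
lemma exists_translate (hn : n ≠ 0) (hg : IsTorsionRoot n T g) (hS : n • S = 0) :
    ∃ ζ : F, ζ ^ n = 1 ∧ ∀ᶠ X in cofinite, g (X + S) = ζ * g X := by
  have hne := hg.eventually_ne_zero hn
  obtain ⟨hr, f, hf0, hf, h⟩ := hg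
  obtain ⟨c, hc, h1⟩ := (((IsRatMap.addConst S).comp hr).div hr).eq_const_of_pow hn (c := 1) (by
    filter_upwards [h, (tendsto_add S).eventually h, hne] with X h1 h2 h3
    rw [div_pow, h2, nsmul_add, hS, add_zero, ← h1]
    exact div_self (pow_ne_zero n h3))
  refine ⟨c, hc, ?_⟩
  filter_upwards [h1, hne] with X h1 h2
  rw [← h1]; field_simp

end IsTorsionRoot

/-- The definition demands its identities at every admissible point. Both sides are regular there,
so the identities of germs imply them. -/
lemma isWeilPairingValue_iff (hn : n ≠ 0) {ζ : F} : IsWeilPairingValue n S T ζ ↔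
    ∃ g, IsTorsionRoot n T g ∧ ∀ᶠ X in cofinite, g (X + S) = ζ * g X := by
  constructor
  · rintro ⟨f, a, b, hf, ha, hb, h1, h2⟩
    have hb' := eventually_value_ne_zero hb
    refine ⟨fun X ↦ value a X / value b X, ⟨(IsRat.value a).div (.value b), f, ?_, hf, ?_⟩, ?_⟩
    · rintro rfl
      obtain ⟨X, hX, hX'⟩ := ((eventually_value_ne_zero ha).and
        (IsRatMap.eventually_nsmul_ne hn 0)).exists
      have := h1 X hX'
      rw [value_zero, mul_zero] at this
      exact hX (pow_eq_zero_iff hn |>.mp this)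
    · filter_upwards [hb', IsRatMap.eventually_nsmul_ne hn 0] with X hX hX'
      rw [div_pow, h1 X hX']
      field_simp
    · filter_upwards [hb', (tendsto_add S).eventually hb', eventually_ne 0,
        (tendsto_add S).eventually (eventually_ne 0)] with X h3 h4 h5 h6
      have := h2 X h5 h6
      field_simp
      linear_combination this
  · rintro ⟨g, hg, hζ⟩
    have hne := hg.eventually_ne_zero hn
    obtain ⟨hr, f, hf0, hf, h⟩ := hg
    obtain ⟨a, b, hb, hab⟩ := hr.exists_div
    have hb' := eventually_value_ne_zero hb
    refine ⟨f, a, b, hf, ?_, hb, fun X hX ↦ ?_, fun X hX hXS ↦ ?_⟩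
    · rintro rfl
      obtain ⟨X, h1, h2, h3⟩ := (hne.and (hb'.and hab)).exists
      rw [value_zero] at h3
      exact mul_ne_zero h1 h2 h3
    · have hX0 : X ≠ 0 := by rintro rfl; simp at hX
      refine sub_eq_zero.mp (IsRegAt.eq_zero (((IsRegAt.value a hX0).pow n).sub
        (((IsRegAt.value b hX0).pow n).mul ((IsRegMapAt.nsmul hn hX0 hX).value f))) ?_)
      filter_upwards [hab, h] with X h1 h2
      rw [← h1, ← h2]; ring
    · have hτ := IsRegMapAt.addConst hX hXS
      refine sub_eq_zero.mp (IsRegAt.eq_zero (((hτ.value a).mul (.value b hX)).sub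
        ((IsRegAt.const ζ hX).mul ((IsRegAt.value a hX).mul (hτ.value b)))) ?_)
      filter_upwards [hab, (tendsto_add S).eventually hab, hζ] with X h1 h2 h3
      rw [← h1, ← h2, h3]; ring

lemma weilPairing_spec (hn : Odd n) (hS : n • S = 0) (hT : n • T = 0) :
    IsWeilPairingValue n S T (weilPairing n S T) := by
  obtain ⟨g, hg⟩ := exists_isTorsionRoot hn hT
  obtain ⟨ζ, -, hζ⟩ := hg.exists_translate hn.pos.ne' hS
  exact Classical.epsilon_spec (p := IsWeilPairingValue n S T)
    ⟨ζ, (isWeilPairingValue_iff hn.pos.ne').mpr ⟨g, hg, hζ⟩⟩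

namespace IsTorsionRoot

variable {g : W.Point → F}

/-- The translation factors of any root of `f ∘ [n]` are the values of the Weil pairing. -/
lemma map_add (hn : Odd n) (hg : IsTorsionRoot n T g) (hS : n • S = 0) (hT : n • T = 0) :
    ∀ᶠ X in cofinite, g (X + S) = weilPairing n S T * g X := by
  have hn0 := hn.pos.ne'
  obtain ⟨g', hg', h⟩ := (isWeilPairingValue_iff hn0).mp (weilPairing_spec hn hS hT)
  obtain ⟨c, hc, h1⟩ := hg.exists_eq_const_mul hn0 hg'
  filter_upwards [h, h1, (tendsto_add S).eventually h1] with X h2 h3 h4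
  rw [h3, h4] at h2
  exact mul_left_cancel₀ hc (by linear_combination h2)

lemma weilPairing_eq (hn : Odd n) (hg : IsTorsionRoot n T g) (hS : n • S = 0) (hT : n • T = 0)
    {ζ : F} (h : ∀ᶠ X in cofinite, g (X + S) = ζ * g X) : weilPairing n S T = ζ := by
  obtain ⟨X, h1, h2, h3⟩ := (h.and ((hg.map_add hn hS hT).and
    (hg.eventually_ne_zero hn.pos.ne'))).exists
  exact mul_right_cancel₀ h3 (h2.symm.trans h1)

end IsTorsionRoot

lemma weilPairing_eq_of_value (hn : Odd n) (hS : n • S = 0) (hT : n • T = 0) {ζ : F}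
    (h : IsWeilPairingValue n S T ζ) : weilPairing n S T = ζ := by
  obtain ⟨g, hg, h⟩ := (isWeilPairingValue_iff hn.pos.ne').mp h
  exact hg.weilPairing_eq hn hS hT h

lemma weilPairing_pow (hn : Odd n) (hS : n • S = 0) (hT : n • T = 0) :
    weilPairing n S T ^ n = 1 := by
  obtain ⟨g, hg⟩ := exists_isTorsionRoot hn hT
  obtain ⟨ζ, h1, h2⟩ := hg.exists_translate hn.pos.ne' hS
  rw [hg.weilPairing_eq hn hS hT h2, h1]

lemma weilPairing_add_left (hn : Odd n) {S' : W.Point} (hS : n • S = 0) (hS' : n • S' = 0)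
    (hT : n • T = 0) :
    weilPairing n (S + S') T = weilPairing n S T * weilPairing n S' T := by
  obtain ⟨g, hg⟩ := exists_isTorsionRoot hn hT
  refine hg.weilPairing_eq hn (by rw [nsmul_add, hS, hS', add_zero]) hT ?_
  filter_upwards [hg.map_add hn hS' hT, (tendsto_add S').eventually (hg.map_add hn hS hT)]
    with X h1 h2
  rw [show X + (S + S') = X + S' + S by abel, h2, h1]
  ring

/-- Multiplying a torsion root by the pullback of a function under `[n]`. -/
lemma IsTorsionRoot.mul_add (hn : n ≠ 0) {T' : W.Point} {g g' : W.Point → F}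
    (hg : IsTorsionRoot n T g) (hg' : IsTorsionRoot n T' g') :
    ∃ h : W.Point → F, IsRat h ∧
      IsTorsionRoot n (T + T') fun X ↦ g X * g' X * h (n • X) := by
  obtain ⟨α, β, hα, hβ, hαβ⟩ := exists_span_mul_pointIdeal T T'
  obtain ⟨hr, f, hf0, hf, h⟩ := hg
  obtain ⟨hr', f', hf0', hf', h'⟩ := hg'
  have hI : Ideal.span {α ^ n} * pointIdeal (T + T') ^ n = Ideal.span {β ^ n * (f * f')} := by
    rw [← Ideal.span_singleton_pow, ← mul_pow, hαβ, mul_pow, mul_pow, ← hf, ← hf',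
      Ideal.span_singleton_pow, Ideal.span_singleton_mul_span_singleton,
      Ideal.span_singleton_mul_span_singleton]
  -- F' = f f' (β/α)^n is the function attached to T + T'.
  obtain ⟨F', -, hF'⟩ : ∃ z ∈ pointIdeal (T + T') ^ n, α ^ n * z = β ^ n * (f * f') := by
    rw [← Ideal.mem_span_singleton_mul, hI]
    exact Ideal.mem_span_singleton_self _
  have hα' : α ^ n ≠ 0 := pow_ne_zero n hα
  have hF0 : F' ≠ 0 := by
    rintro rfl
    rw [mul_zero] at hF'
    exact mul_ne_zero (pow_ne_zero n hβ) (mul_ne_zero hf0 hf0') hF'.symm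
  refine ⟨fun X ↦ value β X / value α X, (IsRat.value β).div (.value α), (hr.mul hr').mul
    ((IsRatMap.nsmul hn).comp ((IsRat.value β).div (.value α))), F', hF0, ?_, ?_⟩
  · rw [← hF', ← Ideal.span_singleton_mul_span_singleton] at hI
    exact ((Ideal.span_singleton_mul_right_inj hα').mp hI).symm
  · filter_upwards [h, h', (IsRatMap.nsmul hn).eventually_value_ne_zero hα,
      IsRatMap.eventually_nsmul_ne hn 0] with X h1 h2 h3 h4
    have := congrArg (fun z ↦ value z (n • X)) hF'
    simp only [value_mul, value_pow h4] at this
    rw [mul_pow, mul_pow, h1, h2, div_pow]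
    field_simp
    linear_combination -this

/-- A root for T + T' is the product of roots for T and T' and a function of nX. The latter is
unchanged by translation by S, so the translation factors multiply. -/
lemma weilPairing_add_right (hn : Odd n) {T' : W.Point} (hS : n • S = 0) (hT : n • T = 0)
    (hT' : n • T' = 0) :
    weilPairing n S (T + T') = weilPairing n S T * weilPairing n S T' := by
  obtain ⟨g, hg⟩ := exists_isTorsionRoot hn hT
  obtain ⟨g', hg'⟩ := exists_isTorsionRoot hn hT'
  obtain ⟨h, -, hh⟩ := hg.mul_add hn.pos.ne' hg'
  refine hh.weilPairing_eq hn hS (by rw [nsmul_add, hT, hT', add_zero]) ?_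
  filter_upwards [hg.map_add hn hS hT, hg'.map_add hn hS hT'] with X h1 h2
  rw [h1, h2, nsmul_add, hS, add_zero]
  ring

end Existence

end EllipticCongruence

end



noncomputable section

namespace EllipticCongruence

open WeierstrassCurve WeierstrassCurve.Affine Polynomial Filter
open scoped Polynomial.Bivariate nonZeroDivisors

/-! ### The Weil pairing is alternating -/

section Alternating

variable {F : Type*} [Field F] [DecidableEq F] [IsAlgClosed F] {W : WeierstrassCurve.Affine F}
  [W.IsElliptic]

instance : IsNoetherianRing W.CoordinateRing :=
  inferInstanceAs (IsNoetherianRing (F[X][Y] ⧸ _))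

/-- Hilbert's Nullstellensatz for the affine coordinate ring. -/
lemma exists_le_pointIdeal {I : Ideal W.CoordinateRing} (hI : I ≠ ⊤) :
    ∃ X : W.Point, X ≠ 0 ∧ I ≤ pointIdeal X := by
  obtain ⟨M, hM, hIM⟩ := Ideal.exists_le_maximal I hI
  let _ : Field (W.CoordinateRing ⧸ M) := Ideal.Quotient.field M
  have : Algebra.FiniteType F W.CoordinateRing := by
    have : Module.Finite F[X] W.CoordinateRing := .of_basis (CoordinateRing.basis W)
    exact .trans (S := F[X]) inferInstance inferInstance
  have : Algebra.FiniteType F (W.CoordinateRing ⧸ M) :=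
    .of_surjective (Ideal.Quotient.mkₐ F M) (Ideal.Quotient.mkₐ_surjective F M)
  have : Module.Finite F (W.CoordinateRing ⧸ M) := finite_of_finite_type_of_isJacobsonRing _ _
  have hs := (IsAlgClosed.algebraMap_bijective_of_isIntegral (k := F)
    (K := W.CoordinateRing ⧸ M)).2
  obtain ⟨x, hx⟩ := hs (Ideal.Quotient.mk M (CoordinateRing.mk W (C X)))
  obtain ⟨y, hy⟩ := hs (Ideal.Quotient.mk M (CoordinateRing.mk W Y))
  let ψ := Ideal.Quotient.mkₐ F M
  have hψ : ∀ q : F[X][Y], ψ (CoordinateRing.mk W q) =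
      algebraMap F (W.CoordinateRing ⧸ M) (q.evalEval x y) := by
    intro q
    have h1 : (ψ : W.CoordinateRing →+* _).comp (CoordinateRing.mk W) =
        (algebraMap F (W.CoordinateRing ⧸ M)).comp (evalEvalRingHom x y) := by
      ext c
      · change ψ (CoordinateRing.mk W (C (C c))) = algebraMap F _ (evalEval x y (C (C c)))
        rw [evalEval_C, eval_C, ← const_eq_mk]
        exact ψ.commutes c
      · change ψ (CoordinateRing.mk W (C X)) = algebraMap F _ (evalEval x y (C X))
        rw [evalEval_C, eval_X, hx]; rfl
      · change ψ (CoordinateRing.mk W Y) = algebraMap F _ (evalEval x y Y)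
        rw [evalEval_X, hy]; rfl
    exact RingHom.congr_fun h1 q
  have heq : W.Equation x y := by
    have h1 := hψ W.polynomial
    rw [show CoordinateRing.mk W W.polynomial = 0 from AdjoinRoot.mk_self, map_zero] at h1
    exact (map_eq_zero _).mp h1.symm
  have hns : W.Nonsingular x y := (equation_iff_nonsingular).mp heq
  refine ⟨.some x y hns, Point.some_ne_zero _, hIM.trans fun f hf ↦ ?_⟩
  rw [mem_pointIdeal (Point.some_ne_zero _)]
  obtain ⟨q, rfl⟩ := AdjoinRoot.mk_surjective f
  change AdjoinRoot.evalEval hns.1 (CoordinateRing.mk W q) = 0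
  have h2 : ψ (CoordinateRing.mk W q) = 0 := Ideal.Quotient.eq_zero_iff_mem.mpr hf
  rw [hψ, map_eq_zero] at h2
  exact (AdjoinRoot.evalEval_mk hns.1 q).trans h2

/-- A rational function which is regular at every affine point is a polynomial function. -/
lemma exists_value_eq_of_isRegAt {h : W.Point → F}
    (hreg : ∀ X₀ : W.Point, X₀ ≠ 0 → ∃ h', IsRegAt h' X₀ ∧ h' =ᶠ[cofinite] h) :
    ∃ f : W.CoordinateRing, ∀ᶠ X in cofinite, value f X = h X := by
  -- The denominators of h form an ideal. Regularity at each affine point keeps it out of every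
  -- point ideal, so it contains 1.
  let D : Ideal W.CoordinateRing :=
    { carrier := {v | ∃ u : W.CoordinateRing, ∀ᶠ X in cofinite, h X * value v X = value u X}
      zero_mem' := ⟨0, by simp⟩
      add_mem' := by
        rintro v v' ⟨u, hu⟩ ⟨u', hu'⟩
        refine ⟨u + u', ?_⟩
        filter_upwards [hu, hu'] with X h1 h2
        rw [value_add, value_add, mul_add, h1, h2]
      smul_mem' := by
        rintro a v ⟨u, hu⟩
        refine ⟨a * u, ?_⟩
        filter_upwards [hu] with X h1
        rw [smul_eq_mul, value_mul, value_mul, ← h1]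
        ring }
  have hD : D = ⊤ := by
    by_contra hne
    obtain ⟨X₀, hX₀, hle⟩ := exists_le_pointIdeal hne
    obtain ⟨h', ⟨u, v, hv, -, huv⟩, he⟩ := hreg X₀ hX₀
    have hvD : v ∈ D := ⟨u, by filter_upwards [huv, he] with X h1 h2; rw [← h2, h1]⟩
    exact hv ((mem_pointIdeal hX₀ v).mp (hle hvD))
  obtain ⟨u, hu⟩ : (1 : W.CoordinateRing) ∈ D := hD ▸ Submodule.mem_top
  refine ⟨u, ?_⟩
  filter_upwards [hu, eventually_ne 0] with X h1 h2
  rw [← h1, value_one h2, mul_one]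

/-- A rational function without zeros and poles at the affine points is constant. -/
lemma exists_eq_const_of_isRegAt {h : W.Point → F}
    (hreg : ∀ X₀ : W.Point, X₀ ≠ 0 → ∃ h', IsRegAt h' X₀ ∧ h' X₀ ≠ 0 ∧ h' =ᶠ[cofinite] h) :
    ∃ c : F, c ≠ 0 ∧ ∀ᶠ X in cofinite, h X = c := by
  obtain ⟨f, hf⟩ := exists_value_eq_of_isRegAt fun X₀ hX₀ ↦
    let ⟨h', h1, _, h3⟩ := hreg X₀ hX₀
    ⟨h', h1, h3⟩
  obtain ⟨k, hk⟩ := exists_value_eq_of_isRegAt (h := fun X ↦ (h X)⁻¹) fun X₀ hX₀ ↦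
    let ⟨h', h1, h2, h3⟩ := hreg X₀ hX₀
    ⟨fun X ↦ (h' X)⁻¹, h1.inv h2, h3.mono fun X hX ↦ by simp only [hX]⟩
  have hne : ∀ᶠ X in cofinite, h X ≠ 0 := by
    obtain ⟨X₀, hX₀⟩ := (eventually_ne (0 : W.Point)).exists
    obtain ⟨h', h1, h2, h3⟩ := hreg X₀ hX₀
    have hf0 : f ≠ 0 := by
      rintro rfl
      refine h2 (h1.eq_zero ?_)
      filter_upwards [h3, hf] with X h3 h4
      rw [h3, ← h4, value_zero]
    filter_upwards [hf, eventually_value_ne_zero hf0] with X h3 h4 using h3 ▸ h4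
  have hfk : f * k - 1 = 0 := by
    refine eq_zero_of_value ?_
    filter_upwards [hf, hk, hne, eventually_ne 0] with X h1 h2 h3 h4
    rw [value_sub, value_mul, h1, h2, value_one h4, mul_inv_cancel₀ h3, sub_self]
  obtain ⟨c, hc, rfl⟩ := exists_const_of_isUnit (IsUnit.of_mul_eq_one _ (sub_eq_zero.mp hfk))
  refine ⟨c, hc, ?_⟩
  filter_upwards [hf, eventually_ne 0] with X h1 h2
  rw [← h1, value_const h2]

variable {n : ℕ} {S T : W.Point} {f : W.CoordinateRing}

lemma yCoord_ne_yCoord_neg (hT : T ≠ 0) (hne : -T ≠ T) : yCoord T - yCoord (-T) ≠ 0 := fun h ↦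
  hne (ext_coord (neg_point_ne_zero hT) hT (xCoord_neg T) (sub_eq_zero.mp h).symm)

/-- `f (X) f (T - X)` is constant, for a function `f` with divisor `n (T) - n (O)`. -/
lemma exists_value_mul_value_sub (hn : Odd n) (hT : T ≠ 0) (hnT : n • T = 0)
    (hf : Ideal.span {f} = pointIdeal T ^ n) : ∃ c : F, c ≠ 0 ∧
      ∀ X : W.Point, X ≠ 0 → xCoord X ≠ xCoord T → value f X * value f (T - X) = c := by
  obtain ⟨c, hc, h⟩ := exists_value_line hn hT hnT hf
  have hT' := neg_point_ne_zero hT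
  have hne := neg_ne_self_of_odd hn hT hnT
  have hv : value f (-T) ≠ 0 := fun h ↦ hne ((value_eq_zero_iff hn.pos.ne' hT hf hT').mp h)
  refine ⟨c * (yCoord T - yCoord (-T)) ^ n / value f (-T), ?_, fun X hX hx ↦ ?_⟩
  · exact div_ne_zero (mul_ne_zero hc (pow_ne_zero n (yCoord_ne_yCoord_neg hT hne))) hv
  -- The line through X and −T meets the curve again at T − X. Its vertical distance from T is y(T)
  -- − y(−T), whatever X is.
  · have h1 := h X (-T) hX hT' (by rwa [xCoord_neg])
    have hx' := sub_ne_zero.mpr hx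
    rw [eval_lineThrough, xCoord_neg, show -(X + -T) = T - X by abel] at h1
    rw [eq_div_iff hv, show yCoord T - yCoord (-T) = yCoord T - (yCoord X +
      (yCoord X - yCoord (-T)) / (xCoord X - xCoord T) * (xCoord T - xCoord X)) by
        field_simp; ring, ← h1]
    ring

/-- The function `X ↦ f (X) f (X - T)` is regular and does not vanish at `T`. -/
lemma exists_isRegAt_value_mul_value_sub (hn : Odd n) (hT : T ≠ 0) (hnT : n • T = 0)
    (hf : Ideal.span {f} = pointIdeal T ^ n) : ∃ h' : W.Point → F, IsRegAt h' T ∧ h' T ≠ 0 ∧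
      ∀ᶠ X in cofinite, h' X = value f X * value f (X - T) := by
  obtain ⟨c, hc, h1⟩ := exists_value_mul_value_neg hn hT hnT hf
  obtain ⟨c₀, hc₀, h2⟩ := exists_value_mul_value_sub hn hT hnT hf
  have hf0 := ne_zero_of_span hn.pos.ne' hT hf
  have hT' := neg_point_ne_zero hT
  have hne := neg_ne_self_of_odd hn hT hnT
  have hv : value f (-T) ≠ 0 := fun h ↦ hne ((value_eq_zero_iff hn.pos.ne' hT hf hT').mp h)
  have hy := (IsRegAt.yCoord hT).sub (.const (yCoord (-T)) hT)
  have hx := (IsRegAt.xCoord hT).sub (.const (xCoord T) hT)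
  -- This function is (x − x(T))² (x(X − T) − x(T)): the double zero at T cancels the double pole,
  -- and the value at T is (y(T) − y(−T))². Eliminating f(X), f(T − X) and f(X − T) by the two
  -- product formulas shows that f(X) f(X − T) is its n-th power times c³/c₀, divided by f(−X)².
  have hG := ((hy.pow 2).add ((IsRegAt.const W.a₁ hT).mul (hy.mul hx))).sub
    (((IsRegAt.xCoord hT).add (.const (W.a₂ + 2 * xCoord T) hT)).mul (hx.pow 2))
  have hneg : IsRegMapAt (fun X : W.Point ↦ -X) T := by
    refine ⟨.neg, hT', by simpa using IsRegAt.xCoord hT, ?_⟩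
    refine (((IsRegAt.yCoord hT).neg.sub ((IsRegAt.const W.a₁ hT).mul (.xCoord hT))).sub
      (.const W.a₃ hT)).congr ?_ (yCoord_neg hT)
    filter_upwards [eventually_ne 0] with X hX using yCoord_neg hX
  refine ⟨_, ((IsRegAt.const (c ^ 3 / c₀) hT).mul (hG.pow n)).div ((hneg.value f).pow 2)
    (pow_ne_zero 2 hv), ?_, ?_⟩
  · simp only [sub_self, mul_zero, add_zero, ne_eq, OfNat.ofNat_ne_zero, not_false_eq_true,
      zero_pow, sub_zero]
    exact div_ne_zero (mul_ne_zero (div_ne_zero (pow_ne_zero 3 hc) hc₀)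
      (pow_ne_zero n (pow_ne_zero 2 (yCoord_ne_yCoord_neg hT hne)))) (pow_ne_zero 2 hv)
  · have hxT : ∀ᶠ X in cofinite, xCoord X ≠ xCoord T := eventually_xCoord_ne (eventually_ne 0)
      (.of_forall fun _ ↦ hT) (eventually_ne T) (eventually_ne (-T))
    filter_upwards [eventually_ne 0, hxT, IsRatMap.neg.eventually_value_ne_zero hf0] with X hX hx hvX
    have hx' := sub_ne_zero.mpr hx
    have hxs : xCoord X ≠ xCoord (-T) := by rwa [xCoord_neg]
    have e1 := h1 X hX
    have e2 := h2 X hX hx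
    have e3 := h1 (X + -T) (add_ne_zero hxs)
    rw [show -(X + -T) = T - X by abel, xCoord_add hX hT' hxs, xCoord_neg, ← sub_eq_add_neg] at e3
    set l := (yCoord X - yCoord (-T)) / (xCoord X - xCoord T)
    have hl : yCoord X - yCoord (-T) = l * (xCoord X - xCoord T) := by
      rw [div_mul_cancel₀ _ hx']
    rw [hl]
    have e4 : (l * (xCoord X - xCoord T)) ^ 2 +
        W.a₁ * (l * (xCoord X - xCoord T) * (xCoord X - xCoord T)) -
        (xCoord X + (W.a₂ + 2 * xCoord T)) * (xCoord X - xCoord T) ^ 2 =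
        (xCoord X - xCoord T) ^ 2 *
          (l ^ 2 + W.a₁ * l - W.a₂ - xCoord X - xCoord T - xCoord T) := by ring
    rw [e4, mul_pow, ← pow_mul, mul_comm 2 n, pow_mul]
    rw [div_mul_eq_mul_div, div_div, div_eq_iff (mul_ne_zero hc₀ (pow_ne_zero 2 hvX))]
    set p := (xCoord X - xCoord T) ^ n
    set r := (l ^ 2 + W.a₁ * l - W.a₂ - xCoord X - xCoord T - xCoord T) ^ n
    rw [← e2]
    linear_combination -c ^ 2 * p ^ 2 * e3 -
      (value f (X - T) * value f (T - X)) * (c * p + value f X * value f (-X)) * e1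

/-- The translate f(X + iT) has its zero at T − iT and its pole at −iT, so the divisors telescope to
0. At points outside the multiples of T no factor has a zero or a pole. At T the factors i = 0 and i
= n − 1 compensate each other, and invariance under translation by T transports this to the other
affine multiples of T. -/
lemma exists_prod_value_eq_const (hn : n.Prime) (hn2 : n ≠ 2) (hT : T ≠ 0) (hnT : n • T = 0)
    (hf : Ideal.span {f} = pointIdeal T ^ n) : ∃ c : F, c ≠ 0 ∧
      ∀ᶠ X in cofinite, ∏ i ∈ Finset.range n, value f (X + i • T) = c := by
  have hodd := hn.odd_of_ne_two hn2
  have hf0 := ne_zero_of_span hn.ne_zero hT hf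
  have := Fact.mk hn
  have hord : addOrderOf T = n := addOrderOf_eq_prime hnT hT
  have hz : ∀ i : ℕ, i • T = 0 ↔ n ∣ i := fun i ↦ by rw [← hord, addOrderOf_dvd_iff_nsmul_eq_zero]
  -- the value at a point where no factor has a zero or a pole
  have key : ∀ X₀ : W.Point, X₀ ≠ 0 → ∀ s : Finset ℕ,
      (∀ i ∈ s, X₀ + i • T ≠ 0 ∧ X₀ + i • T ≠ T) →
      IsRegAt (fun X ↦ ∏ i ∈ s, value f (X + i • T)) X₀ ∧ ∏ i ∈ s, value f (X₀ + i • T) ≠ 0 := by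
    intro X₀ hX₀ s hs
    refine ⟨IsRegAt.prod s hX₀ fun i hi ↦ (IsRegMapAt.addConst hX₀ (hs i hi).1).value f, ?_⟩
    rw [Finset.prod_ne_zero_iff]
    exact fun i hi h ↦ (hs i hi).2 ((value_eq_zero_iff hn.ne_zero hT hf (hs i hi).1).mp h)
  -- the point `T`
  obtain ⟨h₁, hr₁, hne₁, he₁⟩ := exists_isRegAt_value_mul_value_sub hodd hT hnT hf
  have hgt := hn.two_le
  have keyT : ∃ h', IsRegAt h' T ∧ h' T ≠ 0 ∧
      h' =ᶠ[cofinite] fun X ↦ ∏ i ∈ Finset.range n, value f (X + i • T) := by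
    obtain ⟨hr, hne⟩ := key T hT (Finset.Ico 1 (n - 1)) fun i hi ↦ by
      rw [Finset.mem_Ico] at hi
      refine ⟨fun h ↦ ?_, fun h ↦ ?_⟩
      · have : (i + 1) • T = 0 := by rw [add_nsmul, one_nsmul, add_comm, h]
        exact absurd (Nat.le_of_dvd (by omega) ((hz _).mp this)) (by omega)
      · rw [add_eq_left, hz] at h
        exact absurd (Nat.le_of_dvd (by omega) h) (by omega)
    refine ⟨_, hr₁.mul hr, mul_ne_zero hne₁ hne, ?_⟩
    filter_upwards [he₁] with X hX
    have e1 : (n - 1) • T = -T := by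
      rw [← add_eq_zero_iff_eq_neg, ← succ_nsmul, Nat.sub_add_cancel (by omega), hnT]
    have e2 : n = (n - 1) + 1 := by omega
    conv_rhs => rw [e2, Finset.prod_range_succ, Finset.range_eq_Ico,
      Finset.prod_eq_prod_Ico_succ_bot (by omega), e1]
    rw [hX, zero_nsmul, add_zero, sub_eq_add_neg]
    ring
  obtain ⟨h', hr', hne', he'⟩ := keyT
  -- invariance under translation by `T`
  have htranslate : ∀ X : W.Point, ∏ i ∈ Finset.range n, value f (X + T + i • T) =
      ∏ i ∈ Finset.range n, value f (X + i • T) := by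
    intro X
    have e1 : ∀ i : ℕ, X + T + i • T = X + (i + 1) • T := fun i ↦ by
      rw [add_nsmul, one_nsmul]; abel
    simp only [e1]
    rw [← Nat.sub_add_cancel hn.one_le, Finset.prod_range_succ, Finset.prod_range_succ',
      Nat.sub_add_cancel hn.one_le, hnT, zero_nsmul]
  have hinv : ∀ (j : ℕ) (X : W.Point), ∏ i ∈ Finset.range n, value f (X + j • T + i • T) =
      ∏ i ∈ Finset.range n, value f (X + i • T) := by
    intro j X
    induction j with
    | zero => simp
    | succ j ih => rw [← ih, ← htranslate (X + j • T), succ_nsmul]; simp only [add_assoc]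
  refine exists_eq_const_of_isRegAt fun X₀ hX₀ ↦ ?_
  by_cases hX : ∃ j : ℕ, X₀ + j • T = T
  · obtain ⟨j, hj⟩ := hX
    have hτ : IsRegMapAt (fun X ↦ X + j • T) X₀ := .addConst hX₀ (by rwa [hj])
    refine ⟨fun X ↦ h' (X + j • T), hτ.comp (by rwa [hj]), by simpa only [hj] using hne', ?_⟩
    filter_upwards [(tendsto_add (j • T)).eventually he'] with X hX
    rw [hX, hinv]
  · push Not at hX
    obtain ⟨hr, hne⟩ := key X₀ hX₀ (Finset.range n) fun i _ ↦
      ⟨fun h ↦ hX (i + 1) (by rw [succ_nsmul, ← add_assoc, h, zero_add]), hX i⟩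
    exact ⟨_, hr, hne, .rfl⟩

theorem weilPairing_self (hn : n.Prime) (hn2 : n ≠ 2) (hnT : n • T = 0) :
    weilPairing n T T = 1 := by
  have hodd := hn.odd_of_ne_two hn2
  obtain ⟨g, hg⟩ := exists_isTorsionRoot hodd hnT
  by_cases hT : T = 0
  · refine hg.weilPairing_eq hodd hnT hnT (.of_forall fun X ↦ ?_)
    rw [hT, add_zero, one_mul]
  refine hg.weilPairing_eq hodd hnT hnT ?_
  have hne := hg.eventually_ne_zero hn.ne_zero
  obtain ⟨hr, f, hf0, hf, h⟩ := id hg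
  -- With nT' = T, the product of g(X + iT') over i < n has n-th power ∏ f(nX + iT), a constant, so
  -- it is constant itself. Replacing X by X + T' exchanges the factor g(X) for g(X + T); hence they
  -- agree.
  obtain ⟨T', hT'⟩ := nsmul_surjective (W := W) hn.ne_zero T
  simp only at hT'
  obtain ⟨c, hc, hF⟩ := exists_prod_value_eq_const hn hn2 hT hnT hf
  have hτ : ∀ i : ℕ, IsRatMap fun X : W.Point ↦ X + i • T' := fun i ↦ .addConst _
  obtain ⟨c', hc', hH⟩ := (IsRat.prod (Finset.range n) (g := fun i X ↦ g (X + i • T'))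
    fun i _ ↦ (hτ i).comp hr).eq_const_of_pow hn.ne_zero (c := c) (by
      filter_upwards [(tendsto_nsmul hn.ne_zero).eventually hF,
        (Finset.eventually_all (Finset.range n)).mpr fun i _ ↦ (hτ i).tendsto.eventually h]
        with X h1 h2
      rw [← Finset.prod_pow, ← h1]
      refine Finset.prod_congr rfl fun i hi ↦ ?_
      rw [h2 i hi, nsmul_add, smul_comm, hT'])
  have hc0 : c' ≠ 0 := by
    rintro rfl
    rw [zero_pow hn.ne_zero] at hc'
    exact hc hc'.symm
  filter_upwards [hH, (tendsto_add T').eventually hH, hne,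
    (Finset.eventually_all (Finset.range n)).mpr fun i _ ↦ (hτ i).tendsto.eventually hne]
    with X h1 h2 h3 h4
  have e1 : ∀ i : ℕ, X + T' + i • T' = X + (i + 1) • T' := fun i ↦ by
    rw [add_nsmul, one_nsmul]; abel
  simp only [e1] at h2
  rw [← h1, ← Nat.sub_add_cancel hn.one_le, Finset.prod_range_succ, Finset.prod_range_succ',
    Nat.sub_add_cancel hn.one_le, hT', zero_nsmul, add_zero] at h2
  rw [one_mul]
  refine mul_left_cancel₀ (Finset.prod_ne_zero_iff.mpr fun i hi ↦ h4 (i + 1) ?_) h2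
  rw [Finset.mem_range] at hi ⊢
  omega

end Alternating

end EllipticCongruence

end



noncomputable section

namespace EllipticCongruence

open WeierstrassCurve WeierstrassCurve.Affine Polynomial Filter
open scoped Polynomial.Bivariate nonZeroDivisors IntermediateField

/-! ### The Weil pairing is not trivial -/

section Pullback

variable {F : Type*} [Field F] [DecidableEq F] [IsAlgClosed F] {W : WeierstrassCurve.Affine F}
  [W.IsElliptic] {m m' : W.Point → W.Point}

lemma exists_ratGerm_eq_coe (q : W.FunctionField) : ∃ h : W.Point → F, ratGerm W q = ↑h := by
  induction hq : ratGerm W q using Germ.inductionOn with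
  | h f => exact ⟨f, rfl⟩

lemma exists_pullback (hm : IsRatMap m) (q : W.FunctionField) :
    ∃ q' : W.FunctionField, ratGerm W q' = (ratGerm W q).compTendsto m hm.tendsto := by
  obtain ⟨h, hh⟩ := exists_ratGerm_eq_coe q
  obtain ⟨q', hq'⟩ := hm.comp ⟨q, hh⟩
  exact ⟨q', by rw [hq', hh]; rfl⟩

/-- The endomorphism `h ↦ h ∘ m` of the function field. -/
def pullback (hm : IsRatMap m) : W.FunctionField →+* W.FunctionField where
  toFun q := (exists_pullback hm q).choose
  map_one' := ratGerm_injective <| by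
    rw [(exists_pullback hm 1).choose_spec, map_one]; rfl
  map_zero' := ratGerm_injective <| by
    rw [(exists_pullback hm 0).choose_spec, map_zero]; rfl
  map_mul' q q' := ratGerm_injective <| by
    rw [(exists_pullback hm _).choose_spec, map_mul, map_mul, (exists_pullback hm _).choose_spec,
      (exists_pullback hm _).choose_spec]
    obtain ⟨h, hh⟩ := exists_ratGerm_eq_coe q
    obtain ⟨h', hh'⟩ := exists_ratGerm_eq_coe q'
    rw [hh, hh']; rfl
  map_add' q q' := ratGerm_injective <| by
    rw [(exists_pullback hm _).choose_spec, map_add, map_add, (exists_pullback hm _).choose_spec,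
      (exists_pullback hm _).choose_spec]
    obtain ⟨h, hh⟩ := exists_ratGerm_eq_coe q
    obtain ⟨h', hh'⟩ := exists_ratGerm_eq_coe q'
    rw [hh, hh']; rfl

lemma ratGerm_pullback (hm : IsRatMap m) {q : W.FunctionField} {h : W.Point → F}
    (hq : ratGerm W q = ↑h) : ratGerm W (pullback hm q) = ↑(fun X ↦ h (m X)) := by
  exact (exists_pullback hm q).choose_spec.trans (by rw [hq]; rfl)

lemma ratGerm_polynomial (a : F[X]) :
    ratGerm W (algebraMap _ _ (CoordinateRing.mk W (C a))) =
      Germ.ofFun (fun P ↦ a.eval (xCoord P)) := by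
  rw [ratGerm_algebraMap]
  exact Germ.coe_eq.mpr ((eventually_ne 0).mono fun P hP ↦ by rw [value_mk_C hP])

/-- A rational function invariant under `-1` is a rational function of `x`. -/
lemma exists_div_of_even [CharZero F] {h : W.Point → F} (hh : IsRat h)
    (he : ∀ᶠ X in cofinite, h (-X) = h X) : ∃ a b : F[X], b ≠ 0 ∧
      ∀ᶠ X in cofinite, h X * b.eval (xCoord X) = a.eval (xCoord X) := by
  obtain ⟨u, v, hv, huv⟩ := hh.exists_div
  obtain ⟨c, d, rfl⟩ := exists_ofPair v
  -- After multiplication by the conjugate of the denominator h has a denominator in x alone.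
  -- Evenness then kills the coefficient of y, since y(X) ≠ y(−X) away from the 2-torsion.
  obtain ⟨a, b, hab⟩ := exists_ofPair (u * conjPair W c d)
  have h1 : ∀ᶠ X in cofinite, h X * (pairNorm W c d).eval (xCoord X) = value (ofPair a b) X := by
    filter_upwards [huv, eventually_ne 0] with X h1 h2
    rw [eval_pairNorm h2, ← hab, value_mul, value_conjPair, ← h1]
    ring
  refine ⟨a, pairNorm W c d, pairNorm_ne_zero hv, ?_⟩
  have h2 : ∀ᶠ X : W.Point in cofinite, b.eval (xCoord X) = 0 := by
    filter_upwards [h1, tendsto_neg.eventually h1, he, eventually_ne 0,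
      IsRatMap.eventually_nsmul_ne (W := W) two_ne_zero 0] with X h1 h2 h3 h4 h5
    have h4' := neg_point_ne_zero h4
    rw [xCoord_neg, h3, h1, value_ofPair h4, value_ofPair h4', xCoord_neg] at h2
    have h6 : yCoord X - yCoord (-X) ≠ 0 := yCoord_ne_yCoord_neg h4 fun h ↦ h5 (by
      rw [two_nsmul]; nth_rw 1 [← h]; exact neg_add_cancel X)
    exact (mul_eq_zero.mp (by linear_combination h2 :
      b.eval (xCoord X) * (yCoord X - yCoord (-X)) = 0)).resolve_right h6
  filter_upwards [h1, h2, eventually_ne 0] with X h1 h2 h3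
  rw [h1, value_ofPair h3, h2]
  ring

/-- The field of functions of the form `h ∘ [n]`. -/
def nsmulField (W : WeierstrassCurve.Affine F) [W.IsElliptic] {n : ℕ} (hn : n ≠ 0) :
    Subfield W.FunctionField := (pullback (IsRatMap.nsmul (W := W) hn)).fieldRange

/-- The function `x`, in the function field. -/
def xFun (W : WeierstrassCurve.Affine F) : W.FunctionField :=
  algebraMap _ _ (CoordinateRing.mk W (C X))

lemma ratGerm_xFun : ratGerm W (xFun W) = ↑(xCoord (W := W)) := by
  rw [xFun, ratGerm_algebraMap]
  exact Germ.coe_eq.mpr ((eventually_ne 0).mono fun P hP ↦ by rw [value_mk_C hP, eval_X])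

variable {n : ℕ}

lemma mem_nsmulField (hn : n ≠ 0) {q : W.FunctionField} : q ∈ nsmulField W hn ↔
    ∃ h, IsRat h ∧ ratGerm W q = Germ.ofFun (fun X ↦ h (n • X)) := by
  constructor
  · rintro ⟨q', rfl⟩
    obtain ⟨h, hh⟩ := exists_ratGerm_eq_coe q'
    exact ⟨h, ⟨q', hh⟩, ratGerm_pullback _ hh⟩
  · rintro ⟨h, ⟨q', hq'⟩, hq⟩
    exact ⟨q', ratGerm_injective (by rw [ratGerm_pullback _ hq', hq])⟩

/-- `x` satisfies an equation of degree `n ^ 2` over the functions of `n X`. -/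
lemma exists_polynomial_x (hn : n ≠ 0) : ∃ f : (nsmulField W hn)[X], f ≠ 0 ∧
    f.natDegree ≤ n ^ 2 ∧ aeval (xFun W) f = 0 := by
  obtain ⟨u, v, h⟩ := exists_isMulPoly W n
  let j : F →+* nsmulField W hn :=
    { toFun c := ⟨algebraMap _ _ (CoordinateRing.mk W (C (C c))), (mem_nsmulField hn).mpr
        ⟨fun _ ↦ c, .const c, by simpa using ratGerm_polynomial (C c)⟩⟩
      map_one' := Subtype.ext (by simp)
      map_zero' := Subtype.ext (by simp)
      map_mul' a b := Subtype.ext (by simp)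
      map_add' a b := Subtype.ext (by simp) }
  have hj : ∀ a : F[X], aeval (xFun W) (a.map j) = algebraMap _ _ (CoordinateRing.mk W (C a)) := by
    intro a
    have : ((aeval (R := nsmulField W hn) (xFun W) : _ →+* _).comp (mapRingHom j)) =
        ((algebraMap W.CoordinateRing W.FunctionField).comp (CoordinateRing.mk W)).comp C := by
      ext c
      · simp only [RingHom.comp_apply, coe_mapRingHom, map_C, RingHom.coe_coe, aeval_C]
        rfl
      · simp [xFun]
    exact RingHom.congr_fun this a
  let t : nsmulField W hn := ⟨pullback (IsRatMap.nsmul hn) (xFun W), _, rfl⟩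
  have hv0 := h.right_ne_zero hn
  -- The equation u(x) = x(nX) v(x). Its coefficient in degree n² comes from u alone, so it is not
  -- trivial.
  refine ⟨u.map j - C t * v.map j, ?_, ?_, ?_⟩
  · intro h0
    have h1 := congrArg (coeff · (n ^ 2)) h0
    simp only [coeff_sub, coeff_C_mul, coeff_map, coeff_zero] at h1
    rw [coeff_eq_zero_of_degree_lt h.degree_right, map_zero, mul_zero, sub_zero, map_eq_zero,
      ← h.natDegree_left, coeff_natDegree, leadingCoeff_eq_zero] at h1
    exact h.left_ne_zero h1
  · refine (natDegree_sub_le_of_le (n := n ^ 2) (natDegree_map_le.trans h.natDegree_left.le)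
      (natDegree_C_mul_le _ _ |>.trans (natDegree_map_le.trans
        (natDegree_le_of_degree_le h.degree_right.le)))).trans (max_self _).le
  · rw [map_sub, map_mul, aeval_C, hj, hj, sub_eq_zero]
    apply ratGerm_injective
    rw [map_mul, ratGerm_polynomial, ratGerm_polynomial]
    change _ = ratGerm W (pullback (IsRatMap.nsmul hn) (xFun W)) * _
    rw [ratGerm_pullback _ ratGerm_xFun]
    refine Germ.coe_eq.mpr ?_
    filter_upwards [IsRatMap.eventually_nsmul_ne hn 0] with X hX using (h.xCoord_nsmul hX).symm

/-- Only y needs an argument. The function η = 2y + a₁x + a₃ is odd, so η(X)/η(nX) is even and hence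
rational in x, while η(nX) lies in the base field. -/
lemma adjoin_x_eq_top [CharZero F] (hn : n ≠ 0) : (nsmulField W hn)⟮xFun W⟯ = ⊤ := by
  set M := (nsmulField W hn)⟮xFun W⟯
  have hM : ∀ {h : W.Point → F}, IsRat h → ∀ {q}, ratGerm W q = Germ.ofFun (fun X ↦ h (n • X)) → q ∈ M :=
    fun hh q hq ↦ M.algebraMap_mem ⟨q, (mem_nsmulField hn).mpr ⟨_, hh, hq⟩⟩
  have hx : xFun W ∈ M := IntermediateField.mem_adjoin_simple_self _ _
  have hpol : ∀ a : F[X], algebraMap W.CoordinateRing W.FunctionField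
      (CoordinateRing.mk W (C a)) ∈ M := by
    intro a
    induction a using Polynomial.induction_on' with
    | add p q hp hq => simpa only [map_add] using M.add_mem hp hq
    | monomial k c =>
      rw [← C_mul_X_pow_eq_monomial]
      simp only [map_mul, map_pow]
      exact M.mul_mem (hM (.const c) (by simpa using ratGerm_polynomial (C c))) (M.pow_mem hx k)
  have hy : algebraMap W.CoordinateRing W.FunctionField (CoordinateRing.mk W Y) ∈ M := by
    let η : W.Point → F := fun X ↦ 2 * yCoord X + W.a₁ * xCoord X + W.a₃
    have hη : IsRat η := (((IsRat.const 2).mul .yCoord).add ((IsRat.const _).mul .xCoord)).add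
      (.const _)
    have hηneg : ∀ X : W.Point, X ≠ 0 → η (-X) = -η X := fun X hX ↦ by
      simp only [η, yCoord_neg hX, xCoord_neg]; ring
    have hη0 : ∀ᶠ X in cofinite, η X ≠ 0 := by
      filter_upwards [eventually_ne 0, IsRatMap.eventually_nsmul_ne (W := W) two_ne_zero 0]
        with X hX hX2 h
      refine yCoord_ne_yCoord_neg hX (fun h ↦ hX2 (by
        rw [two_nsmul]; nth_rw 1 [← h]; exact neg_add_cancel X)) ?_
      rw [yCoord_neg hX, ← h]
      simp only [η]; ring
    have hn' := IsRatMap.nsmul (W := W) hn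
    obtain ⟨a, b, hb, hab⟩ := exists_div_of_even (hη.div (hn'.comp hη)) (by
      filter_upwards [eventually_ne 0, IsRatMap.eventually_nsmul_ne hn 0] with X h1 h2
      rw [hηneg X h1, smul_neg, hηneg _ h2, neg_div_neg_eq])
    obtain ⟨q, hq⟩ := hn'.comp hη
    have h2 : algebraMap W.CoordinateRing W.FunctionField (CoordinateRing.mk W Y) =
        (algebraMap _ _ (CoordinateRing.mk W (C a)) / algebraMap _ _ (CoordinateRing.mk W (C b)) * q
          - algebraMap _ _ (CoordinateRing.mk W (C (C W.a₁ * X + C W.a₃)))) /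
          algebraMap _ _ (CoordinateRing.mk W (C (C 2))) := by
      have hb' : algebraMap W.CoordinateRing W.FunctionField (CoordinateRing.mk W (C b)) ≠ 0 := by
        intro h0
        have h1 := ratGerm_polynomial (W := W) b
        rw [h0, map_zero] at h1
        obtain ⟨X, h2, h3⟩ := ((Germ.coe_eq.mp h1).and (eventually_eval_xCoord_ne_zero hb)).exists
        exact h3 h2.symm
      have h2' : algebraMap W.CoordinateRing W.FunctionField (CoordinateRing.mk W (C (C 2))) ≠ 0 := by
        intro h0
        have h1 := ratGerm_polynomial (W := W) (C 2)
        rw [h0, map_zero] at h1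
        obtain ⟨X, h2⟩ := (Germ.coe_eq.mp h1).exists
        simp at h2
      rw [eq_div_iff h2', eq_sub_iff_add_eq, div_mul_eq_mul_div, eq_div_iff hb']
      apply ratGerm_injective
      rw [map_mul, map_mul, map_add, map_mul, ratGerm_polynomial, ratGerm_polynomial,
        ratGerm_polynomial, ratGerm_polynomial, hq, ratGerm_algebraMap]
      refine Germ.coe_eq.mpr ?_
      filter_upwards [hab, eventually_ne 0, hn'.tendsto.eventually hη0] with P h1 h2 h3
      simp only [value_mk_Y h2, eval_C]
      rw [← h1]
      field_simp
      simp only [eval_add, eval_mul, eval_C, eval_X, η]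
      ring
    rw [h2]
    exact M.div_mem (M.sub_mem (M.mul_mem (M.div_mem (hpol a) (hpol b)) (hM hη hq)) (hpol _)) (hpol _)
  rw [eq_top_iff]
  intro q _
  have hR : ∀ r : W.CoordinateRing, algebraMap W.CoordinateRing W.FunctionField r ∈ M := by
    intro r
    obtain ⟨a, b, rfl⟩ := exists_ofPair r
    rw [ofPair_eq, map_add, map_mul]
    exact M.add_mem (hpol a) (M.mul_mem (hpol b) hy)
  obtain ⟨a, b, hb, rfl⟩ := IsFractionRing.div_surjective (A := W.CoordinateRing) q
  exact M.div_mem (hR a) (hR b)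

/-- A rational function which is invariant under `n`-torsion translations is a function
of `n X`. -/
lemma exists_eq_comp_nsmul [CharZero F] (hn : n ≠ 0) {g : W.Point → F} (hg : IsRat g)
    (hinv : ∀ S : W.Point, n • S = 0 → ∀ᶠ X in cofinite, g (X + S) = g X) :
    ∃ h : W.Point → F, IsRat h ∧ ∀ᶠ X in cofinite, g X = h (n • X) := by
  obtain ⟨q, hq⟩ := hg
  obtain ⟨f₀, hf₀, hdeg, hroot⟩ := exists_polynomial_x (W := W) hn
  have hint : IsIntegral (nsmulField W hn) (xFun W) :=
    (isAlgebraic_iff_isIntegral).mp ⟨f₀, hf₀, hroot⟩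
  have hqM : q ∈ (nsmulField W hn)⟮xFun W⟯ := adjoin_x_eq_top (W := W) hn ▸ IntermediateField.mem_top
  let pb := IntermediateField.adjoin.powerBasis hint
  obtain ⟨f, hf, hfq⟩ := pb.exists_eq_aeval ⟨q, hqM⟩
  have hfq' : q = aeval (xFun W) f := by
    have := congrArg (algebraMap _ W.FunctionField) hfq
    rw [← aeval_algebraMap_apply] at this
    exact this
  have hfd : f.natDegree < n ^ 2 := hf.trans_le ((natDegree_le_of_dvd
    (minpoly.dvd _ _ hroot) hf₀).trans hdeg)
  let P : W.FunctionField[X] := f.map (algebraMap _ _) - C q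
  let τ : ∀ S : W.Point, W.FunctionField →+* W.FunctionField := fun S ↦ pullback (.addConst S)
  -- The function q is f(x), with f of degree less than n² over the functions of nX. Translations by
  -- n-torsion points fix q and the coefficients of f, so the n² distinct functions x(X + S) are all
  -- roots of f − q. Hence f is constant.
  have hP0 : P = 0 := by
    have : Fintype {S : W.Point | n • S = 0} := (finite_nsmul_eq_zero hn).fintype
    refine eq_zero_of_natDegree_lt_card_of_eval_eq_zero P
      (f := fun S : {S : W.Point | n • S = 0} ↦ τ S (xFun W)) ?_ ?_ ?_
    · rintro ⟨S, hS⟩ ⟨S', hS'⟩ h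
      have h1 := congrArg (ratGerm W) h
      simp only [τ] at h1
      rw [ratGerm_pullback _ ratGerm_xFun, ratGerm_pullback _ ratGerm_xFun] at h1
      obtain ⟨X, h2, h3, h4, h5⟩ := ((Germ.coe_eq.mp h1).and
        (((tendsto_add S).eventually (eventually_ne 0)).and
        (((tendsto_add S').eventually (eventually_ne 0)).and
        (IsRatMap.eventually_nsmul_ne (W := W) two_ne_zero (-S - S'))))).exists
      rcases (xCoord_eq_iff h3 h4).mp h2 with h6 | h6
      · exact Subtype.ext (add_left_cancel h6)
      · refine absurd ?_ h5
        rw [two_nsmul, show X + X = (X + S) + X - S by abel, h6]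
        abel
    · rintro ⟨S, hS⟩
      have hfix : ∀ m : nsmulField W hn, τ S m = m := by
        rintro ⟨_, q', rfl⟩
        obtain ⟨h, hh⟩ := exists_ratGerm_eq_coe q'
        apply ratGerm_injective
        simp only [τ]
        rw [ratGerm_pullback _ (ratGerm_pullback _ hh), ratGerm_pullback _ hh]
        simp only [nsmul_add, show n • S = 0 from hS, add_zero]
      have hτq : τ S q = q := by
        apply ratGerm_injective
        simp only [τ]
        rw [ratGerm_pullback _ hq, hq]
        exact Germ.coe_eq.mpr (hinv S hS)
      have h1 := congrArg (τ S) hfq'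
      rw [hτq, aeval_def, hom_eval₂, show (τ S).comp (algebraMap (nsmulField W hn) _) =
        algebraMap _ _ from RingHom.ext hfix] at h1
      simp only [P, eval_sub, eval_C, eval_map]
      rw [← h1, sub_self]
    · have h1 : Fintype.card {S : W.Point | n • S = 0} = n ^ 2 := by
        rw [← ncard_nsmul_eq_zero (W := W) hn, Set.ncard_eq_toFinset_card', Set.toFinset_card]
      rw [h1]
      refine lt_of_le_of_lt (natDegree_sub_le _ _) (max_lt (lt_of_le_of_lt natDegree_map_le hfd) ?_)
      rw [natDegree_C]
      positivity
  have h0 : q = (f.coeff 0 : nsmulField W hn) := by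
    have := congrArg (coeff · 0) hP0
    simp only [P, coeff_sub, coeff_map, coeff_C_zero, coeff_zero] at this
    exact (sub_eq_zero.mp this).symm
  obtain ⟨h, hh, hh'⟩ := (mem_nsmulField hn).mp (f.coeff 0).2
  rw [← h0, hq] at hh'
  exact ⟨h, hh, Germ.coe_eq.mp hh'⟩

end Pullback

/-! ### Non-triviality of the pairing, from the class group -/

section Nontrivial

variable {F : Type*} [Field F] [DecidableEq F] [IsAlgClosed F] {W : WeierstrassCurve.Affine F}
  [W.IsElliptic] {n : ℕ} {T : W.Point}

lemma mk_X_sub_C_ne_zero (x : F) : CoordinateRing.mk W (C (X - C x)) ≠ 0 := by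
  intro h0
  obtain ⟨P, h1, h2⟩ := ((eventually_ne (0 : W.Point)).and (eventually_eval_xCoord_ne_zero
    (W := W) (X_sub_C_ne_zero x))).exists
  rw [← value_mk_C h1, h0, value_zero] at h2
  exact h2 rfl

/-- The product of the ideals of P and −P is generated by x − x(P), so point ideals are invertible.
-/
lemma pointIdeal_mul_left_cancel {P : W.Point} (hP : P ≠ 0) {I J : Ideal W.CoordinateRing}
    (h : pointIdeal P * I = pointIdeal P * J) : I = J := by
  apply (Ideal.span_singleton_mul_right_inj (mk_X_sub_C_ne_zero (xCoord P))).mp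
  rw [← pointIdeal_neg_mul hP, mul_assoc, h, mul_assoc]

lemma pointIdeal_pow_mul_left_cancel {P : W.Point} (hP : P ≠ 0) (n : ℕ)
    {I J : Ideal W.CoordinateRing} (h : pointIdeal P ^ n * I = pointIdeal P ^ n * J) : I = J := by
  induction n with
  | zero => simpa using h
  | succ n ih =>
    rw [pow_succ', mul_assoc, mul_assoc] at h
    exact ih (pointIdeal_mul_left_cancel hP h)

lemma exists_eq_pointIdeal_mul {P : W.Point} (hP : P ≠ 0) {I : Ideal W.CoordinateRing}
    (hI : I ≤ pointIdeal P) : ∃ J, I = pointIdeal P * J := by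
  set x := CoordinateRing.mk W (C (X - C (xCoord P))) with hx
  have h1 : pointIdeal (-P) * pointIdeal P = Ideal.span {x} := pointIdeal_neg_mul hP
  have h2 : pointIdeal (-P) * I ≤ Ideal.span {x} := h1 ▸ Ideal.mul_mono_right hI
  have h3 : pointIdeal (-P) * I = Ideal.span {x} *
      Submodule.comap (LinearMap.mulLeft W.CoordinateRing x) (pointIdeal (-P) * I) := by
    rw [Ideal.eq_span_singleton_mul]
    refine ⟨fun z hz ↦ ?_, fun z hz ↦ hz⟩
    obtain ⟨w, rfl⟩ := Ideal.mem_span_singleton'.mp (h2 hz)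
    exact ⟨w, (mul_comm w x ▸ hz : x * w ∈ _), mul_comm _ _⟩
  refine ⟨Submodule.comap (LinearMap.mulLeft W.CoordinateRing x) (pointIdeal (-P) * I),
    (Ideal.span_singleton_mul_right_inj (mk_X_sub_C_ne_zero (xCoord P))).mp ?_⟩
  rw [← hx]
  conv_lhs => rw [← h1, mul_comm (pointIdeal (-P)), mul_assoc, h3]
  rw [mul_left_comm]

/-- A proper J lies in the ideal of some point, which then divides both J and I. Cancelling it
enlarges J, so Noetherian induction reduces to J = ⊤. -/
lemma eq_pointIdeal_mul_of_pow_eq (hn : n ≠ 0) (hT : T ≠ 0) (J : Ideal W.CoordinateRing)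
    (hJ : J ≠ ⊥) (I : Ideal W.CoordinateRing) (h : I ^ n = pointIdeal T ^ n * J ^ n) :
    I = pointIdeal T * J := by
  induction J using WellFoundedGT.induction generalizing I with
  | ind J ih =>
  by_cases hJt : J = ⊤
  · subst hJt
    have hpT := isPrime_pointIdeal hT
    rw [← Ideal.one_eq_top, one_pow, mul_one] at h
    obtain ⟨A, rfl⟩ := exists_eq_pointIdeal_mul hT
      ((Ideal.IsPrime.pow_le_iff hn).mp (h.le.trans (Ideal.pow_le_self hn)))
    have hA : A ^ n = 1 := pointIdeal_pow_mul_left_cancel hT n (by rw [← mul_pow, h, mul_one])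
    have hA' : A = ⊤ := by
      rw [eq_top_iff, ← Ideal.one_eq_top, ← hA]
      exact Ideal.pow_le_self hn
    rw [hA']
  · obtain ⟨P, hP, hle⟩ := exists_le_pointIdeal hJt
    have hpP := isPrime_pointIdeal hP
    obtain ⟨J, rfl⟩ := exists_eq_pointIdeal_mul hP hle
    obtain ⟨I, rfl⟩ : ∃ A, I = pointIdeal P * A := by
      refine exists_eq_pointIdeal_mul hP ((Ideal.IsPrime.pow_le_iff hn).mp ?_)
      rw [h]
      exact Ideal.mul_le_right.trans ((Ideal.pow_le_self hn).trans hle)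
    have hJ0 : J ≠ ⊥ := by rintro rfl; simp at hJ
    have hlt : pointIdeal P * J < J := by
      -- Strictness is Nakayama's lemma: otherwise some r ≡ 1 modulo the ideal of P kills J, so r =
      -- 0 and that ideal would contain 1.
      refine lt_of_le_of_ne Ideal.mul_le_right fun h0 ↦ ?_
      obtain ⟨r, hr, hr'⟩ := Submodule.exists_sub_one_mem_and_smul_eq_zero_of_fg_of_le_smul
        (pointIdeal P) J (IsNoetherian.noetherian J) h0.ge
      obtain ⟨z, hz, hz0⟩ := Submodule.exists_mem_ne_zero_of_ne_bot hJ0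
      have hr0 : r = 0 := (mul_eq_zero.mp (hr' z hz)).resolve_right hz0
      rw [hr0, zero_sub, neg_mem_iff] at hr
      exact hpP.ne_top ((Ideal.eq_top_iff_one _).mpr hr)
    rw [ih J hlt hJ0 I, mul_left_comm]
    refine pointIdeal_pow_mul_left_cancel hP n ?_
    rw [← mul_pow, h, mul_pow, mul_left_comm]

lemma pointIdeal_ne_span (hT : T ≠ 0) (w : W.CoordinateRing) : pointIdeal T ≠ Ideal.span {w} := by
  intro h
  obtain ⟨I, hI, hIT⟩ := exists_pointUnit T
  refine hT ((Point.toClass_eq_zero T).mp ?_)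
  rw [hIT, (ClassGroup.mk_eq_one_of_coe_ideal hI).mpr ⟨w, ?_, h⟩, ofMul_one]
  rintro rfl
  have := (mem_pointIdeal hT _).mpr (show value (CoordinateRing.mk W (C (X - C (xCoord T)))) T = 0 by
    rw [value_mk_C hT]; simp)
  rw [h] at this
  exact mk_X_sub_C_ne_zero (xCoord T) (by simpa using this)

/-- If all values were 1, g would be invariant under n-torsion translations, so g = h ∘ [n] with h^n
= f. For h = u/v the ideal (u) is then the ideal of T times (v), so the ideal of T is principal. But
only T = 0 has trivial class. -/
theorem exists_weilPairing_ne_one [CharZero F] (hn : Odd n) (hT : T ≠ 0) (hnT : n • T = 0) :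
    ∃ S : W.Point, n • S = 0 ∧ weilPairing n S T ≠ 1 := by
  by_contra! hS
  have hn0 := hn.pos.ne'
  obtain ⟨g, hg⟩ := exists_isTorsionRoot hn hnT
  obtain ⟨h, hh, hgh⟩ := exists_eq_comp_nsmul hn0 hg.1 fun S hS' ↦
    (hg.map_add hn hS' hnT).mono fun X hX ↦ by rw [hX, hS S hS', one_mul]
  obtain ⟨-, f, hf0, hf, hgf⟩ := hg
  have hhf : ∀ᶠ X in cofinite, h X ^ n = value f X := by
    rcases ((hh.pow n).sub (.value f)).eventually_eq_zero_or with h0 | h0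
    · exact h0.mono fun X hX ↦ sub_eq_zero.mp hX
    · obtain ⟨X, h1, h2, h3⟩ := ((tendsto_nsmul hn0).eventually h0 |>.and (hgh.and hgf)).exists
      rw [← h3, ← h2, sub_self] at h1
      exact absurd rfl h1
  obtain ⟨u, v, hv, huv⟩ := hh.exists_div
  have h1 : u ^ n = f * v ^ n := by
    refine sub_eq_zero.mp (eq_zero_of_value ?_)
    filter_upwards [hhf, huv, eventually_ne 0] with X h1 h2 h3
    rw [value_sub, value_mul, value_pow h3, value_pow h3, ← h1, ← h2]
    ring
  have h2 : Ideal.span {u} = pointIdeal T * Ideal.span {v} := by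
    refine eq_pointIdeal_mul_of_pow_eq hn0 hT _ (by simpa using hv) _ ?_
    rw [← hf, Ideal.span_singleton_pow, Ideal.span_singleton_pow, h1,
      Ideal.span_singleton_mul_span_singleton]
  obtain ⟨w, rfl⟩ : v ∣ u := by
    rw [← Ideal.span_singleton_le_span_singleton, h2]
    exact Ideal.mul_le_right
  rw [← Ideal.span_singleton_mul_span_singleton, mul_comm (pointIdeal T),
    Ideal.span_singleton_mul_right_inj hv] at h2
  exact pointIdeal_ne_span hT w h2.symm

end Nontrivial

end EllipticCongruence

end



noncomputable section

namespace EllipticCongruence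

open WeierstrassCurve WeierstrassCurve.Affine Polynomial Filter
open scoped Polynomial.Bivariate nonZeroDivisors

/-! ### Transport of the Weil pairing along semilinear isomorphisms of curves -/

section Transport

variable {F F' : Type*} [Field F] [DecidableEq F] [IsAlgClosed F] [Field F'] [DecidableEq F']
  [IsAlgClosed F'] {W : WeierstrassCurve.Affine F} [W.IsElliptic]
  {W' : WeierstrassCurve.Affine F'} [W'.IsElliptic]

lemma eq_of_value {f g : W.CoordinateRing} (h : ∀ X : W.Point, value f X = value g X) : f = g :=
  sub_eq_zero.mp (eq_zero_of_value (.of_forall fun X ↦ by rw [value_sub, h, sub_self]))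

/-- The values of regular functions transform under a semilinear map as soon as those of the
coordinates do. -/
lemma exists_value_comp (φ : F →+* F') {Ψ : W.Point → W'.Point} (h0 : Ψ 0 = 0)
    (hne : ∀ X, X ≠ 0 → Ψ X ≠ 0) {A B : W'.CoordinateRing}
    (hA : ∀ X, X ≠ 0 → value A (Ψ X) = φ (xCoord X))
    (hB : ∀ X, X ≠ 0 → value B (Ψ X) = φ (yCoord X)) (f : W.CoordinateRing) :
    ∃ f' : W'.CoordinateRing, ∀ X, value f' (Ψ X) = φ (value f X) := by
  obtain ⟨a, b, rfl⟩ := exists_ofPair f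
  let j : F →+* W'.CoordinateRing := (algebraMap F' W'.CoordinateRing).comp φ
  refine ⟨a.eval₂ j A + b.eval₂ j A * B, fun X ↦ ?_⟩
  by_cases hX : X = 0
  · simp [hX, h0]
  have key : ∀ q : F[X], value (q.eval₂ j A) (Ψ X) = φ (q.eval (xCoord X)) := by
    intro q
    rw [← valueHom_apply _ (hne X hX), hom_eval₂, valueHom_apply, hA X hX, ← eval₂_hom]
    congr 1
    ext c
    exact (valueHom_apply _ (hne X hX) _).trans (value_const (hne X hX) _)
  rw [value_add, value_mul, key, key, hB X hX, value_ofPair hX, map_add, map_mul]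

/-- A semilinear isomorphism of elliptic curves over algebraically closed fields, given by its
effect on points and on functions. -/
structure SemilinearIso (W : WeierstrassCurve.Affine F) (W' : WeierstrassCurve.Affine F') where
  onField : F ≃+* F'
  onPoint : W.Point ≃ W'.Point
  map_zero : onPoint 0 = 0
  exists_value (f : W.CoordinateRing) : ∃ f' : W'.CoordinateRing,
    ∀ X, value f' (onPoint X) = onField (value f X)
  exists_value_symm (f' : W'.CoordinateRing) : ∃ f : W.CoordinateRing,
    ∀ X, value f' (onPoint X) = onField (value f X)

namespace SemilinearIso

variable (Ψ : SemilinearIso W W')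

lemma exists_ringEquiv : ∃ Φ : W.CoordinateRing ≃+* W'.CoordinateRing,
    ∀ f X, value (Φ f) (Ψ.onPoint X) = Ψ.onField (value f X) := by
  choose Φ hΦ using Ψ.exists_value
  choose Φ' hΦ' using Ψ.exists_value_symm
  have hext : ∀ {f g : W'.CoordinateRing},
      (∀ X, value f (Ψ.onPoint X) = value g (Ψ.onPoint X)) → f = g := by
    intro f g h
    refine eq_of_value fun X ↦ ?_
    obtain ⟨X, rfl⟩ := Ψ.onPoint.surjective X
    exact h X
  refine ⟨⟨⟨Φ, Φ', fun f ↦ ?_, fun f ↦ ?_⟩, fun f g ↦ ?_, fun f g ↦ ?_⟩, hΦ⟩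
  · exact eq_of_value fun X ↦ Ψ.onField.injective (by rw [← hΦ', hΦ])
  · exact hext fun X ↦ by rw [hΦ, ← hΦ']
  · exact hext fun X ↦ by rw [value_mul, hΦ, hΦ, hΦ, value_mul, map_mul]
  · exact hext fun X ↦ by rw [value_add, hΦ, hΦ, hΦ, value_add, map_add]

lemma map_ne_zero {X : W.Point} (hX : X ≠ 0) : Ψ.onPoint X ≠ 0 := fun h ↦
  hX (Ψ.onPoint.injective (h.trans Ψ.map_zero.symm))

variable {Ψ} {Φ : W.CoordinateRing ≃+* W'.CoordinateRing}

lemma map_pointIdeal (hΦ : ∀ f X, value (Φ f) (Ψ.onPoint X) = Ψ.onField (value f X))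
    (T : W.Point) : (pointIdeal T).map (Φ : W.CoordinateRing →+* W'.CoordinateRing) =
      pointIdeal (Ψ.onPoint T) := by
  by_cases hT : T = 0
  · rw [hT, Ψ.map_zero, pointIdeal_zero, pointIdeal_zero, Ideal.map_top]
  ext f
  rw [Ideal.mem_map_iff_of_surjective (Φ : W.CoordinateRing →+* W'.CoordinateRing) Φ.surjective, mem_pointIdeal (Ψ.map_ne_zero hT)]
  constructor
  · rintro ⟨g, hg, rfl⟩
    rw [mem_pointIdeal hT] at hg
    change value (Φ g) _ = 0
    rw [hΦ, hg, _root_.map_zero]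
  · intro hf
    refine ⟨Φ.symm f, (mem_pointIdeal hT _).mpr (Ψ.onField.injective ?_), Φ.apply_symm_apply f⟩
    rw [← hΦ, Φ.apply_symm_apply, hf, _root_.map_zero]

lemma map_span_eq_pow (hΦ : ∀ f X, value (Φ f) (Ψ.onPoint X) = Ψ.onField (value f X))
    {f : W.CoordinateRing} {T : W.Point} {n : ℕ} (hf : Ideal.span {f} = pointIdeal T ^ n) :
    Ideal.span {Φ f} = pointIdeal (Ψ.onPoint T) ^ n := by
  rw [← map_pointIdeal hΦ, ← Ideal.map_pow, ← hf, Ideal.map_span, Set.image_singleton]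
  rfl

variable (Ψ)

/-- An isomorphism of curves which preserves the origin is additive. -/
lemma map_add (T T' : W.Point) : Ψ.onPoint (T + T') = Ψ.onPoint T + Ψ.onPoint T' := by
  obtain ⟨Φ, hΦ⟩ := Ψ.exists_ringEquiv
  -- The relation between the ideals of T, T' and T + T' is carried over by the ring isomorphism,
  -- and a point is determined by its ideal class.
  obtain ⟨α, β, hα, hβ, hαβ⟩ := exists_span_mul_pointIdeal T T'
  have h1 := congrArg (Ideal.map (Φ : W.CoordinateRing →+* W'.CoordinateRing)) hαβ
  simp only [Ideal.map_mul, map_pointIdeal hΦ, Ideal.map_span, Set.image_singleton] at h1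
  obtain ⟨I, hI, hIT⟩ := exists_pointUnit (Ψ.onPoint T)
  obtain ⟨I', hI', hIT'⟩ := exists_pointUnit (Ψ.onPoint T')
  obtain ⟨J, hJ, hJT⟩ := exists_pointUnit (Ψ.onPoint (T + T'))
  apply Point.toClass_injective
  rw [_root_.map_add Point.toClass, hIT, hIT', hJT, ← ofMul_mul, ← map_mul]
  congr 1
  exact (ClassGroup.mk_eq_mk_of_coe_ideal hJ
    (by rw [Units.val_mul, hI, hI', FractionalIdeal.coeIdeal_mul])).mpr
    ⟨Φ α, Φ β, by simpa using hα, by simpa using hβ, h1⟩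

/-- The isomorphism of groups of points. -/
def addEquiv : W.Point ≃+ W'.Point := { Ψ.onPoint with map_add' := Ψ.map_add }

lemma map_nsmul (n : ℕ) (T : W.Point) : Ψ.onPoint (n • T) = n • Ψ.onPoint T :=
  _root_.map_nsmul Ψ.addEquiv n T

/-- All data in the definition are transported by the ring isomorphism and the additive map on
points; only the scalar ζ feels the field isomorphism. This covers both Galois automorphisms and
changes of coordinates. -/
theorem weilPairing_map {n : ℕ} (hn : Odd n) {S T : W.Point} (hS : n • S = 0) (hT : n • T = 0) :
    weilPairing n (Ψ.onPoint S) (Ψ.onPoint T) = Ψ.onField (weilPairing n S T) := by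
  refine weilPairing_eq_of_value hn (by rw [← Ψ.map_nsmul, hS, Ψ.map_zero])
    (by rw [← Ψ.map_nsmul, hT, Ψ.map_zero]) ?_
  obtain ⟨Φ, hΦ⟩ := Ψ.exists_ringEquiv
  obtain ⟨f, a, b, hf, ha, hb, h1, h2⟩ := weilPairing_spec hn hS hT
  refine ⟨Φ f, Φ a, Φ b, map_span_eq_pow hΦ hf, by simpa using ha, by simpa using hb,
    fun X hX ↦ ?_, fun X hX hXS ↦ ?_⟩
  · obtain ⟨X, rfl⟩ := Ψ.onPoint.surjective X
    rw [← Ψ.map_nsmul] at hX ⊢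
    rw [hΦ, hΦ, hΦ, ← map_pow, h1 X (fun h ↦ hX (by rw [h, Ψ.map_zero])), map_mul, map_pow]
  · obtain ⟨X, rfl⟩ := Ψ.onPoint.surjective X
    rw [← Ψ.map_add] at hXS ⊢
    rw [hΦ, hΦ, hΦ, hΦ, ← map_mul, h2 X (fun h ↦ hX (by rw [h, Ψ.map_zero]))
      (fun h ↦ hXS (by rw [h, Ψ.map_zero])), map_mul, map_mul]

end SemilinearIso

end Transport

/-! ### The Galois action and quadratic twists -/

section Twist

variable {K : Type*} [Field K] [CharZero K] [DecidableEq (AlgebraicClosure K)]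
  (E : WeierstrassCurve K) [E.IsElliptic]

instance : (WeierstrassCurve.Affine.baseChange E (AlgebraicClosure K)).IsElliptic :=
  inferInstanceAs ((E.map _).IsElliptic)

lemma isElliptic_quadraticTwist {d : K} (hd : d ≠ 0) : (quadraticTwist E d).IsElliptic := by
  have h : (quadraticTwist E d).Δ = d ^ 6 * E.Δ := by
    simp only [quadraticTwist, WeierstrassCurve.Δ, WeierstrassCurve.b₂, WeierstrassCurve.b₄,
      WeierstrassCurve.b₆, WeierstrassCurve.b₈]
    ring
  refine ⟨?_⟩
  rw [h]
  exact ((isUnit_iff_ne_zero.mpr hd).pow 6).mul E.isUnit_Δ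

variable {E}

lemma xCoord_map (σ : Gal(AlgebraicClosure K/K)) (X : GeomPoint E) :
    xCoord (Point.map (W' := E) σ.toAlgHom X) = σ (xCoord X) := by
  cases X with
  | zero => exact (map_zero σ).symm
  | some x y h => rfl

lemma yCoord_map (σ : Gal(AlgebraicClosure K/K)) (X : GeomPoint E) :
    yCoord (Point.map (W' := E) σ.toAlgHom X) = σ (yCoord X) := by
  cases X with
  | zero => exact (map_zero σ).symm
  | some x y h => rfl

lemma map_point_ne_zero (σ : Gal(AlgebraicClosure K/K)) {X : GeomPoint E} (hX : X ≠ 0) :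
    Point.map (W' := E) σ.toAlgHom X ≠ 0 := fun h ↦
  hX (Point.map_injective (W' := E) _ (h.trans (map_zero _).symm))

lemma map_symm_map (σ : Gal(AlgebraicClosure K/K)) (X : GeomPoint E) :
    Point.map (W' := E) σ.symm.toAlgHom (Point.map (W' := E) σ.toAlgHom X) = X := by
  cases X with
  | zero => rfl
  | some x y h => simp [Point.map_some]

variable (E) in
/-- The Galois action as a semilinear automorphism. -/
def galoisIso (σ : Gal(AlgebraicClosure K/K)) :
    SemilinearIso (WeierstrassCurve.Affine.baseChange E (AlgebraicClosure K))
      (WeierstrassCurve.Affine.baseChange E (AlgebraicClosure K)) where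
  onField := σ
  onPoint := ⟨Point.map (W' := E) σ.toAlgHom, Point.map (W' := E) σ.symm.toAlgHom,
    map_symm_map σ, fun X ↦ by simpa using map_symm_map σ.symm X⟩
  map_zero := rfl
  exists_value := by
    refine exists_value_comp (σ : AlgebraicClosure K →+* AlgebraicClosure K) rfl
      (fun X hX ↦ map_point_ne_zero σ hX) (A := CoordinateRing.mk _ (C X))
      (B := CoordinateRing.mk _ Y) (fun X hX ↦ ?_) fun X hX ↦ ?_
    · change value _ (Point.map (W' := E) σ.toAlgHom X) = _
      rw [value_mk_C (map_point_ne_zero σ hX), eval_X, xCoord_map]; rfl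
    · change value _ (Point.map (W' := E) σ.toAlgHom X) = _
      rw [value_mk_Y (map_point_ne_zero σ hX), yCoord_map]; rfl
  exists_value_symm f' := by
    obtain ⟨f, hf⟩ := exists_value_comp (W := WeierstrassCurve.Affine.baseChange E
      (AlgebraicClosure K)) (σ.symm : AlgebraicClosure K →+* AlgebraicClosure K) 
      (Ψ := Point.map (W' := E) σ.symm.toAlgHom) rfl
      (fun X hX ↦ map_point_ne_zero σ.symm hX) (A := CoordinateRing.mk _ (C X))
      (B := CoordinateRing.mk _ Y) (fun X hX ↦ by
        rw [value_mk_C (map_point_ne_zero σ.symm hX), eval_X, xCoord_map]; rfl) (fun X hX ↦ by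
        rw [value_mk_Y (map_point_ne_zero σ.symm hX), yCoord_map]; rfl) f'
    refine ⟨f, fun X ↦ ?_⟩
    have := hf (Point.map (W' := E) σ.toAlgHom X)
    rw [map_symm_map] at this
    change _ = σ (value f X)
    rw [this]
    exact (σ.apply_symm_apply _).symm

theorem weilPairing_galois {n : ℕ} (hn : Odd n) (σ : Gal(AlgebraicClosure K/K))
    {S T : GeomPoint E} (hS : n • S = 0) (hT : n • T = 0) :
    weilPairing n (Point.map (W' := E) σ.toAlgHom S) (Point.map (W' := E) σ.toAlgHom T) =
      σ (weilPairing n S T) :=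
  (galoisIso E σ).weilPairing_map hn hS hT

end Twist

end EllipticCongruence

end



noncomputable section

namespace EllipticCongruence

open WeierstrassCurve WeierstrassCurve.Affine Polynomial Filter
open scoped Polynomial.Bivariate

/-! ### Isomorphisms given by affine changes of coordinates -/

section AffineIso

variable {F : Type*} [Field F] [DecidableEq F] [IsAlgClosed F]

/-- An affine change of coordinates `(x, y) ↦ (α x + r, β y + s x + t)` which maps the curve `W`
onto `W'`. -/
structure CoordChange (W W' : WeierstrassCurve.Affine F) where
  (α β r s t : F)
  α_ne_zero : α ≠ 0
  β_ne_zero : β ≠ 0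
  equation_iff (x y : F) : W.Equation x y ↔ W'.Equation (α * x + r) (β * y + s * x + t)

namespace CoordChange

variable {W W' : WeierstrassCurve.Affine F} [W.IsElliptic] [W'.IsElliptic] (c : CoordChange W W')

lemma exists_point_of_equation {x y : F} (h : W.Equation x y) :
    ∃ P : W.Point, P ≠ 0 ∧ xCoord P = x ∧ yCoord P = y :=
  ⟨.some x y (equation_iff_nonsingular.mp h), Point.some_ne_zero _, rfl, rfl⟩

lemma exists_map (X : W.Point) : ∃ P : W'.Point, (X = 0 → P = 0) ∧ (X ≠ 0 → P ≠ 0 ∧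
    xCoord P = c.α * xCoord X + c.r ∧ yCoord P = c.β * yCoord X + c.s * xCoord X + c.t) := by
  by_cases hX : X = 0
  · exact ⟨0, fun _ ↦ rfl, fun h ↦ absurd hX h⟩
  · obtain ⟨P, hP⟩ := exists_point_of_equation
      ((c.equation_iff _ _).mp (nonsingular_coord hX).1)
    exact ⟨P, fun h ↦ absurd h hX, fun _ ↦ hP⟩

/-- The effect of the change of coordinates on points. -/
def map (X : W.Point) : W'.Point := (c.exists_map X).choose

lemma map_zero : c.map 0 = 0 := (c.exists_map 0).choose_spec.1 rfl

lemma map_spec {X : W.Point} (hX : X ≠ 0) : c.map X ≠ 0 ∧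
    xCoord (c.map X) = c.α * xCoord X + c.r ∧
    yCoord (c.map X) = c.β * yCoord X + c.s * xCoord X + c.t :=
  (c.exists_map X).choose_spec.2 hX

lemma map_bijective : Function.Bijective c.map := by
  constructor
  · intro X X' h
    by_cases hX : X = 0
    · by_contra hne
      rw [hX, map_zero] at h
      exact (c.map_spec (X := X') (fun h' ↦ hne (hX.trans h'.symm))).1 h.symm
    by_cases hX' : X' = 0
    · rw [hX', map_zero] at h
      exact absurd h (c.map_spec hX).1
    obtain ⟨-, h1, h2⟩ := c.map_spec hX
    obtain ⟨-, h3, h4⟩ := c.map_spec hX'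
    rw [h, h3] at h1
    have h5 := mul_left_cancel₀ c.α_ne_zero (add_right_cancel h1)
    rw [h, h4, h5] at h2
    have h6 := mul_left_cancel₀ c.β_ne_zero (add_right_cancel (add_right_cancel h2))
    exact ext_coord hX hX' h5.symm h6.symm
  · intro P
    by_cases hP : P = 0
    · exact ⟨0, by rw [map_zero, hP]⟩
    obtain ⟨x, hx⟩ : ∃ x, xCoord P = c.α * x + c.r :=
      ⟨(xCoord P - c.r) / c.α, by have := c.α_ne_zero; field_simp; ring⟩
    obtain ⟨y, hy⟩ : ∃ y, yCoord P = c.β * y + c.s * x + c.t :=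
      ⟨(yCoord P - c.s * x - c.t) / c.β, by have := c.β_ne_zero; field_simp; ring⟩
    have h := (nonsingular_coord hP).1
    rw [hx, hy, ← c.equation_iff] at h
    obtain ⟨X, hX, rfl, rfl⟩ := exists_point_of_equation h
    obtain ⟨h3, h4, h5⟩ := c.map_spec hX
    exact ⟨X, ext_coord h3 hP (h4.trans hx.symm) (h5.trans hy.symm)⟩

/-- The isomorphism of curves given by the change of coordinates. -/
def iso : SemilinearIso W W' where
  onField := .refl _
  onPoint := .ofBijective _ c.map_bijective
  map_zero := c.map_zero
  exists_value := by
    have hα := c.α_ne_zero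
    have hβ := c.β_ne_zero
    refine exists_value_comp (RingHom.id _) c.map_zero (fun X hX ↦ (c.map_spec hX).1)
      (A := CoordinateRing.mk _ (C (C c.α⁻¹ * (X - C c.r))))
      (B := const c.β⁻¹ * (CoordinateRing.mk _ Y - CoordinateRing.mk _
        (C (C (c.s / c.α) * (X - C c.r) + C c.t)))) (fun X hX ↦ ?_) fun X hX ↦ ?_
    · obtain ⟨h1, h2, h3⟩ := c.map_spec hX
      change value _ (c.map X) = _
      rw [value_mk_C h1, h2]
      simp [hα]
    · obtain ⟨h1, h2, h3⟩ := c.map_spec hX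
      change value _ (c.map X) = _
      rw [value_mul, value_sub, value_const h1, value_mk_C h1, value_mk_Y h1, h2, h3]
      simp only [eval_mul, eval_add, eval_sub, eval_C, eval_X, RingHom.id_apply]
      field_simp
      ring
  exists_value_symm f' := by
    set Ψ := Equiv.ofBijective _ c.map_bijective
    have hne : ∀ P, P ≠ 0 → Ψ.symm P ≠ 0 := by
      intro P hP h
      rw [Equiv.symm_apply_eq] at h
      exact hP (h.trans c.map_zero)
    have hspec : ∀ P, P ≠ 0 → xCoord P = c.α * xCoord (Ψ.symm P) + c.r ∧
        yCoord P = c.β * yCoord (Ψ.symm P) + c.s * xCoord (Ψ.symm P) + c.t := by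
      intro P hP
      have h1 := (c.map_spec (hne P hP)).2
      rwa [show c.map (Ψ.symm P) = P from Ψ.apply_symm_apply P] at h1
    obtain ⟨f, hf⟩ := exists_value_comp (W := W') (W' := W) (RingHom.id _) (Ψ := Ψ.symm)
      ((Equiv.symm_apply_eq _).mpr c.map_zero.symm) hne
      (A := CoordinateRing.mk _ (C (C c.α * X + C c.r)))
      (B := const c.β * CoordinateRing.mk _ Y + CoordinateRing.mk _ (C (C c.s * X + C c.t)))
      (fun P hP ↦ by
        rw [value_mk_C (hne P hP), (hspec P hP).1]
        simp)
      (fun P hP ↦ by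
        rw [value_add, value_mul, value_const (hne P hP), value_mk_C (hne P hP),
          value_mk_Y (hne P hP), RingHom.id_apply, (hspec P hP).2]
        simp only [eval_mul, eval_add, eval_C, eval_X]
        ring) f'
    refine ⟨f, fun X ↦ ?_⟩
    have := hf (Ψ X)
    rw [Equiv.symm_apply_apply] at this
    exact this.symm

theorem weilPairing_map {n : ℕ} (hn : Odd n) {S T : W.Point} (hS : n • S = 0) (hT : n • T = 0) :
    weilPairing n (c.map S) (c.map T) = weilPairing n S T :=
  c.iso.weilPairing_map hn hS hT

end CoordChange

end AffineIso

/-! ### A curve and its quadratic twist over the algebraic closure -/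

section TwistIso

lemma equation_baseChange_iff {K : Type*} [Field K] {E : WeierstrassCurve K}
    {x y : AlgebraicClosure K} :
    (WeierstrassCurve.Affine.baseChange E (AlgebraicClosure K)).Equation x y ↔
      y ^ 2 + algebraMap K _ E.a₁ * x * y + algebraMap K _ E.a₃ * y =
      x ^ 3 + algebraMap K _ E.a₂ * x ^ 2 + algebraMap K _ E.a₄ * x + algebraMap K _ E.a₆ :=
  equation_iff ..

variable {K : Type*} [Field K] [CharZero K] [DecidableEq (AlgebraicClosure K)]
  {E : WeierstrassCurve K} [E.IsElliptic] {e : K} {δ : AlgebraicClosure K}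

lemma yCoord_neg' {X : GeomPoint E} (hX : X ≠ 0) : yCoord (-X) =
    -yCoord X - algebraMap K _ E.a₁ * xCoord X - algebraMap K _ E.a₃ := yCoord_neg hX

variable (E) in
/-- The isomorphism `(x, y) ↦ (δ² x, δ³ (y + (a₁ x + a₃) / 2))` from `E` to its twist by `e = δ²`. -/
def twistChange (hδ : δ ^ 2 = algebraMap K _ e) (hδ0 : δ ≠ 0) :
    CoordChange (WeierstrassCurve.Affine.baseChange E (AlgebraicClosure K))
      (WeierstrassCurve.Affine.baseChange (quadraticTwist E e) (AlgebraicClosure K)) where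
  α := δ ^ 2
  β := δ ^ 3
  r := 0
  s := δ ^ 3 * (algebraMap K _ E.a₁ / 2)
  t := δ ^ 3 * (algebraMap K _ E.a₃ / 2)
  α_ne_zero := pow_ne_zero 2 hδ0
  β_ne_zero := pow_ne_zero 3 hδ0
  equation_iff x y := by
    rw [equation_baseChange_iff, equation_baseChange_iff]
    simp only [quadraticTwist, _root_.map_zero, map_mul, map_pow, map_div₀, ← hδ,
      WeierstrassCurve.b₂, WeierstrassCurve.b₄, WeierstrassCurve.b₆, map_add, map_ofNat]
    constructor
    · intro h
      linear_combination δ ^ 6 * h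
    · intro h
      apply mul_left_cancel₀ (pow_ne_zero 6 hδ0)
      linear_combination h

variable (hδ : δ ^ 2 = algebraMap K _ e) (hδ0 : δ ≠ 0) [(quadraticTwist E e).IsElliptic]

/-- The twisting isomorphism is defined over K(δ), so σ carries the one for δ to the one for σ δ.
Together with `twistChange_neg` this gives the sign in the Galois action. -/
lemma map_twistChange (σ : Gal(AlgebraicClosure K/K)) {δ' : AlgebraicClosure K}
    (hδ' : δ' ^ 2 = algebraMap K _ e) (hδ0' : δ' ≠ 0) (h : σ δ = δ') (X : GeomPoint E) :
    Point.map (W' := quadraticTwist E e) σ.toAlgHom ((twistChange E hδ hδ0).map X) =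
      (twistChange E hδ' hδ0').map (Point.map (W' := E) σ.toAlgHom X) := by
  by_cases hX : X = 0
  · rw [hX, _root_.map_zero, CoordChange.map_zero, CoordChange.map_zero, _root_.map_zero]
  obtain ⟨h1, h2, h3⟩ := (twistChange E hδ hδ0).map_spec hX
  obtain ⟨h4, h5, h6⟩ := (twistChange E hδ' hδ0').map_spec (map_point_ne_zero σ hX)
  refine ext_coord (map_point_ne_zero σ h1) h4 ?_ ?_
  · rw [xCoord_map, h2, h5, xCoord_map]
    simp [twistChange, h]
  · rw [yCoord_map, h3, h6, xCoord_map, yCoord_map]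
    simp [twistChange, h, map_ofNat σ 2]

lemma twistChange_neg (h' : (-δ) ^ 2 = algebraMap K _ e) (h0' : -δ ≠ 0) (X : GeomPoint E) :
    (twistChange E h' h0').map X = (twistChange E hδ hδ0).map (-X) := by
  by_cases hX : X = 0
  · rw [hX, neg_zero, CoordChange.map_zero, CoordChange.map_zero]
  obtain ⟨h1, h2, h3⟩ := (twistChange E h' h0').map_spec hX
  obtain ⟨h4, h5, h6⟩ := (twistChange E hδ hδ0).map_spec (neg_point_ne_zero hX)
  refine ext_coord h1 h4 ?_ ?_
  · rw [h2, h5, xCoord_neg]; simp only [twistChange]; ring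
  · rw [h3, h6, xCoord_neg, yCoord_neg' hX]; simp only [twistChange]; ring

end TwistIso

end EllipticCongruence

end



noncomputable section

namespace EllipticCongruence

open WeierstrassCurve WeierstrassCurve.Affine Polynomial Filter
open scoped Polynomial.Bivariate

/-! ### Powers of roots of unity with exponents modulo `p` -/

section RootPow

variable {p : ℕ} [Fact p.Prime] {M : Type*} [Field M] {ζ : M}

lemma pow_val_natCast (hζ : ζ ^ p = 1) (n : ℕ) : ζ ^ (n : ZMod p).val = ζ ^ n := by
  rw [ZMod.val_natCast, ← pow_mod_orderOf ζ (n % p), ← pow_mod_orderOf ζ n,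
    Nat.mod_mod_of_dvd _ (orderOf_dvd_of_pow_eq_one hζ)]

lemma pow_val_add (hζ : ζ ^ p = 1) (a b : ZMod p) :
    ζ ^ (a + b).val = ζ ^ a.val * ζ ^ b.val := by
  rw [← pow_add, ← pow_val_natCast hζ (_ + _), Nat.cast_add, ZMod.natCast_zmod_val,
    ZMod.natCast_zmod_val]

lemma pow_val_mul (hζ : ζ ^ p = 1) (a b : ZMod p) :
    ζ ^ (a * b).val = (ζ ^ a.val) ^ b.val := by
  rw [← pow_mul, ← pow_val_natCast hζ (_ * _), Nat.cast_mul, ZMod.natCast_zmod_val,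
    ZMod.natCast_zmod_val]

lemma pow_val_injective (hζ : ζ ^ p = 1) (h1 : ζ ≠ 1) {a b : ZMod p}
    (h : ζ ^ a.val = ζ ^ b.val) : a = b := by
  have hord : orderOf ζ = p := orderOf_eq_prime hζ h1
  apply ZMod.val_injective p
  refine pow_injOn_Iio_orderOf ?_ ?_ h <;> rw [hord] <;> exact ZMod.val_lt _

end RootPow

/-! ### The Weil pairing on the plane `E[p]` -/

section Plane

variable {K : Type*} [Field K] [CharZero K] [DecidableEq (AlgebraicClosure K)]
  {p : ℕ} [hpp : Fact p.Prime] {E : WeierstrassCurve K} [E.IsElliptic]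

lemma Torsion.nsmul_eq_zero (P : Torsion p E) : p • (P : GeomPoint E) = 0 :=
  (AddSubgroup.torsionBy.nsmul_iff).mp P.2

lemma card_torsion : Nat.card (Torsion p E) = p ^ 2 := by
  rw [← ncard_nsmul_eq_zero (W := WeierstrassCurve.Affine.baseChange E (AlgebraicClosure K))
    hpp.out.ne_zero]
  refine congrArg Set.ncard (Set.ext fun P ↦ ?_)
  exact AddSubgroup.torsionBy.nsmul_iff

instance : Finite (Torsion p E) :=
  Nat.finite_of_card_ne_zero (by rw [card_torsion]; exact pow_ne_zero 2 hpp.out.ne_zero)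

lemma finrank_torsion : Module.finrank (ZMod p) (Torsion p E) = 2 := by
  have := Fintype.ofFinite (Torsion p E)
  have h := Module.card_eq_pow_finrank (K := ZMod p) (V := Torsion p E)
  rw [← Nat.card_eq_fintype_card, ← Nat.card_eq_fintype_card, card_torsion, Nat.card_zmod] at h
  exact (Nat.pow_right_injective hpp.out.two_le h).symm

/-- The Weil pairing on `E[p]`. -/
def torsionPairing (P Q : Torsion p E) : AlgebraicClosure K :=
  weilPairing p (P : GeomPoint E) (Q : GeomPoint E)

variable (hp : p ≠ 2)

include hp

lemma torsionPairing_pow (P Q : Torsion p E) : torsionPairing P Q ^ p = 1 :=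
  weilPairing_pow (hpp.out.odd_of_ne_two hp) P.nsmul_eq_zero Q.nsmul_eq_zero

lemma torsionPairing_add_left (P P' Q : Torsion p E) :
    torsionPairing (P + P') Q = torsionPairing P Q * torsionPairing P' Q :=
  weilPairing_add_left (hpp.out.odd_of_ne_two hp) P.nsmul_eq_zero P'.nsmul_eq_zero Q.nsmul_eq_zero

lemma torsionPairing_add_right (P Q Q' : Torsion p E) :
    torsionPairing P (Q + Q') = torsionPairing P Q * torsionPairing P Q' :=
  weilPairing_add_right (hpp.out.odd_of_ne_two hp) P.nsmul_eq_zero Q.nsmul_eq_zero Q'.nsmul_eq_zero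

lemma torsionPairing_self (P : Torsion p E) : torsionPairing P P = 1 :=
  weilPairing_self hpp.out hp P.nsmul_eq_zero

lemma torsionPairing_zero_left (Q : Torsion p E) : torsionPairing 0 Q = 1 := by
  have h := torsionPairing_add_left hp 0 0 Q
  have h0 : torsionPairing (0 : Torsion p E) Q ≠ 0 := fun h0 ↦ by
    simpa [h0, hpp.out.ne_zero] using torsionPairing_pow hp 0 Q
  rw [add_zero] at h
  exact (mul_eq_left₀ h0).mp h.symm

lemma torsionPairing_zero_right (P : Torsion p E) : torsionPairing P 0 = 1 := by
  have h := torsionPairing_add_right hp P 0 0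
  have h0 : torsionPairing P (0 : Torsion p E) ≠ 0 := fun h0 ↦ by
    simpa [h0, hpp.out.ne_zero] using torsionPairing_pow hp P 0
  rw [add_zero] at h
  exact (mul_eq_left₀ h0).mp h.symm

lemma torsionPairing_smul_left (c : ZMod p) (P Q : Torsion p E) :
    torsionPairing (c • P) Q = torsionPairing P Q ^ c.val := by
  have key : ∀ n : ℕ, torsionPairing (n • P) Q = torsionPairing P Q ^ n := by
    intro n
    induction n with
    | zero => rw [zero_nsmul, pow_zero, torsionPairing_zero_left hp]
    | succ n ih => rw [succ_nsmul, torsionPairing_add_left hp, ih, pow_succ]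
  rw [← key, ← Nat.cast_smul_eq_nsmul (ZMod p), ZMod.natCast_zmod_val]

lemma torsionPairing_smul_right (c : ZMod p) (P Q : Torsion p E) :
    torsionPairing P (c • Q) = torsionPairing P Q ^ c.val := by
  have key : ∀ n : ℕ, torsionPairing P (n • Q) = torsionPairing P Q ^ n := by
    intro n
    induction n with
    | zero => rw [zero_nsmul, pow_zero, torsionPairing_zero_right hp]
    | succ n ih => rw [succ_nsmul, torsionPairing_add_right hp, ih, pow_succ]
  rw [← key, ← Nat.cast_smul_eq_nsmul (ZMod p), ZMod.natCast_zmod_val]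

lemma torsionPairing_swap (P Q : Torsion p E) : torsionPairing P Q * torsionPairing Q P = 1 := by
  have h := torsionPairing_self hp (P + Q)
  rwa [torsionPairing_add_left hp, torsionPairing_add_right hp, torsionPairing_add_right hp,
    torsionPairing_self hp, torsionPairing_self hp, one_mul, mul_one] at h

/-- The Weil pairing is a power of the determinant form of a basis. -/
lemma torsionPairing_eq_pow_det (b : Module.Basis (Fin 2) (ZMod p) (Torsion p E))
    (P Q : Torsion p E) :
    torsionPairing P Q = torsionPairing (b 0) (b 1) ^ (b.det ![P, Q]).val := by
  set ζ := torsionPairing (b 0) (b 1) with hζ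
  have h1 : ζ ^ p = 1 := torsionPairing_pow hp _ _
  have h2 : torsionPairing (b 1) (b 0) = ζ ^ (-1 : ZMod p).val := by
    have h3 := torsionPairing_swap hp (b 0) (b 1)
    have h4 := pow_val_add h1 1 (-1)
    rw [add_neg_cancel, ZMod.val_zero, pow_zero, ZMod.val_one, pow_one] at h4
    have h0 : ζ ≠ 0 := fun h0 ↦ by simp [h0, hpp.out.ne_zero] at h1
    exact mul_left_cancel₀ h0 (h3.trans h4)
  have hP := b.sum_repr P
  have hQ := b.sum_repr Q
  rw [Fin.sum_univ_two] at hP hQ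
  conv_lhs => rw [← hP, ← hQ]
  simp only [torsionPairing_add_left hp, torsionPairing_add_right hp, torsionPairing_smul_left hp,
    torsionPairing_smul_right hp, torsionPairing_self hp, h2, ← hζ, one_pow, one_mul, mul_one]
  rw [← pow_val_mul h1, ← pow_val_mul h1, ← pow_val_mul h1, ← pow_val_add h1]
  congr 2
  rw [Module.Basis.det_apply, Matrix.det_fin_two]
  simp [Module.Basis.toMatrix_apply]
  ring

lemma exists_torsionPairing_ne_one : ∃ P Q : Torsion p E, torsionPairing P Q ≠ 1 := by
  have : Nontrivial (Torsion p E) := by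
    rw [← Finite.one_lt_card_iff_nontrivial, card_torsion]
    exact Nat.one_lt_pow two_ne_zero hpp.out.one_lt
  obtain ⟨Q, hQ⟩ := exists_ne (0 : Torsion p E)
  obtain ⟨P, hP, h⟩ := exists_weilPairing_ne_one (hpp.out.odd_of_ne_two hp)
    (T := (Q : GeomPoint E)) (fun h ↦ hQ (Subtype.ext h)) Q.nsmul_eq_zero
  exact ⟨⟨P, AddSubgroup.torsionBy.nsmul_iff.mpr hP⟩, Q, h⟩

lemma torsionPairing_map (A : Torsion p E →ₗ[ZMod p] Torsion p E) (P Q : Torsion p E) :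
    torsionPairing (A P) (A Q) = torsionPairing P Q ^ (LinearMap.det A).val := by
  have : Module.Finite (ZMod p) (Torsion p E) := .of_finite
  let b := Module.finBasisOfFinrankEq (ZMod p) (Torsion p E) finrank_torsion
  rw [torsionPairing_eq_pow_det hp b, torsionPairing_eq_pow_det hp b P Q,
    ← pow_val_mul (torsionPairing_pow hp _ _)]
  congr 2
  have := b.det_comp A ![P, Q]
  rw [mul_comm, ← this]
  congr 1
  ext i
  fin_cases i <;> rfl

/-- Some pairing value is a primitive p-th root of unity, so exponents modulo p can be read off from
it. -/
lemma det_eq_of_torsionPairing {A : Torsion p E →ₗ[ZMod p] Torsion p E} {c : ZMod p}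
    (h : ∀ P Q, torsionPairing (A P) (A Q) = torsionPairing P Q ^ c.val) :
    LinearMap.det A = c := by
  obtain ⟨P, Q, hPQ⟩ := exists_torsionPairing_ne_one (E := E) hp
  exact pow_val_injective (torsionPairing_pow hp P Q) hPQ
    ((torsionPairing_map hp A P Q).symm.trans (h P Q))

/-- The determinant of the mod `p` representation is the cyclotomic character. -/
lemma exists_root_galois : ∃ ζ : AlgebraicClosure K, ζ ^ p = 1 ∧ ζ ≠ 1 ∧
    ∀ σ : Gal(AlgebraicClosure K/K), σ ζ = ζ ^ (LinearMap.det (galoisRep p E σ)).val := by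
  obtain ⟨P, Q, hPQ⟩ := exists_torsionPairing_ne_one (E := E) hp
  refine ⟨_, torsionPairing_pow hp P Q, hPQ, fun σ ↦ ?_⟩
  rw [← torsionPairing_map hp]
  exact (weilPairing_galois (hpp.out.odd_of_ne_two hp) σ P.nsmul_eq_zero Q.nsmul_eq_zero).symm

end Plane

/-! ### Quadratic characters, and congruences with quadratic twists -/

section Characters

variable {K : Type*} [Field K] [CharZero K]

/-- A square root in the algebraic closure. -/
def sqrtClosure (e : K) : AlgebraicClosure K :=
  (IsAlgClosed.exists_pow_nat_eq (algebraMap K (AlgebraicClosure K) e) two_pos).choose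

lemma sqrtClosure_sq (e : K) : sqrtClosure e ^ 2 = algebraMap K (AlgebraicClosure K) e :=
  (IsAlgClosed.exists_pow_nat_eq (algebraMap K (AlgebraicClosure K) e) two_pos).choose_spec

lemma sqrtClosure_ne_zero {e : K} (he : e ≠ 0) : sqrtClosure e ≠ 0 := fun h ↦ by
  have h1 := sqrtClosure_sq e
  rw [h, zero_pow two_ne_zero, eq_comm, map_eq_zero] at h1
  exact he h1

lemma eq_or_neg_of_sq {δ δ' : AlgebraicClosure K} (h : δ ^ 2 = δ' ^ 2) : δ = δ' ∨ δ = -δ' :=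
  sq_eq_sq_iff_eq_or_eq_neg.mp h

lemma galois_sq {e : K} {δ : AlgebraicClosure K} (hδ : δ ^ 2 = algebraMap K _ e)
    (σ : Gal(AlgebraicClosure K/K)) : σ δ = δ ∨ σ δ = -δ :=
  eq_or_neg_of_sq (by rw [← map_pow, hδ, AlgEquiv.commutes])

open Classical in
/-- The quadratic character of the absolute Galois group attached to `K(√e)`. -/
def quadChar (e : K) (σ : Gal(AlgebraicClosure K/K)) : ℤˣ :=
  if σ (sqrtClosure e) = sqrtClosure e then 1 else -1

lemma quadChar_spec {e : K} {δ : AlgebraicClosure K} (hδ : δ ^ 2 = algebraMap K _ e)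
    (σ : Gal(AlgebraicClosure K/K)) : σ δ = ((quadChar e σ : ℤ) : AlgebraicClosure K) * δ := by
  have key : σ (sqrtClosure e) = ((quadChar e σ : ℤ) : AlgebraicClosure K) * sqrtClosure e := by
    rw [quadChar]
    split_ifs with h
    · simp [h]
    · simpa using (galois_sq (sqrtClosure_sq e) σ).resolve_left h
  rcases eq_or_neg_of_sq (hδ.trans (sqrtClosure_sq e).symm) with rfl | rfl
  · exact key
  · rw [map_neg, key]; ring

lemma quadChar_eq_one_iff {e : K} {δ : AlgebraicClosure K} (hδ : δ ^ 2 = algebraMap K _ e)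
    (σ : Gal(AlgebraicClosure K/K)) : quadChar e σ = 1 ↔ σ δ = δ := by
  have h := quadChar_spec hδ σ
  constructor
  · intro h1; rw [h, h1]; simp
  · intro h1
    have key : σ (sqrtClosure e) = sqrtClosure e := by
      rcases eq_or_neg_of_sq (hδ.trans (sqrtClosure_sq e).symm) with rfl | rfl
      · exact h1
      · simpa using h1
    rw [quadChar, if_pos key]

lemma quadChar_mul_apply {e : K} (he : e ≠ 0) (σ τ : Gal(AlgebraicClosure K/K)) :
    quadChar e (σ * τ) = quadChar e σ * quadChar e τ := by
  have h := quadChar_spec (sqrtClosure_sq e) (σ * τ)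
  rw [AlgEquiv.mul_apply, quadChar_spec (sqrtClosure_sq e) τ, map_mul, map_intCast,
    quadChar_spec (sqrtClosure_sq e) σ, ← mul_assoc] at h
  have h1 := mul_right_cancel₀ (sqrtClosure_ne_zero he) h
  rw [← Int.cast_mul, Int.cast_inj] at h1
  exact Units.ext (by rw [← h1, Units.val_mul, mul_comm])

end Characters

/-! ### The p-torsion of a quadratic twist -/

section TwistTorsion

variable {K : Type*} [Field K] [CharZero K] [DecidableEq (AlgebraicClosure K)]
  {p : ℕ} [hpp : Fact p.Prime] {E : WeierstrassCurve K} [E.IsElliptic] {e : K}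

/-- The isomorphism of `E` with its twist by `e`, on `p`-torsion points. -/
def twistTorsion (p : ℕ) (E : WeierstrassCurve K) [E.IsElliptic] [Fact p.Prime] (he : e ≠ 0) :
    Torsion p E ≃ₗ[ZMod p] Torsion p (quadraticTwist E e) :=
  have := isElliptic_quadraticTwist E he
  let Ψ := (twistChange E (sqrtClosure_sq e) (sqrtClosure_ne_zero he)).iso.addEquiv
  let Θ : Torsion p E ≃+ Torsion p (quadraticTwist E e) :=
    { toFun := fun P ↦ ⟨Ψ P, AddSubgroup.torsionBy.nsmul_iff.mpr (by
        rw [← map_nsmul, P.nsmul_eq_zero, map_zero])⟩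
      invFun := fun P ↦ ⟨Ψ.symm P, AddSubgroup.torsionBy.nsmul_iff.mpr (by
        rw [← map_nsmul, P.nsmul_eq_zero, map_zero])⟩
      left_inv := fun P ↦ Subtype.ext (Ψ.symm_apply_apply _)
      right_inv := fun P ↦ Subtype.ext (Ψ.apply_symm_apply _)
      map_add' := fun P Q ↦ Subtype.ext (map_add Ψ _ _) }
  { Θ with map_smul' := fun c P ↦ ZMod.map_smul Θ c P }

lemma torsionPairing_twist (hp : p ≠ 2) (he : e ≠ 0) (P Q : Torsion p E) :
    torsionPairing (twistTorsion p E he P) (twistTorsion p E he Q) = torsionPairing P Q :=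
  have := isElliptic_quadraticTwist E he
  (twistChange E (sqrtClosure_sq e) (sqrtClosure_ne_zero he)).weilPairing_map (hpp.out.odd_of_ne_two hp)
    P.nsmul_eq_zero Q.nsmul_eq_zero

/-- An automorphism with σ√e = −√e replaces the twisting isomorphism by its negative. -/
lemma galoisRep_twist (he : e ≠ 0) (σ : Gal(AlgebraicClosure K/K)) (P : Torsion p E) :
    galoisRep p (quadraticTwist E e) σ (twistTorsion p E he P) =
      ((quadChar e σ : ℤ) : ZMod p) • twistTorsion p E he (galoisRep p E σ P) := by
  have := isElliptic_quadraticTwist E he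
  have hδ0 := sqrtClosure_ne_zero he
  rcases Int.units_eq_one_or (quadChar e σ) with h | h
  · rw [h, Units.val_one, Int.cast_one, one_smul]
    exact Subtype.ext (map_twistChange (sqrtClosure_sq e) hδ0 σ (sqrtClosure_sq e) hδ0
      ((quadChar_eq_one_iff (sqrtClosure_sq e) σ).mp h) P.1)
  · rw [h, Units.val_neg, Units.val_one, Int.cast_neg, Int.cast_one, neg_smul, one_smul]
    have hσ := quadChar_spec (sqrtClosure_sq e) σ
    rw [h, Units.val_neg, Units.val_one, Int.cast_neg, Int.cast_one, neg_one_mul] at hσ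
    have h' : (-sqrtClosure e) ^ 2 = algebraMap K _ e := by rw [neg_sq, sqrtClosure_sq]
    refine Subtype.ext ((map_twistChange (sqrtClosure_sq e) hδ0 σ h' (neg_ne_zero.mpr hδ0)
      hσ P.1).trans ?_)
    rw [twistChange_neg (sqrtClosure_sq e) hδ0]
    exact map_neg (twistChange E (sqrtClosure_sq e) hδ0).iso.addEquiv _

/-- The linear map `A` commutes with `ρ` up to the signs `χ`. -/
def TwistCommutes {G V : Type*} [Group G] [AddCommGroup V] [Module (ZMod p) V]
    (ρ : Representation (ZMod p) G V) (χ : G → ℤˣ) (A : V →ₗ[ZMod p] V) : Prop :=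
  ∀ σ P, A (ρ σ P) = ((χ σ : ℤ) : ZMod p) • ρ σ (A P)

lemma congruent_of_twistCommutes (he : e ≠ 0) (A : Torsion p E ≃ₗ[ZMod p] Torsion p E)
    (hA : TwistCommutes (galoisRep p E) (quadChar e) A.toLinearMap) :
    Congruent p E (quadraticTwist E e) := by
  refine ⟨Representation.Equiv.mk (A.trans (twistTorsion p E he)) fun σ ↦ LinearMap.ext fun P ↦ ?_⟩
  change twistTorsion p E he (A (galoisRep p E σ P)) =
    galoisRep p (quadraticTwist E e) σ (twistTorsion p E he (A P))
  rw [galoisRep_twist, ← map_smul]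
  exact congrArg _ (hA σ P)

/-- A is φ followed by the inverse of the twisting isomorphism. The latter preserves pairings, so d
is a multiplier of φ exactly when d = det A; in particular the multiplier is unique. -/
lemma TorsionIso.exists_twistCommutes (hp : p ≠ 2) (he : e ≠ 0)
    (φ : TorsionIso p E (quadraticTwist E e)) :
    ∃ A : Torsion p E ≃ₗ[ZMod p] Torsion p E,
      TwistCommutes (galoisRep p E) (quadChar e) A.toLinearMap ∧
      (IsSymplectic φ ↔ IsSquare (LinearMap.det A.toLinearMap)) ∧
      (IsAntisymplectic φ ↔ ¬ IsSquare (LinearMap.det A.toLinearMap)) := by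
  let A : Torsion p E ≃ₗ[ZMod p] Torsion p E := φ.toLinearEquiv.trans (twistTorsion p E he).symm
  have hA : ∀ P, twistTorsion p E he (A P) = φ P := fun P ↦ (twistTorsion p E he).apply_symm_apply _
  have hm : ∀ d : (ZMod p)ˣ, HasMultiplier φ d ↔ LinearMap.det A.toLinearMap = d := by
    intro d
    have h1 : ∀ P Q, weilPairing p (φ P : GeomPoint (quadraticTwist E e))
        (φ Q : GeomPoint (quadraticTwist E e)) = torsionPairing (A P) (A Q) := fun P Q ↦ by
      rw [← torsionPairing_twist hp he, hA, hA]; rfl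
    simp only [HasMultiplier, h1]
    constructor
    · exact fun h ↦ det_eq_of_torsionPairing hp h
    · rintro h P Q
      rw [← h]
      exact torsionPairing_map hp A.toLinearMap P Q
  have hunit : IsUnit (LinearMap.det A.toLinearMap) := A.isUnit_det'
  obtain ⟨u, hu⟩ := hunit
  have hsq : ∀ d : (ZMod p)ˣ, IsSquare d ↔ IsSquare (d : ZMod p) := by
    intro d
    constructor
    · rintro ⟨r, rfl⟩; exact ⟨r, by simp⟩
    · rintro ⟨r, hr⟩
      have hr0 : r ≠ 0 := by rintro rfl; simp at hr
      exact ⟨Units.mk0 r hr0, Units.ext hr⟩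
  refine ⟨A, fun σ P ↦ ?_, ?_, ?_⟩
  · apply (twistTorsion p E he).injective
    change twistTorsion p E he (A (galoisRep p E σ P)) = _
    rw [hA, map_smul]
    have h1 := galoisRep_twist he σ (A P)
    rw [hA] at h1
    change _ = ((quadChar e σ : ℤ) : ZMod p) • twistTorsion p E he (galoisRep p E σ (A P))
    rw [← h1]
    exact LinearMap.congr_fun (φ.isIntertwining' σ) P
  · constructor
    · rintro ⟨d, hd, hd'⟩
      rw [(hm d).mp hd]
      exact (hsq d).mp hd'
    · intro h
      exact ⟨u, (hm u).mpr hu.symm, (hsq u).mpr (hu ▸ h)⟩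
  · constructor
    · rintro ⟨d, hd, hd'⟩
      rw [(hm d).mp hd]
      exact fun h ↦ hd' ((hsq d).mpr h)
    · intro h
      exact ⟨u, (hm u).mpr hu.symm, fun h' ↦ h (hu ▸ (hsq u).mp h')⟩

end TwistTorsion

end EllipticCongruence

end



noncomputable section

namespace EllipticCongruence

open Module TensorProduct

/-! ### Absolutely irreducible planes -/

section Irreducible

variable {k G V : Type*} [Field k] [Group G] [AddCommGroup V] [Module k V]
  {ρ : Representation k G V}

lemma IsAbsolutelyIrreducible.eq_bot_or_eq_top (h : IsAbsolutelyIrreducible ρ)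
    (U : Submodule (AlgebraicClosure k) (AlgebraicClosure k ⊗[k] V))
    (hU : ∀ g, ∀ v ∈ U, (ρ g).baseChange (AlgebraicClosure k) v ∈ U) : U = ⊥ ∨ U = ⊤ := by
  have h' : IsSimpleOrder (Subrepresentation
    (((Module.End.baseChangeHom k (AlgebraicClosure k) V : _ →* _).comp ρ :
      Representation (AlgebraicClosure k) G (AlgebraicClosure k ⊗[k] V)))) := h
  rcases h'.eq_bot_or_eq_top ⟨U, hU⟩ with h1 | h1
  · exact .inl (congrArg Subrepresentation.toSubmodule h1)
  · exact .inr (congrArg Subrepresentation.toSubmodule h1)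

/-- Schur's lemma. -/
lemma IsAbsolutelyIrreducible.exists_eq_smul_one [FiniteDimensional k V] [Nontrivial V]
    (h : IsAbsolutelyIrreducible ρ) (B : V →ₗ[k] V) (hB : ∀ g v, B (ρ g v) = ρ g (B v)) :
    ∃ c : k, ∀ v, B v = c • v := by
  let b := Module.finBasis k V
  let b' := Algebra.TensorProduct.basis (AlgebraicClosure k) b
  have : Nontrivial (AlgebraicClosure k ⊗[k] V) := by
    have : Nonempty (Fin (finrank k V)) := ⟨⟨0, finrank_pos⟩⟩
    exact b'.index_nonempty.elim fun i ↦ ⟨b' i, 0, b'.ne_zero i⟩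
  obtain ⟨μ, hμ⟩ := Module.End.exists_eigenvalue (B.baseChange (AlgebraicClosure k))
  have hcomm : ∀ g v, B.baseChange (AlgebraicClosure k) ((ρ g).baseChange (AlgebraicClosure k) v) =
      (ρ g).baseChange (AlgebraicClosure k) (B.baseChange (AlgebraicClosure k) v) := by
    intro g v
    rw [← LinearMap.comp_apply, ← LinearMap.comp_apply, ← LinearMap.baseChange_comp,
      ← LinearMap.baseChange_comp]
    congr 2
    exact LinearMap.ext (hB g)
  have htop := (h.eq_bot_or_eq_top (Module.End.eigenspace (B.baseChange (AlgebraicClosure k)) μ)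
    fun g v hv ↦ by
      rw [Module.End.mem_eigenspace_iff] at hv ⊢
      rw [hcomm, hv, map_smul]).resolve_left hμ
  have key : ∀ v, (1 : AlgebraicClosure k) ⊗ₜ[k] B v = μ • (1 ⊗ₜ[k] v) := fun v ↦ by
    rw [← LinearMap.baseChange_tmul]
    exact Module.End.mem_eigenspace_iff.mp (htop ▸ Submodule.mem_top)
  have key2 : ∀ v j, algebraMap k (AlgebraicClosure k) (b.repr (B v) j) =
      μ * algebraMap k _ (b.repr v j) := fun v j ↦ by
    have := congrArg (fun x ↦ b'.repr x j) (key v)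
    simpa [b', Algebra.smul_def] using this
  let i₀ : Fin (finrank k V) := ⟨0, finrank_pos⟩
  -- The eigenvalue is a matrix coefficient of B in a basis over k, so it already lies in k.
  have hμc : μ = algebraMap k _ (b.repr (B (b i₀)) i₀) := by rw [key2]; simp
  refine ⟨b.repr (B (b i₀)) i₀, fun v ↦ b.repr.injective (Finsupp.ext fun j ↦ ?_)⟩
  apply (algebraMap k (AlgebraicClosure k)).injective
  rw [key2, hμc, ← map_mul]
  simp

lemma IsAbsolutelyIrreducible.not_stable_line [FiniteDimensional k V] (hV : finrank k V = 2)
    (h : IsAbsolutelyIrreducible ρ) {v : V} (hv : v ≠ 0) : ¬ ∀ g, ∃ c : k, ρ g v = c • v := by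
  intro hs
  have hinj : (1 : AlgebraicClosure k) ⊗ₜ[k] v ≠ 0 := by
    intro h0
    let b := Module.finBasis k V
    apply hv
    refine b.repr.injective (Finsupp.ext fun j ↦ (algebraMap k (AlgebraicClosure k)).injective ?_)
    have := congrArg (fun x ↦ (Algebra.TensorProduct.basis (AlgebraicClosure k) b).repr x j) h0
    simpa [Algebra.smul_def] using this
  rcases h.eq_bot_or_eq_top (Submodule.span _ {(1 : AlgebraicClosure k) ⊗ₜ[k] v})
    (fun g w hw ↦ by
      obtain ⟨a, rfl⟩ := Submodule.mem_span_singleton.mp hw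
      obtain ⟨c, hc⟩ := hs g
      rw [map_smul, LinearMap.baseChange_tmul, hc, TensorProduct.tmul_smul]
      exact Submodule.smul_mem _ _ ((Submodule.smul_of_tower_mem _ c
        (Submodule.mem_span_singleton_self _)))) with h1 | h1
  · rw [Submodule.span_singleton_eq_bot] at h1
    exact hinj h1
  · have h2 : finrank (AlgebraicClosure k) (AlgebraicClosure k ⊗[k] V) = 2 := by
      rw [Module.finrank_baseChange, hV]
    rw [← finrank_top, ← h1, finrank_span_singleton hinj] at h2
    omega

end Irreducible

/-! ### Cartan subgroups -/

section Cartan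

variable {p : ℕ} [Fact p.Prime] {V : Type*} [AddCommGroup V] [Module (ZMod p) V]

lemma commute_diag_iff {M : Matrix (Fin 2) (Fin 2) (ZMod p)} {s t : ZMod p} (hst : s ≠ t) :
    M * !![s, 0; 0, t] = !![s, 0; 0, t] * M ↔ ∃ x y, M = !![x, 0; 0, y] := by
  constructor
  · intro h
    have h01 := congrFun (congrFun h 0) 1
    have h10 := congrFun (congrFun h 1) 0
    simp [Matrix.mul_apply, Fin.sum_univ_two] at h01 h10
    refine ⟨M 0 0, M 1 1, ?_⟩
    have e1 : M 0 1 = 0 := by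
      have : M 0 1 * (t - s) = 0 := by linear_combination h01
      exact (mul_eq_zero.mp this).resolve_right (sub_ne_zero.mpr hst.symm)
    have e2 : M 1 0 = 0 := by
      have : M 1 0 * (s - t) = 0 := by linear_combination h10
      exact (mul_eq_zero.mp this).resolve_right (sub_ne_zero.mpr hst)
    ext i j
    fin_cases i <;> fin_cases j <;> simp [e1, e2]
  · rintro ⟨x, y, rfl⟩
    simp [mul_comm]

lemma commute_nonsplit_iff {M : Matrix (Fin 2) (Fin 2) (ZMod p)} {δ x y : ZMod p} (hδ : δ ≠ 0)
    (hy : y ≠ 0) : M * !![x, δ * y; y, x] = !![x, δ * y; y, x] * M ↔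
      ∃ u w, M = !![u, δ * w; w, u] := by
  constructor
  · intro h
    have h00 := congrFun (congrFun h 0) 0
    have h01 := congrFun (congrFun h 0) 1
    simp [Matrix.mul_apply, Fin.sum_univ_two] at h00 h01
    refine ⟨M 0 0, M 1 0, ?_⟩
    have e1 : M 0 1 = δ * M 1 0 := mul_right_cancel₀ hy (by linear_combination h00)
    have e2 : M 1 1 = M 0 0 := mul_left_cancel₀ (mul_ne_zero hδ hy) (by linear_combination -h01)
    ext i j
    fin_cases i <;> fin_cases j <;> simp [e1, e2]
  · rintro ⟨u, w, rfl⟩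
    ext i j
    fin_cases i <;> fin_cases j <;> simp <;> ring

variable (b : Basis (Fin 2) (ZMod p) V)

lemma mem_centralizer_iff_toMatrix {g h : LinearMap.GeneralLinearGroup (ZMod p) V} :
    g ∈ Subgroup.centralizer {h} ↔
      LinearMap.toMatrix b b (g : V →ₗ[ZMod p] V) * LinearMap.toMatrix b b (h : V →ₗ[ZMod p] V) =
      LinearMap.toMatrix b b (h : V →ₗ[ZMod p] V) * LinearMap.toMatrix b b (g : V →ₗ[ZMod p] V) := by
  rw [Subgroup.mem_centralizer_singleton_iff, ← LinearMap.toMatrix_mul, ← LinearMap.toMatrix_mul,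
    (LinearMap.toMatrix b b).injective.eq_iff, ← Units.val_mul, ← Units.val_mul, Units.val_inj]

/-- An endomorphism given by a multiplication. -/
def IsScalar (g : V →ₗ[ZMod p] V) : Prop := ∃ c : ZMod p, ∀ v, g v = c • v

lemma isScalar_of_toMatrix {g : V →ₗ[ZMod p] V} {x : ZMod p}
    (h : LinearMap.toMatrix b b g = !![x, 0; 0, x]) : IsScalar g := by
  refine ⟨x, fun v ↦ ?_⟩
  have : g = x • LinearMap.id := by
    apply (LinearMap.toMatrix b b).injective
    rw [h, map_smul, LinearMap.toMatrix_id]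
    ext i j
    fin_cases i <;> fin_cases j <;> simp
  rw [this]; rfl

/-- A Cartan subgroup is the centralizer of each of its nonscalar elements. -/
lemma eq_centralizer {C : Subgroup (LinearMap.GeneralLinearGroup (ZMod p) V)}
    (hC : IsSplitCartan C ∨ IsNonsplitCartan C) {h : LinearMap.GeneralLinearGroup (ZMod p) V}
    (hh : h ∈ C) (hs : ¬ IsScalar (h : V →ₗ[ZMod p] V)) : C = Subgroup.centralizer {h} := by
  rcases hC with ⟨b, hb⟩ | ⟨b, δ, hδ, hb⟩
  · obtain ⟨x, y, hxy⟩ := (hb h).mp hh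
    have hne : x ≠ y := by
      rintro rfl
      exact hs (isScalar_of_toMatrix b hxy)
    ext g
    rw [hb, mem_centralizer_iff_toMatrix b, hxy, commute_diag_iff hne]
  · obtain ⟨x, y, hxy⟩ := (hb h).mp hh
    have hy : y ≠ 0 := by
      rintro rfl
      rw [mul_zero] at hxy
      exact hs (isScalar_of_toMatrix b hxy)
    have hδ0 : δ ≠ 0 := by rintro rfl; exact hδ (IsSquare.zero)
    ext g
    rw [hb, mem_centralizer_iff_toMatrix b, hxy, commute_nonsplit_iff hδ0 hy]

lemma trace_eq (g : V →ₗ[ZMod p] V) : LinearMap.trace (ZMod p) V g =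
    LinearMap.toMatrix b b g 0 0 + LinearMap.toMatrix b b g 1 1 := by
  rw [LinearMap.trace_eq_matrix_trace _ b, Matrix.trace_fin_two]

lemma det_eq (g : V →ₗ[ZMod p] V) : LinearMap.det g =
    LinearMap.toMatrix b b g 0 0 * LinearMap.toMatrix b b g 1 1 -
      LinearMap.toMatrix b b g 0 1 * LinearMap.toMatrix b b g 1 0 := by
  rw [← LinearMap.det_toMatrix b, Matrix.det_fin_two]

/-- Cayley–Hamilton. The eigenvalues are the square roots of −det A, which is why −det A decides the
type of the centralizer. -/
lemma apply_apply_of_trace_eq_zero (hV : finrank (ZMod p) V = 2) {A : V →ₗ[ZMod p] V}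
    (hA : LinearMap.trace (ZMod p) V A = 0) (v : V) : A (A v) = -LinearMap.det A • v := by
  have : Module.Finite (ZMod p) V := Module.finite_of_finrank_pos (by omega)
  let b := Module.finBasisOfFinrankEq (ZMod p) V hV
  have h : A * A = -LinearMap.det A • (1 : V →ₗ[ZMod p] V) := by
    apply (LinearMap.toMatrix b b).injective
    rw [LinearMap.toMatrix_mul, map_smul, LinearMap.toMatrix_one, det_eq b]
    rw [trace_eq b] at hA
    set M := LinearMap.toMatrix b b A
    have e1 : M 1 1 = -M 0 0 := by linear_combination hA
    ext i j
    fin_cases i <;> fin_cases j <;> simp [Matrix.mul_apply, Fin.sum_univ_two, e1] <;> ring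
  exact LinearMap.congr_fun h v

variable {A : LinearMap.GeneralLinearGroup (ZMod p) V}

lemma two_ne_zero_zmod (hp : p ≠ 2) : (2 : ZMod p) ≠ 0 := by
  have hp' : p.Prime := Fact.out
  intro h
  have h1 : ((2 : ℕ) : ZMod p) = 0 := by exact_mod_cast h
  rw [ZMod.natCast_eq_zero_iff] at h1
  exact hp ((Nat.prime_dvd_prime_iff_eq hp' Nat.prime_two).mp h1)

lemma det_val_ne_zero : LinearMap.det (A : V →ₗ[ZMod p] V) ≠ 0 :=
  (A.isUnit.map (LinearMap.det (M := V) (A := ZMod p))).ne_zero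

/-- If −det A = s², then A v + s v and A w − s w are eigenvectors for s and −s. They can be chosen
nonzero, because a nonzero scalar does not have trace zero. -/
lemma isSplitCartan_centralizer (hp : p ≠ 2) (hV : finrank (ZMod p) V = 2)
    (hA : LinearMap.trace (ZMod p) V (A : V →ₗ[ZMod p] V) = 0)
    (hsq : IsSquare (-LinearMap.det (A : V →ₗ[ZMod p] V))) :
    IsSplitCartan (Subgroup.centralizer {A}) := by
  have hfin : Module.Finite (ZMod p) V := Module.finite_of_finrank_pos (by omega)
  have h2 := two_ne_zero_zmod hp
  have hAA := apply_apply_of_trace_eq_zero hV hA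
  have hdet := det_val_ne_zero (A := A)
  set B : V →ₗ[ZMod p] V := (A : V →ₗ[ZMod p] V) with hB
  obtain ⟨s, hs⟩ := hsq
  have hs0 : s ≠ 0 := by
    rintro rfl
    exact hdet (by linear_combination -hs)
  -- `B` is not a scalar
  have hns : ∀ c : ZMod p, c ≠ 0 → ∃ v, B v + c • v ≠ 0 := by
    intro c hc
    by_contra! hall
    have h1 : B = -c • LinearMap.id := LinearMap.ext fun v ↦ by
      rw [LinearMap.smul_apply, LinearMap.id_apply, neg_smul]
      exact eq_neg_of_add_eq_zero_left (hall v)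
    rw [h1, map_smul, LinearMap.trace_id, hV, smul_eq_mul] at hA
    push_cast at hA
    exact mul_ne_zero (neg_ne_zero.mpr hc) h2 hA
  obtain ⟨v, hv⟩ := hns s hs0
  obtain ⟨w, hw⟩ := hns (-s) (neg_ne_zero.mpr hs0)
  have hBv : B (B v + s • v) = s • (B v + s • v) := by
    rw [map_add, hAA, map_smul, hs, smul_add, smul_smul, add_comm]
  have hBw : B (B w + -s • w) = -s • (B w + -s • w) := by
    rw [map_add, hAA, map_smul, hs, smul_add, smul_smul, add_comm, neg_mul_neg]
  set v' := B v + s • v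
  set w' := B w + -s • w
  have hli : LinearIndependent (ZMod p) ![v', w'] := by
    rw [LinearIndependent.pair_iff]
    intro x y hxy
    have h1 := congrArg B hxy
    rw [map_add, map_smul, map_smul, hBv, hBw, map_zero] at h1
    have h3 : (2 * s * x) • v' = 0 := by
      have : (2 * s * x) • v' = (x • s • v' + y • -s • w') + s • (x • v' + y • w') := by
        module
      rw [this, h1, hxy, smul_zero, add_zero]
    have hx : x = 0 := by
      have := (smul_eq_zero.mp h3).resolve_right hv
      simpa [h2, hs0] using this
    rw [hx, zero_smul, zero_add] at hxy
    exact ⟨hx, (smul_eq_zero.mp hxy).resolve_right hw⟩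
  let b := basisOfLinearIndependentOfCardEqFinrank hli (by rw [hV, Fintype.card_fin])
  have hb0 : b 0 = v' := by simp [b]
  have hb1 : b 1 = w' := by simp [b]
  have hM : LinearMap.toMatrix b b B = !![s, 0; 0, -s] := by
    ext i j
    rw [LinearMap.toMatrix_apply]
    fin_cases j
    · change b.repr (B (b 0)) i = _
      rw [hb0, hBv, ← hb0, map_smul, b.repr_self]
      fin_cases i <;> simp
    · change b.repr (B (b 1)) i = _
      rw [hb1, hBw, ← hb1, map_smul, b.repr_self]
      fin_cases i <;> simp
  refine ⟨b, fun g ↦ ?_⟩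
  rw [mem_centralizer_iff_toMatrix b, ← hB, hM, commute_diag_iff]
  intro h
  have : 2 * s = 0 := by linear_combination h
  exact mul_ne_zero h2 hs0 this

/-- A has no eigenvector, so v, A v is a basis for any v ≠ 0. In it A is multiplication by √δ with δ
= −det A. -/
lemma isNonsplitCartan_centralizer (hV : finrank (ZMod p) V = 2)
    (hA : LinearMap.trace (ZMod p) V (A : V →ₗ[ZMod p] V) = 0)
    (hsq : ¬ IsSquare (-LinearMap.det (A : V →ₗ[ZMod p] V))) :
    IsNonsplitCartan (Subgroup.centralizer {A}) := by
  have hfin : Module.Finite (ZMod p) V := Module.finite_of_finrank_pos (by omega)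
  have : Nontrivial V := Module.nontrivial_of_finrank_pos (R := ZMod p) (by omega)
  have hAA := apply_apply_of_trace_eq_zero hV hA
  set B : V →ₗ[ZMod p] V := (A : V →ₗ[ZMod p] V) with hB
  set a := -LinearMap.det B
  obtain ⟨v, hv⟩ := exists_ne (0 : V)
  have hli : LinearIndependent (ZMod p) ![v, B v] := by
    rw [LinearIndependent.pair_iff]
    intro x y hxy
    have hy : y = 0 := by
      by_contra hy
      have h1 : B v = (-(x / y)) • v := by
        have h2 : y • B v = -x • v := by
          rw [neg_smul]; exact eq_neg_of_add_eq_zero_right hxy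
        have h3 := congrArg (y⁻¹ • ·) h2
        simp only [smul_smul, inv_mul_cancel₀ hy, one_smul] at h3
        rw [h3]; congr 1; field_simp
      have h2 := hAA v
      rw [h1, map_smul, h1, smul_smul] at h2
      exact hsq ⟨_, (smul_left_injective (ZMod p) hv h2).symm⟩
    rw [hy, zero_smul, add_zero] at hxy
    exact ⟨(smul_eq_zero.mp hxy).resolve_right hv, hy⟩
  let b := basisOfLinearIndependentOfCardEqFinrank hli (by rw [hV, Fintype.card_fin])
  have hb0 : b 0 = v := by simp [b]
  have hb1 : b 1 = B v := by simp [b]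
  have hM : LinearMap.toMatrix b b B = !![0, a * 1; 1, 0] := by
    ext i j
    rw [LinearMap.toMatrix_apply]
    fin_cases j
    · change b.repr (B (b 0)) i = _
      rw [hb0, ← hb1, b.repr_self]
      fin_cases i <;> simp
    · change b.repr (B (b 1)) i = _
      rw [hb1, hAA, ← hb0, map_smul, b.repr_self]
      fin_cases i <;> simp
  have ha : a ≠ 0 := by
    intro h; rw [h] at hsq; exact hsq IsSquare.zero
  refine ⟨b, a, hsq, fun g ↦ ?_⟩
  rw [mem_centralizer_iff_toMatrix b, ← hB, hM, commute_nonsplit_iff ha one_ne_zero]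

lemma isSquare_of_isSplitCartan {C : Subgroup (LinearMap.GeneralLinearGroup (ZMod p) V)}
    (hC : IsSplitCartan C) (hAC : A ∈ C)
    (hA : LinearMap.trace (ZMod p) V (A : V →ₗ[ZMod p] V) = 0) :
    IsSquare (-LinearMap.det (A : V →ₗ[ZMod p] V)) := by
  obtain ⟨b, hb⟩ := hC
  obtain ⟨x, y, hxy⟩ := (hb A).mp hAC
  rw [trace_eq b, hxy] at hA
  rw [det_eq b, hxy]
  simp at hA ⊢
  exact ⟨x, by linear_combination -x * hA⟩

lemma not_isSquare_of_isNonsplitCartan (hp : p ≠ 2)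
    {C : Subgroup (LinearMap.GeneralLinearGroup (ZMod p) V)}
    (hC : IsNonsplitCartan C) (hAC : A ∈ C)
    (hA : LinearMap.trace (ZMod p) V (A : V →ₗ[ZMod p] V) = 0) :
    ¬ IsSquare (-LinearMap.det (A : V →ₗ[ZMod p] V)) := by
  obtain ⟨b, δ, hδ, hb⟩ := hC
  obtain ⟨x, y, hxy⟩ := (hb A).mp hAC
  have hdet := det_val_ne_zero (A := A)
  rw [trace_eq b, hxy] at hA
  rw [det_eq b, hxy] at hdet ⊢
  simp at hA hdet ⊢
  have hx : x = 0 := (mul_eq_zero.mp (by linear_combination hA : 2 * x = 0)).resolve_left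
    (two_ne_zero_zmod hp)
  subst hx
  rintro ⟨s, hs⟩
  have hy : y ≠ 0 := by rintro rfl; simp at hdet
  exact hδ ⟨s / y, by field_simp; linear_combination hs⟩

end Cartan

end EllipticCongruence

end



noncomputable section

namespace EllipticCongruence

open WeierstrassCurve WeierstrassCurve.Affine Polynomial Filter
open scoped Polynomial.Bivariate

/-! ### Quadratic characters of the absolute Galois group -/

section QuadraticCharacters

variable {K : Type*} [Field K] [CharZero K]

lemma isSquare_iff_forall_quadChar {e : K} : IsSquare e ↔ ∀ σ, quadChar e σ = 1 := by
  constructor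
  · rintro ⟨r, rfl⟩ σ
    exact (quadChar_eq_one_iff (δ := algebraMap K _ r) (by rw [← map_pow, sq]) σ).mpr
      (AlgEquiv.commutes _ _)
  · intro h
    obtain ⟨r, hr⟩ := (InfiniteGalois.mem_range_algebraMap_iff_fixed (k := K) (sqrtClosure e)).mpr
      fun σ ↦ (quadChar_eq_one_iff (sqrtClosure_sq e) σ).mp (h σ)
    refine ⟨r, (algebraMap K (AlgebraicClosure K)).injective ?_⟩
    rw [← sqrtClosure_sq, ← hr, map_mul, sq]

lemma quadChar_mul {e D : K} (he : e ≠ 0) (hD : D ≠ 0) (σ : Gal(AlgebraicClosure K/K)) :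
    quadChar (e * D) σ = quadChar e σ * quadChar D σ := by
  have h := quadChar_spec (e := e * D) (δ := sqrtClosure e * sqrtClosure D)
    (by rw [mul_pow, sqrtClosure_sq, sqrtClosure_sq, map_mul]) σ
  rw [map_mul, quadChar_spec (sqrtClosure_sq e), quadChar_spec (sqrtClosure_sq D), mul_mul_mul_comm]
    at h
  have h1 := mul_right_cancel₀ (mul_ne_zero (sqrtClosure_ne_zero he) (sqrtClosure_ne_zero hD)) h
  rw [← Int.cast_mul, Int.cast_inj] at h1
  exact Units.ext (by rw [Units.val_mul, h1])

lemma isSquare_mul_iff_quadChar_eq {e D : K} (he : e ≠ 0) (hD : D ≠ 0) :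
    IsSquare (e * D) ↔ quadChar e = quadChar D := by
  rw [isSquare_iff_forall_quadChar, funext_iff]
  refine forall_congr' fun σ ↦ ?_
  rw [quadChar_mul he hD]
  rcases Int.units_eq_one_or (quadChar e σ) with h | h <;>
    rcases Int.units_eq_one_or (quadChar D σ) with h' | h' <;> rw [h, h'] <;> decide

lemma exists_quadChar_eq_neg_one {e : K} (he : ¬ IsSquare e) : ∃ σ, quadChar e σ = -1 := by
  rw [isSquare_iff_forall_quadChar] at he
  push Not at he
  exact he.imp fun σ h ↦ (Int.units_eq_one_or _).resolve_left h

lemma mem_galSqrt_iff {e : K} {σ : Gal(AlgebraicClosure K/K)} :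
    σ ∈ galSqrt e ↔ quadChar e σ = 1 := by
  rw [quadChar_eq_one_iff (sqrtClosure_sq e), galSqrt, IntermediateField.mem_fixingSubgroup_iff]
  constructor
  · exact fun h ↦ h _ (IntermediateField.subset_adjoin K _ (sqrtClosure_sq e))
  · intro h
    have hle : IntermediateField.adjoin K
        {r : AlgebraicClosure K | r ^ 2 = algebraMap K (AlgebraicClosure K) e} ≤
        IntermediateField.fixedField (Subgroup.zpowers σ) := by
      rw [IntermediateField.adjoin_le_iff]
      intro r hr
      rw [SetLike.mem_coe, IntermediateField.mem_fixedField_iff]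
      have h1 : σ r = r :=
        (quadChar_eq_one_iff hr σ).mp ((quadChar_eq_one_iff (sqrtClosure_sq e) σ).mpr h)
      have h2 : Subgroup.zpowers σ ≤ MulAction.stabilizer _ r := by
        rw [Subgroup.zpowers_le]; exact h1
      exact fun f hf ↦ h2 hf
    intro x hx
    exact (IntermediateField.mem_fixedField_iff _ _).mp (hle hx) σ (Subgroup.mem_zpowers σ)

/-- Every quadratic character with open kernel is the character of a quadratic extension. -/
lemma exists_eq_quadChar (χ : Gal(AlgebraicClosure K/K) →* ℤˣ)
    (hχ : IsOpen (χ.ker : Set Gal(AlgebraicClosure K/K))) : ∃ D : K, D ≠ 0 ∧ ⇑χ = quadChar D := by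
  by_cases htriv : ∀ σ, χ σ = 1
  · exact ⟨1, one_ne_zero, funext fun σ ↦ by
      rw [htriv, isSquare_iff_forall_quadChar.mp (IsSquare.one) σ]⟩
  push Not at htriv
  obtain ⟨τ, hτ⟩ := htriv
  let N : ClosedSubgroup Gal(AlgebraicClosure K/K) :=
    ⟨χ.ker, Subgroup.isClosed_of_isOpen _ hχ⟩
  have hN := InfiniteGalois.fixingSubgroup_fixedField N
  have hτN : τ ∉ (IntermediateField.fixedField N.1).fixingSubgroup := by
    rw [hN]; exact hτ
  rw [IntermediateField.mem_fixingSubgroup_iff] at hτN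
  push Not at hτN
  obtain ⟨x, hx, hne⟩ := hτN
  rw [IntermediateField.mem_fixedField_iff] at hx
  have hτ' := (Int.units_eq_one_or _).resolve_left hτ
  have h1 : ∀ σ, χ σ = 1 → σ x = x := hx
  have h2 : ∀ σ, χ σ = -1 → σ x = τ x := by
    intro σ hσ
    have h3 := h1 (τ⁻¹ * σ) (by rw [map_mul, map_inv, hσ, hτ']; decide)
    rw [AlgEquiv.mul_apply] at h3
    have := congrArg τ h3
    rwa [← AlgEquiv.mul_apply, mul_inv_cancel, AlgEquiv.one_apply] at this
  -- Kummer theory by hand: x is fixed by the kernel of χ but not by τ, so x − τ x is a nonzero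
  -- eigenvector for χ. Its square is the required D.
  have h4 : ∀ σ, σ (x - τ x) = ((χ σ : ℤ) : AlgebraicClosure K) * (x - τ x) := by
    intro σ
    rcases Int.units_eq_one_or (χ σ) with h | h
    · have h5 := h2 (σ * τ) (by rw [map_mul, h, hτ', one_mul])
      rw [AlgEquiv.mul_apply] at h5
      rw [map_sub, h1 σ h, h5, h]; simp
    · have h5 := h1 (σ * τ) (by rw [map_mul, h, hτ']; decide)
      rw [AlgEquiv.mul_apply] at h5
      rw [map_sub, h2 σ h, h5, h]; simp
  obtain ⟨D, hD⟩ := (InfiniteGalois.mem_range_algebraMap_iff_fixed (k := K) ((x - τ x) ^ 2)).mpr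
    fun σ ↦ by
      rw [map_pow, h4, mul_pow, ← Int.cast_pow, ← Units.val_pow_eq_pow_val, Int.units_sq]; simp
  have hθ : x - τ x ≠ 0 := sub_ne_zero.mpr (Ne.symm hne)
  refine ⟨D, fun h0 ↦ ?_, funext fun σ ↦ ?_⟩
  · rw [h0, map_zero, eq_comm] at hD
    exact hθ (pow_eq_zero_iff two_ne_zero |>.mp hD)
  · have h5 := quadChar_spec hD.symm σ
    rw [h4] at h5
    have h6 := mul_right_cancel₀ hθ h5
    exact Units.ext (by exact_mod_cast h6)

variable {p : ℕ} [hpp : Fact p.Prime]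

lemma pStar_ne_zero : (pStar p : K) ≠ 0 := by
  rw [pStar]
  push_cast
  exact mul_ne_zero (pow_ne_zero _ (by simp)) (by exact_mod_cast hpp.out.ne_zero)

lemma quadraticChar_neg_one_zmod (hp : p ≠ 2) :
    quadraticChar (ZMod p) (-1) = (-1) ^ ((p - 1) / 2) := by
  have h2 : p % 2 = 1 := hpp.out.eq_two_or_odd.resolve_left hp
  rw [quadraticChar_neg_one (by rwa [ZMod.ringChar_zmod_n]), ZMod.card,
    ZMod.χ₄_eq_neg_one_pow h2]
  congr 1
  omega

variable [DecidableEq (AlgebraicClosure K)] {E : WeierstrassCurve K} [E.IsElliptic]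

/-- The quadratic character of `K(√p*)` is the quadratic residue symbol of the determinant. -/
lemma quadChar_pStar_eq_one_iff (hp : p ≠ 2) (σ : Gal(AlgebraicClosure K/K)) :
    quadChar (pStar p : K) σ = 1 ↔ IsSquare (LinearMap.det (galoisRep p E σ)) := by
  obtain ⟨ζ, hζ, hζ1, hσ⟩ := exists_root_galois (E := E) hp
  have hprim : IsPrimitiveRoot ζ p := IsPrimitiveRoot.of_map_of_injective
    (f := MonoidHom.id _) (orderOf_eq_prime hζ hζ1 ▸ IsPrimitiveRoot.orderOf ζ)
    Function.injective_id
  let ψ : AddChar (ZMod p) (AlgebraicClosure K) := AddChar.zmodChar p hζ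
  have hψ : ψ.IsPrimitive := AddChar.zmodChar_primitive_of_primitive_root p hprim
  let χ : MulChar (ZMod p) (AlgebraicClosure K) :=
    (quadraticChar (ZMod p)).ringHomComp (Int.castRingHom _)
  have hχ2 : χ.IsQuadratic := (quadraticChar_isQuadratic (ZMod p)).comp _
  have hχ1 : χ ≠ 1 := by
    rw [MulChar.ringHomComp_ne_one_iff (RingHom.injective_int _)]
    exact quadraticChar_ne_one (by rwa [ZMod.ringChar_zmod_n])
  -- The quadratic Gauss sum is a square root of p*. Since σ raises ζ to the power det ρ(σ), it
  -- multiplies the sum by the quadratic symbol of det ρ(σ).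
  have hsq := gaussSum_sq hχ1 hχ2 hψ
  have hsq' : gaussSum χ ψ ^ 2 = algebraMap K _ (pStar p : K) := by
    rw [hsq, ZMod.card, MulChar.ringHomComp_apply, quadraticChar_neg_one_zmod hp, pStar]
    simp
  have hg0 : gaussSum χ ψ ≠ 0 := by
    intro h0
    rw [h0, zero_pow two_ne_zero, eq_comm, map_eq_zero] at hsq'
    exact pStar_ne_zero hsq'
  have hu0 : LinearMap.det (galoisRep p E σ) ≠ 0 :=
    det_val_ne_zero (A := rho p E σ)
  set u := Units.mk0 _ hu0 with hu
  have hmap : σ (gaussSum χ ψ) = gaussSum χ (ψ.mulShift u) := by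
    rw [gaussSum, gaussSum, map_sum]
    refine Finset.sum_congr rfl fun a _ ↦ ?_
    rw [map_mul, MulChar.ringHomComp_apply, eq_intCast, map_intCast, AddChar.mulShift_apply,
      AddChar.zmodChar_apply, AddChar.zmodChar_apply, map_pow, hσ, ← pow_val_mul hζ]
    rfl
  have hshift := gaussSum_mulShift χ ψ u
  rw [← hmap] at hshift
  rw [quadChar_eq_one_iff hsq', ← quadraticChar_one_iff_isSquare hu0]
  have hval : χ u = ((quadraticChar (ZMod p) (LinearMap.det (galoisRep p E σ)) : ℤ) :
    AlgebraicClosure K) := rfl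
  rw [hval] at hshift
  constructor
  · intro h
    rw [h] at hshift
    have := (mul_eq_right₀ hg0).mp hshift
    exact_mod_cast this
  · intro h
    rwa [h, Int.cast_one, one_mul] at hshift

/-- The kernel of ρ contains the automorphisms fixing the finitely many coordinates of p-torsion
points. Openness is what allows characters of the image to be written as characters of quadratic
extensions. -/
lemma isOpen_of_ker_le {N : Subgroup Gal(AlgebraicClosure K/K)}
    (hN : ∀ σ, galoisRep p E σ = 1 → σ ∈ N) : IsOpen (N : Set Gal(AlgebraicClosure K/K)) := by
  let S : Set (AlgebraicClosure K) :=
    Set.range (fun P : Torsion p E ↦ xCoord (P : GeomPoint E)) ∪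
    Set.range (fun P : Torsion p E ↦ yCoord (P : GeomPoint E))
  have hS : S.Finite := (Set.finite_range _).union (Set.finite_range _)
  have : Finite S := hS
  have : FiniteDimensional K (IntermediateField.adjoin K S) :=
    IntermediateField.finiteDimensional_adjoin fun x _ ↦ Algebra.IsIntegral.isIntegral x
  refine Subgroup.isOpen_mono (H₁ := (IntermediateField.adjoin K S).fixingSubgroup) ?_
    (IntermediateField.fixingSubgroup_isOpen _)
  intro σ hσ
  rw [IntermediateField.mem_fixingSubgroup_iff] at hσ
  refine hN σ (LinearMap.ext fun P ↦ Subtype.ext ?_)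
  change Point.map (W' := E) σ.toAlgHom (P : GeomPoint E) = P
  have hx : σ (xCoord (P : GeomPoint E)) = xCoord (P : GeomPoint E) :=
    hσ _ (IntermediateField.subset_adjoin K _ (Or.inl ⟨P, rfl⟩))
  have hy : σ (yCoord (P : GeomPoint E)) = yCoord (P : GeomPoint E) :=
    hσ _ (IntermediateField.subset_adjoin K _ (Or.inr ⟨P, rfl⟩))
  by_cases h0 : (P : GeomPoint E) = 0
  · rw [h0, map_zero]
  · refine ext_coord (map_point_ne_zero σ h0) h0 ?_ ?_
    · rw [xCoord_map, hx]
    · rw [yCoord_map, hy]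

end QuadraticCharacters

end EllipticCongruence

end



noncomputable section

namespace EllipticCongruence

open Module

/-! ### The Cartan subgroup attached to a congruence with a quadratic twist -/

section TwistedCommutant

variable {p : ℕ} [hpp : Fact p.Prime]

lemma isSquare_mul_iff_of_ne_zero {a b : ZMod p} (ha : a ≠ 0) (hb : b ≠ 0) :
    IsSquare (a * b) ↔ (IsSquare a ↔ IsSquare b) := by
  rw [← quadraticChar_one_iff_isSquare (mul_ne_zero ha hb), ← quadraticChar_one_iff_isSquare ha,
    ← quadraticChar_one_iff_isSquare hb, map_mul]
  rcases quadraticChar_dichotomy ha with h | h <;> rcases quadraticChar_dichotomy hb with h' | h' <;>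
    rw [h, h'] <;> decide

lemma isSquare_neg_iff (hp : p ≠ 2) {a : ZMod p} (ha : a ≠ 0) :
    IsSquare (-a) ↔ (p % 4 = 1 ↔ IsSquare a) := by
  rw [← neg_one_mul, isSquare_mul_iff_of_ne_zero (neg_ne_zero.mpr one_ne_zero) ha,
    ZMod.exists_sq_eq_neg_one_iff]
  have h2 : p % 2 = 1 := hpp.out.eq_two_or_odd.resolve_left hp
  have : p % 4 ≠ 3 ↔ p % 4 = 1 := by omega
  rw [this]

variable {G V : Type*} [Group G] [AddCommGroup V] [Module (ZMod p) V]
  {ρ : Representation (ZMod p) G V} {χ : G → ℤˣ}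

lemma rep_apply_ne_zero (σ : G) {v : V} (hv : v ≠ 0) : ρ σ v ≠ 0 := fun h ↦ hv (by
  have h1 := congrArg (ρ σ⁻¹) h
  rwa [← Module.End.mul_apply, ← map_mul, inv_mul_cancel, map_one, map_zero,
    Module.End.one_apply] at h1)

/-- Where χ = −1, conjugation by ρ(σ) turns A into −A. -/
lemma TwistCommutes.trace_eq_zero (hp : p ≠ 2) {A : V →ₗ[ZMod p] V} (hA : TwistCommutes ρ χ A)
    {σ : G} (hσ : χ σ = -1) : LinearMap.trace (ZMod p) V A = 0 := by
  have h1 : A = -(ρ σ * (A * ρ σ⁻¹)) := by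
    ext v
    have h2 := hA σ (ρ σ⁻¹ v)
    rw [← Module.End.mul_apply (ρ σ), ← map_mul, mul_inv_cancel, map_one, Module.End.one_apply,
      hσ] at h2
    simpa using h2
  have h3 := congrArg (LinearMap.trace (ZMod p) V) h1
  rw [map_neg, LinearMap.trace_mul_comm, mul_assoc, ← map_mul, inv_mul_cancel, map_one, mul_one,
    eq_neg_iff_add_eq_zero, ← two_mul] at h3
  exact (mul_eq_zero.mp h3).resolve_left (two_ne_zero_zmod hp)

variable {a : LinearMap.GeneralLinearGroup (ZMod p) V}

lemma TwistCommutes.mul_eq (ha : TwistCommutes ρ χ (a : V →ₗ[ZMod p] V)) (σ : G) :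
    (χ σ = 1 → a * MonoidHom.toHomUnits ρ σ = MonoidHom.toHomUnits ρ σ * a) ∧
    (χ σ = -1 → a * MonoidHom.toHomUnits ρ σ = -(MonoidHom.toHomUnits ρ σ * a)) := by
  refine ⟨fun h ↦ Units.ext (LinearMap.ext fun v ↦ ?_),
    fun h ↦ Units.ext (LinearMap.ext fun v ↦ ?_)⟩
  · have := ha σ v
    rw [h] at this
    simpa using this
  · have := ha σ v
    rw [h] at this
    simpa using this

lemma exists_not_isScalar (hV : finrank (ZMod p) V = 2) (hρ : IsAbsolutelyIrreducible ρ) :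
    ∃ σ, ¬ IsScalar (ρ σ) := by
  have : Module.Finite (ZMod p) V := Module.finite_of_finrank_pos (by omega)
  have : Nontrivial V := Module.nontrivial_of_finrank_pos (R := ZMod p) (by omega)
  by_contra! h
  obtain ⟨v, hv⟩ := exists_ne (0 : V)
  exact hρ.not_stable_line hV hv fun σ ↦ (h σ).imp fun c hc ↦ hc v

lemma not_isScalar_of_twistCommutes (hp : p ≠ 2) (hV : finrank (ZMod p) V = 2)
    (ha : TwistCommutes ρ χ (a : V →ₗ[ZMod p] V)) {σ : G} (hσ : χ σ = -1) :
    ¬ IsScalar (ρ σ) := by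
  have : Nontrivial V := Module.nontrivial_of_finrank_pos (R := ZMod p) (by omega)
  rintro ⟨c, hc⟩
  obtain ⟨v, hv⟩ := exists_ne (0 : V)
  have h := ha σ v
  rw [hc, map_smul, hc, hσ] at h
  have hav : (a : V →ₗ[ZMod p] V) v ≠ 0 := fun h0 ↦ hv
    ((LinearMap.GeneralLinearGroup.toLinearEquiv a).injective (by rw [map_zero]; exact h0))
  have hc0 : c ≠ 0 := by
    rintro rfl
    exact rep_apply_ne_zero σ hv (by rw [hc, zero_smul])
  rw [Units.val_neg, Units.val_one, Int.cast_neg, Int.cast_one, neg_one_smul,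
    eq_neg_iff_add_eq_zero, ← two_smul (ZMod p), smul_smul] at h
  exact (smul_ne_zero (mul_ne_zero (two_ne_zero_zmod hp) hc0) hav) h

/-- If ρ(ker χ) were scalar, the image would consist of scalars and scalar multiples of ρ(τ). It
would be commutative, so ρ(τ) would be scalar by Schur's lemma, and then everything. -/
lemma exists_not_isScalar_of_eq_one (hV : finrank (ZMod p) V = 2)
    (hρ : IsAbsolutelyIrreducible ρ) (hχ : ∀ σ τ, χ (σ * τ) = χ σ * χ τ)
    {τ : G} (hτ : χ τ = -1) :
    ∃ σ, χ σ = 1 ∧ ¬ IsScalar (ρ σ) := by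
  have : Module.Finite (ZMod p) V := Module.finite_of_finrank_pos (by omega)
  have : Nontrivial V := Module.nontrivial_of_finrank_pos (R := ZMod p) (by omega)
  by_contra! h
  have key : ∀ σ, χ σ = -1 → ∃ c : ZMod p, ∀ v, ρ σ v = c • ρ τ v := by
    intro σ hσ
    have h1 : χ 1 = 1 := by simpa using hχ 1 1
    have h2 : χ τ⁻¹ = -1 := by
      have := hχ τ τ⁻¹
      rw [mul_inv_cancel, h1, hτ] at this
      rcases Int.units_eq_one_or (χ τ⁻¹) with h' | h'
      · rw [h'] at this; exact absurd this (by decide)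
      · exact h'
    obtain ⟨c, hc⟩ := h (σ * τ⁻¹) (by rw [hχ, hσ, h2]; decide)
    refine ⟨c, fun v ↦ ?_⟩
    rw [← hc, ← Module.End.mul_apply, ← map_mul, inv_mul_cancel_right]
  obtain ⟨c, hc⟩ := hρ.exists_eq_smul_one (ρ τ) fun σ v ↦ by
    rcases Int.units_eq_one_or (χ σ) with h' | h'
    · obtain ⟨c, hc⟩ := h σ h'
      rw [hc, hc, map_smul]
    · obtain ⟨c, hc⟩ := key σ h'
      rw [hc, hc, map_smul]
  obtain ⟨σ, hσ⟩ := exists_not_isScalar hV hρ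
  rcases Int.units_eq_one_or (χ σ) with h' | h'
  · exact hσ (h σ h')
  · obtain ⟨c', hc'⟩ := key σ h'
    exact hσ ⟨c' * c, fun v ↦ by rw [hc', hc, smul_smul]⟩

lemma isCartan_centralizer (hp : p ≠ 2) (hV : finrank (ZMod p) V = 2)
    (ha : LinearMap.trace (ZMod p) V (a : V →ₗ[ZMod p] V) = 0) :
    IsSplitCartan (Subgroup.centralizer {a}) ∨ IsNonsplitCartan (Subgroup.centralizer {a}) := by
  by_cases h : IsSquare (-LinearMap.det (a : V →ₗ[ZMod p] V))
  · exact .inl (isSplitCartan_centralizer hp hV ha h)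
  · exact .inr (isNonsplitCartan_centralizer hV ha h)

lemma mem_centralizer_iff_of_twistCommutes (hp : p ≠ 2) (hV : finrank (ZMod p) V = 2)
    (ha : TwistCommutes ρ χ (a : V →ₗ[ZMod p] V)) (σ : G) :
    MonoidHom.toHomUnits ρ σ ∈ Subgroup.centralizer {a} ↔ χ σ = 1 := by
  have : Nontrivial V := Module.nontrivial_of_finrank_pos (R := ZMod p) (by omega)
  rw [Subgroup.mem_centralizer_singleton_iff]
  constructor
  · intro h
    refine (Int.units_eq_one_or (χ σ)).resolve_right fun h1 ↦ ?_
    have h2 := (ha.mul_eq σ).2 h1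
    rw [h] at h2
    obtain ⟨v, hv⟩ := exists_ne (0 : V)
    have h3 := congrArg (fun g : LinearMap.GeneralLinearGroup (ZMod p) V ↦
      (g : V →ₗ[ZMod p] V) v) h2
    have h4 : (a : V →ₗ[ZMod p] V) (ρ σ v) = -(a : V →ₗ[ZMod p] V) (ρ σ v) := by
      rw [← h] at h3
      exact (congrArg (fun g : LinearMap.GeneralLinearGroup (ZMod p) V ↦
        (g : V →ₗ[ZMod p] V) v) h).symm.trans (h3.trans (congrArg
        (fun g : LinearMap.GeneralLinearGroup (ZMod p) V ↦ -(g : V →ₗ[ZMod p] V) v) h))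
    rw [eq_neg_iff_add_eq_zero, ← two_smul (ZMod p), ← map_smul] at h4
    have h5 := (LinearMap.GeneralLinearGroup.toLinearEquiv a).map_eq_zero_iff.mp h4
    exact smul_ne_zero (two_ne_zero_zmod hp) (rep_apply_ne_zero σ hv) h5
  · exact fun h ↦ ((ha.mul_eq σ).1 h).symm

/-- Conjugation by ρ(σ) sends a to ±a, and both have the same centralizer. -/
lemma range_le_normalizer_centralizer (ha : TwistCommutes ρ χ (a : V →ₗ[ZMod p] V)) :
    (MonoidHom.toHomUnits ρ).range ≤
      Subgroup.normalizer ((Subgroup.centralizer {a} : Subgroup _) : Set _) := by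
  rintro _ ⟨σ, rfl⟩
  set g := MonoidHom.toHomUnits ρ σ
  rw [Subgroup.mem_normalizer_iff]
  intro h
  rw [Subgroup.mem_centralizer_singleton_iff, Subgroup.mem_centralizer_singleton_iff]
  rcases Int.units_eq_one_or (χ σ) with h1 | h1
  · have hg : a * g = g * a := (ha.mul_eq σ).1 h1
    have hg' : g⁻¹ * a = a * g⁻¹ := by
      rw [inv_mul_eq_iff_eq_mul, ← mul_assoc, ← hg, mul_inv_cancel_right]
    rw [mul_assoc _ g⁻¹, hg', ← mul_assoc a, ← mul_assoc a, hg, ← mul_assoc, mul_left_inj,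
      mul_assoc, mul_assoc, mul_right_inj]
  · have hg : a * g = -(g * a) := (ha.mul_eq σ).2 h1
    have hg' : g⁻¹ * a = -(a * g⁻¹) := by
      rw [inv_mul_eq_iff_eq_mul, mul_neg, ← mul_assoc, ← neg_mul, ← hg,
        mul_inv_cancel_right]
    rw [mul_assoc _ g⁻¹, hg', ← mul_assoc a, ← mul_assoc a, hg, mul_neg, neg_mul, neg_mul, neg_inj,
      ← mul_assoc, mul_left_inj, mul_assoc, mul_assoc, mul_right_inj]

/-- Both groups are Cartan subgroups containing a common non-scalar element of ρ(ker χ), and each is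
the centralizer of that element. -/
lemma eq_centralizer_of_comap_eq (hp : p ≠ 2) (hV : finrank (ZMod p) V = 2)
    (hρ : IsAbsolutelyIrreducible ρ) (hχ : ∀ σ τ, χ (σ * τ) = χ σ * χ τ) {τ : G} (hτ : χ τ = -1)
    (ha : TwistCommutes ρ χ (a : V →ₗ[ZMod p] V))
    {C : Subgroup (LinearMap.GeneralLinearGroup (ZMod p) V)}
    (hC : IsSplitCartan C ∨ IsNonsplitCartan C)
    (hCχ : ∀ σ, χ σ = 1 → MonoidHom.toHomUnits ρ σ ∈ C) : C = Subgroup.centralizer {a} := by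
  obtain ⟨σ, h1, h2⟩ := exists_not_isScalar_of_eq_one hV hρ hχ hτ
  rw [eq_centralizer hC (hCχ σ h1) h2]
  exact (eq_centralizer (isCartan_centralizer hp hV (ha.trace_eq_zero hp hτ))
    ((mem_centralizer_iff_of_twistCommutes hp hV ha σ).mpr h1) h2).symm

end TwistedCommutant

/-! ### Congruence with a single quadratic twist -/

section AssociatedCartan

variable {K : Type*} [Field K] [CharZero K] [DecidableEq (AlgebraicClosure K)]
  {p : ℕ} [hpp : Fact p.Prime] {E : WeierstrassCurve K} [E.IsElliptic] {d : K}

lemma ne_zero_of_not_isSquare (hd : ¬ IsSquare d) : d ≠ 0 := fun h ↦ hd (h ▸ IsSquare.zero)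

lemma isAssociatedCartan_iff (hp : p ≠ 2) (hρ : IsAbsolutelyIrreducible (galoisRep p E))
    (hd : ¬ IsSquare d) {a : LinearMap.GeneralLinearGroup (ZMod p) (Torsion p E)}
    (ha : TwistCommutes (galoisRep p E) (quadChar d) (a : Torsion p E →ₗ[ZMod p] Torsion p E))
    {C : Subgroup (LinearMap.GeneralLinearGroup (ZMod p) (Torsion p E))} :
    IsAssociatedCartan p E d C ↔ C = Subgroup.centralizer {a} := by
  obtain ⟨τ, hτ⟩ := exists_quadChar_eq_neg_one hd
  constructor
  · rintro ⟨h1, -, h3⟩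
    refine eq_centralizer_of_comap_eq hp finrank_torsion hρ
      (quadChar_mul_apply (ne_zero_of_not_isSquare hd)) hτ ha h1 fun σ hσ ↦ ?_
    have h4 : σ ∈ C.comap (rho p E) := h3 ▸ mem_galSqrt_iff.mpr hσ
    exact h4
  · rintro rfl
    refine ⟨isCartan_centralizer hp finrank_torsion (ha.trace_eq_zero hp hτ),
      range_le_normalizer_centralizer ha, Subgroup.ext fun σ ↦ ?_⟩
    rw [mem_galSqrt_iff]
    exact mem_centralizer_iff_of_twistCommutes hp finrank_torsion ha σ

/-- The operator A of a congruence lies in C and has trace zero, so C is split exactly when −det A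
is a square. Since φ is symplectic exactly when det A is a square, what remains is whether −1 is a
square modulo p. -/
theorem associatedCartan_of_congruent (hp : p ≠ 2) (hρ : IsAbsolutelyIrreducible (galoisRep p E))
    (hd : ¬ IsSquare d) (hcong : Congruent p E (quadraticTwist E d)) :
    (∃! C, IsAssociatedCartan p E d C) ∧
      ∀ C, IsAssociatedCartan p E d C → ∀ φ : TorsionIso p E (quadraticTwist E d),
        (IsSymplectic φ ↔
          (IsSplitCartan C ∧ p % 4 = 1) ∨ (IsNonsplitCartan C ∧ p % 4 = 3)) ∧
        (IsAntisymplectic φ ↔ ¬ IsSymplectic φ) := by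
  obtain ⟨τ, hτ⟩ := exists_quadChar_eq_neg_one hd
  constructor
  · obtain ⟨φ⟩ := hcong
    obtain ⟨A, hA, -⟩ := φ.exists_twistCommutes hp (ne_zero_of_not_isSquare hd)
    have h := fun C ↦ isAssociatedCartan_iff hp hρ hd (C := C)
      (a := LinearMap.GeneralLinearGroup.ofLinearEquiv A) hA
    exact ⟨_, (h _).mpr rfl, fun C hC ↦ (h C).mp hC⟩
  · intro C hC φ
    obtain ⟨A, hA, h1, h2⟩ := φ.exists_twistCommutes hp (ne_zero_of_not_isSquare hd)
    refine ⟨?_, by rw [h1, h2]⟩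
    let a := LinearMap.GeneralLinearGroup.ofLinearEquiv A
    have hC' := (isAssociatedCartan_iff hp hρ hd (a := a) hA).mp hC
    have haC : a ∈ C := by rw [hC', Subgroup.mem_centralizer_singleton_iff]
    have htr : LinearMap.trace (ZMod p) _ (a : Torsion p E →ₗ[ZMod p] Torsion p E) = 0 :=
      hA.trace_eq_zero hp hτ
    have hs : IsSplitCartan C ↔ IsSquare (-LinearMap.det A.toLinearMap) :=
      ⟨fun h ↦ isSquare_of_isSplitCartan h haC htr, fun h ↦ hC.cartan.resolve_right fun h' ↦
        not_isSquare_of_isNonsplitCartan hp h' haC htr h⟩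
    have hn : IsNonsplitCartan C ↔ ¬ IsSquare (-LinearMap.det A.toLinearMap) :=
      ⟨fun h ↦ not_isSquare_of_isNonsplitCartan hp h haC htr, fun h ↦ hC.cartan.resolve_left
        fun h' ↦ h (hs.mp h')⟩
    have hdet : LinearMap.det A.toLinearMap ≠ 0 := det_val_ne_zero (A := a)
    rw [h1, hs, hn, isSquare_neg_iff hp hdet]
    have h2 : p % 2 = 1 := hpp.out.eq_two_or_odd.resolve_left hp
    rcases (show p % 4 = 1 ∨ p % 4 = 3 by omega) with h4 | h4 <;> simp [h4]

end AssociatedCartan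

end EllipticCongruence

end



noncomputable section

namespace EllipticCongruence

open Module

/-! ### Representations with projective image `C₂ × C₂` -/

section KleinFour

variable {p : ℕ} [hpp : Fact p.Prime] {G V : Type*} [Group G] [AddCommGroup V] [Module (ZMod p) V]
  {ρ : Representation (ZMod p) G V} {χ χ' : G → ℤˣ}

/-- The image of `ρ` in `PGL(V)` is abelian, with non-trivial elements the images of three elements
`s i`. -/
structure KleinGenerators (ρ : Representation (ZMod p) G V) (s : Fin 3 → G) : Prop where
  mul_eq : s 2 = s 0 * s 1
  not_isScalar : ∀ i, ¬ IsScalar (ρ (s i))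
  not_isScalar_mul_inv : ∀ i j, i ≠ j → ¬ IsScalar (ρ (s i * (s j)⁻¹))
  isScalar_or : ∀ σ, IsScalar (ρ σ) ∨ ∃ i, IsScalar (ρ (σ * (s i)⁻¹))
  comm : ∀ σ τ, ∃ c : ZMod p, ∀ v, ρ σ (ρ τ v) = c • ρ τ (ρ σ v)

lemma mem_center_iff_isScalar (hV : finrank (ZMod p) V = 2) (hρ : IsAbsolutelyIrreducible ρ)
    (σ : G) : MonoidHom.toHomUnits ρ σ ∈ Subgroup.center (LinearMap.GeneralLinearGroup (ZMod p) V) ↔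
      IsScalar (ρ σ) := by
  have : Module.Finite (ZMod p) V := Module.finite_of_finrank_pos (by omega)
  have : Nontrivial V := Module.nontrivial_of_finrank_pos (R := ZMod p) (by omega)
  rw [Subgroup.mem_center_iff]
  constructor
  · intro h
    refine hρ.exists_eq_smul_one (ρ σ) fun τ v ↦ ?_
    exact congrArg (fun g : LinearMap.GeneralLinearGroup (ZMod p) V ↦ (g : V →ₗ[ZMod p] V) v)
      (h (MonoidHom.toHomUnits ρ τ)).symm
  · rintro ⟨c, hc⟩ g
    refine Units.ext (LinearMap.ext fun v ↦ ?_)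
    change (g : V →ₗ[ZMod p] V) (ρ σ v) = ρ σ ((g : V →ₗ[ZMod p] V) v)
    rw [hc, hc, map_smul]

/-- By Schur's lemma the elements of G that are trivial in PGL(V) are those acting by scalars, so
the structure of the Klein four-group can be read back in G. -/
lemma exists_kleinGenerators (hV : finrank (ZMod p) V = 2) (hρ : IsAbsolutelyIrreducible ρ)
    (hK : IsKleinFour ((MonoidHom.toHomUnits ρ).range.map
      (QuotientGroup.mk' (Subgroup.center (LinearMap.GeneralLinearGroup (ZMod p) V))))) :
    ∃ s, KleinGenerators ρ s := by
  classical
  set Q := (MonoidHom.toHomUnits ρ).range.map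
    (QuotientGroup.mk' (Subgroup.center (LinearMap.GeneralLinearGroup (ZMod p) V))) with hQ
  let q : G →* Q :=
    ((QuotientGroup.mk' _).comp (MonoidHom.toHomUnits ρ)).codRestrict Q fun σ ↦
      ⟨_, ⟨σ, rfl⟩, rfl⟩
  have hq : Function.Surjective q := by
    rintro ⟨_, _, ⟨σ, rfl⟩, rfl⟩
    exact ⟨σ, rfl⟩
  have hq1 : ∀ σ, q σ = 1 ↔ IsScalar (ρ σ) := fun σ ↦ by
    rw [← mem_center_iff_isScalar hV hρ, ← QuotientGroup.eq_one_iff, Subtype.ext_iff]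
    rfl
  have hq2 : ∀ σ τ, q σ = q τ ↔ IsScalar (ρ (σ * τ⁻¹)) := fun σ τ ↦ by
    rw [← hq1, map_mul, map_inv, mul_inv_eq_one]
  have hfin : Finite Q := IsKleinFour.instFinite
  let _ := Fintype.ofFinite Q
  have hcard : Fintype.card Q = 4 := IsKleinFour.card_four'
  obtain ⟨x, -, hx⟩ := Finset.exists_mem_notMem_of_card_lt_card
    (s := ({1} : Finset Q)) (t := Finset.univ) (by rw [Finset.card_univ, hcard, Finset.card_singleton]; norm_num)
  obtain ⟨y, -, hy⟩ := Finset.exists_mem_notMem_of_card_lt_card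
    (s := ({1, x} : Finset Q)) (t := Finset.univ) (by
      rw [Finset.card_univ, hcard]; exact Finset.card_le_two.trans_lt (by decide))
  rw [Finset.mem_singleton] at hx
  rw [Finset.mem_insert, Finset.mem_singleton, not_or] at hy
  obtain ⟨hy1, hyx⟩ := hy
  obtain ⟨σ, rfl⟩ := hq x
  obtain ⟨τ, rfl⟩ := hq y
  have huniv := IsKleinFour.eq_finset_univ hx hy1 (Ne.symm hyx)
  have hm : q (σ * τ) = q σ * q τ := map_mul _ _ _
  have hne := IsKleinFour.mul_self (q σ)
  have hne' := IsKleinFour.mul_self (q τ)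
  have h20 : q σ * q τ ≠ q σ := fun h ↦ hy1 (mul_eq_left.mp h)
  have h21 : q σ * q τ ≠ q τ := fun h ↦ hx (mul_eq_right.mp h)
  have h22 : q σ * q τ ≠ 1 := fun h ↦ hyx (mul_left_cancel (hne.trans h.symm)).symm
  refine ⟨![σ, τ, σ * τ], rfl, ?_, ?_, ?_, ?_⟩
  · intro i
    rw [← hq1]
    fin_cases i
    exacts [hx, hy1, hm ▸ h22]
  · intro i j hij
    rw [← hq2]
    fin_cases i <;> fin_cases j <;> first
      | exact absurd rfl hij
      | exact hyx
      | exact Ne.symm hyx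
      | exact hm ▸ h20
      | exact hm ▸ h20.symm
      | exact hm ▸ h21
      | exact hm ▸ h21.symm
  · intro g
    rw [← hq1]
    have hg : q g ∈ ({q σ * q τ, q σ, q τ, 1} : Finset Q) := huniv ▸ Finset.mem_univ _
    simp only [Finset.mem_insert, Finset.mem_singleton] at hg
    rcases hg with h | h | h | h
    · exact .inr ⟨2, (hq2 _ _).mp (h.trans hm.symm)⟩
    · exact .inr ⟨0, (hq2 _ _).mp h⟩
    · exact .inr ⟨1, (hq2 _ _).mp h⟩
    · exact .inl h
  · intro g h
    have hc : q (g * h) = q (h * g) := by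
      rw [map_mul, map_mul]
      exact mul_comm_of_exponent_two IsKleinFour.exponent_two _ _
    obtain ⟨c, hc⟩ := (hq2 _ _).mp hc
    refine ⟨c, fun v ↦ ?_⟩
    rw [← Module.End.mul_apply (ρ h), ← map_mul, ← hc,
      ← Module.End.mul_apply (ρ (g * h * (h * g)⁻¹)), ← map_mul, inv_mul_cancel_right, map_mul,
      Module.End.mul_apply]

/-- An injective A determines the signs, as 1 ≠ −1 modulo p; hence multiplicativity comes for free.
-/
lemma twistCommutes_mul (hp : p ≠ 2) [Nontrivial V] {A : V →ₗ[ZMod p] V}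
    (hA0 : ∀ v, v ≠ 0 → A v ≠ 0)
    (hA : TwistCommutes ρ χ A) (σ τ : G) : χ (σ * τ) = χ σ * χ τ := by
  obtain ⟨v, hv⟩ := exists_ne (0 : V)
  have h1 := hA (σ * τ) v
  rw [map_mul, Module.End.mul_apply, hA, hA, map_smul, smul_smul, Module.End.mul_apply] at h1
  have h2 := smul_left_injective (ZMod p)
    (rep_apply_ne_zero (ρ := ρ) σ (rep_apply_ne_zero (ρ := ρ) τ (hA0 v hv))) h1
  have hne : ((1 : ℤ) : ZMod p) ≠ ((-1 : ℤ) : ZMod p) := by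
    rw [Int.cast_neg, Int.cast_one, Ne, eq_neg_iff_add_eq_zero, one_add_one_eq_two]
    exact two_ne_zero_zmod hp
  rcases Int.units_eq_one_or (χ (σ * τ)) with h | h <;>
    rcases Int.units_eq_one_or (χ σ) with h' | h' <;>
    rcases Int.units_eq_one_or (χ τ) with h'' | h'' <;>
    rw [h, h', h''] at h2 ⊢ <;> first
      | decide
      | exact absurd (by simpa using h2) hne
      | exact absurd (by simpa using h2) hne.symm

/-- Taking determinants of ρ(σ) ρ(τ) = c ρ(τ) ρ(σ) in dimension 2 gives c² = 1. -/
lemma exists_twistCommutes_rep (hV : finrank (ZMod p) V = 2)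
    (hcomm : ∀ σ τ, ∃ c : ZMod p, ∀ v, ρ σ (ρ τ v) = c • ρ τ (ρ σ v)) (σ : G) :
    ∃ χ, TwistCommutes ρ χ (ρ σ) := by
  have : Module.Finite (ZMod p) V := Module.finite_of_finrank_pos (by omega)
  have key : ∀ τ, ∃ ε : ℤˣ, ∀ v, ρ σ (ρ τ v) = ((ε : ℤ) : ZMod p) • ρ τ (ρ σ v) := by
    intro τ
    obtain ⟨c, hc⟩ := hcomm σ τ
    have h1 : ρ σ * ρ τ = c • (ρ τ * ρ σ) := LinearMap.ext hc
    have h2 := congrArg LinearMap.det h1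
    rw [LinearMap.det_smul, hV, map_mul, map_mul, mul_comm (LinearMap.det (ρ τ))] at h2
    have h3 := (mul_eq_right₀ (mul_ne_zero (det_val_ne_zero (A := MonoidHom.toHomUnits ρ σ))
      (det_val_ne_zero (A := MonoidHom.toHomUnits ρ τ)))).mp h2.symm
    rcases mul_self_eq_one_iff.mp ((sq c).symm.trans h3) with rfl | rfl
    · exact ⟨1, by simpa using hc⟩
    · exact ⟨-1, by simpa using hc⟩
  choose χ hχ using key
  exact ⟨χ, fun τ v ↦ hχ τ v⟩

/-- The two signs cancel in A B⁻¹, which therefore commutes with ρ and is scalar. -/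
lemma eq_smul_of_twistCommutes [FiniteDimensional (ZMod p) V] [Nontrivial V]
    (hρ : IsAbsolutelyIrreducible ρ) {A B : V →ₗ[ZMod p] V} (hA : TwistCommutes ρ χ A)
    (hB : TwistCommutes ρ χ B) (hB0 : ∀ v, v ≠ 0 → B v ≠ 0) :
    ∃ c : ZMod p, ∀ v, A v = c • B v := by
  let B' : V ≃ₗ[ZMod p] V := LinearEquiv.ofInjectiveEndo B
    ((injective_iff_map_eq_zero B).mpr fun v hv ↦ by_contra fun h ↦ hB0 v h hv)
  have hBB' : ∀ v, B' v = B v := fun v ↦ rfl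
  obtain ⟨c, hc⟩ := hρ.exists_eq_smul_one (A ∘ₗ B'.symm.toLinearMap) fun σ v ↦ by
    obtain ⟨w, rfl⟩ := B'.surjective v
    have h1 : B'.symm (ρ σ (B' w)) = ((χ σ : ℤ) : ZMod p) • ρ σ w := by
      rw [LinearEquiv.symm_apply_eq, map_smul, hBB', hBB', hB, smul_smul, ← Int.cast_mul,
        ← Units.val_mul, Int.units_mul_self, Units.val_one, Int.cast_one, one_smul]
    rw [LinearMap.comp_apply, LinearMap.comp_apply, LinearEquiv.coe_coe, h1,
      LinearEquiv.symm_apply_apply, map_smul, hA, smul_smul, ← Int.cast_mul,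
        ← Units.val_mul, Int.units_mul_self, Units.val_one, Int.cast_one, one_smul]
  refine ⟨c, fun v ↦ ?_⟩
  have := hc (B' v)
  rwa [LinearMap.comp_apply, LinearEquiv.coe_coe, LinearEquiv.symm_apply_apply] at this

namespace KleinGenerators

variable {s : Fin 3 → G} (hs : KleinGenerators ρ s)

include hs

/-- From χ(s 2) = χ(s 0) χ(s 1): the three signs cannot all be −1. -/
lemma exists_eq_one (hχ : ∀ σ τ, χ (σ * τ) = χ σ * χ τ) : ∃ i, χ (s i) = 1 := by
  by_contra! h
  have h' := fun i ↦ (Int.units_eq_one_or _).resolve_left (h i)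
  have h2 := hχ (s 0) (s 1)
  rw [← hs.mul_eq, h', h', h'] at h2
  exact absurd h2 (by decide)

lemma apply_eq (hχ : ∀ σ τ, χ (σ * τ) = χ σ * χ τ)
    (hsc : ∀ σ, IsScalar (ρ σ) → χ σ = 1) (σ : G) : χ σ = 1 ∨ ∃ i, IsScalar (ρ (σ * (s i)⁻¹)) ∧
      χ σ = χ (s i) := by
  rcases hs.isScalar_or σ with h | ⟨i, h⟩
  · exact .inl (hsc _ h)
  · refine .inr ⟨i, h, ?_⟩
    have h2 := hχ (σ * (s i)⁻¹) (s i)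
    rwa [inv_mul_cancel_right, hsc _ h, one_mul] at h2

lemma eq_neg_one (hχ : ∀ σ τ, χ (σ * τ) = χ σ * χ τ) (hsc : ∀ σ, IsScalar (ρ σ) → χ σ = 1)
    {τ : G} (hτ : χ τ = -1) {i j : Fin 3} (hi : χ (s i) = 1) (hij : i ≠ j) : χ (s j) = -1 := by
  refine (Int.units_eq_one_or _).resolve_left fun hj ↦ ?_
  have h2 := hχ (s 0) (s 1)
  rw [← hs.mul_eq] at h2
  have hall : ∀ k, χ (s k) = 1 := by
    intro k
    fin_cases i <;> fin_cases j <;> fin_cases k <;> simp_all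
  rcases hs.apply_eq hχ hsc τ with h | ⟨k, -, h⟩
  · rw [h] at hτ; exact absurd hτ (by decide)
  · rw [h, hall] at hτ; exact absurd hτ (by decide)

/-- A non-trivial character of the Klein four-group has a kernel of order 2 and is determined by the
non-trivial element in it. -/
lemma eq_of_eq_one (hχ : ∀ σ τ, χ (σ * τ) = χ σ * χ τ) (hsc : ∀ σ, IsScalar (ρ σ) → χ σ = 1)
    {τ : G} (hτ : χ τ = -1) (hχ' : ∀ σ τ, χ' (σ * τ) = χ' σ * χ' τ)
    (hsc' : ∀ σ, IsScalar (ρ σ) → χ' σ = 1) {τ' : G} (hτ' : χ' τ' = -1)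
    {i : Fin 3} (hi : χ (s i) = 1) (hi' : χ' (s i) = 1) : χ = χ' := by
  have hj : ∀ j, χ (s j) = χ' (s j) := by
    intro j
    rcases eq_or_ne i j with rfl | hij
    · rw [hi, hi']
    · rw [hs.eq_neg_one hχ hsc hτ hi hij, hs.eq_neg_one hχ' hsc' hτ' hi' hij]
  funext σ
  rcases hs.isScalar_or σ with h | ⟨j, h⟩
  · rw [hsc _ h, hsc' _ h]
  · have h1 := hχ (σ * (s j)⁻¹) (s j)
    have h2 := hχ' (σ * (s j)⁻¹) (s j)
    rw [inv_mul_cancel_right, hsc _ h, one_mul] at h1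
    rw [inv_mul_cancel_right, hsc' _ h, one_mul] at h2
    rw [h1, h2, hj]

end KleinGenerators

end KleinFour

end EllipticCongruence

end



noncomputable section

namespace EllipticCongruence

open Module

/-! ### Congruences with quadratic twists when the projective image is `C₂ × C₂` -/

section KleinTwists

variable {K : Type*} [Field K] [CharZero K] [DecidableEq (AlgebraicClosure K)]
  {p : ℕ} [hpp : Fact p.Prime] {E : WeierstrassCurve K} [E.IsElliptic]
  {s : Fin 3 → Gal(AlgebraicClosure K/K)} {D : Fin 3 → K}

instance : Nontrivial (Torsion p E) :=
  Module.nontrivial_of_finrank_pos (R := ZMod p) (by rw [finrank_torsion]; norm_num)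

/-- The operators ρ(s i) are themselves the intertwiners sought. Their sign characters are trivial
on the kernel of ρ, so each comes from some K(√D i). -/
lemma exists_twistCommutes_quadChar (hp : p ≠ 2) (hs : KleinGenerators (galoisRep p E) s) :
    ∃ D : Fin 3 → K, ∀ i, D i ≠ 0 ∧
      TwistCommutes (galoisRep p E) (quadChar (D i)) (galoisRep p E (s i)) := by
  have key : ∀ i, ∃ D : K, D ≠ 0 ∧
      TwistCommutes (galoisRep p E) (quadChar D) (galoisRep p E (s i)) := by
    intro i
    obtain ⟨χ, hχ⟩ := exists_twistCommutes_rep finrank_torsion hs.comm (s i)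
    have hmul := twistCommutes_mul hp (fun v hv ↦ rep_apply_ne_zero (s i) hv) hχ
    let χ' : Gal(AlgebraicClosure K/K) →* ℤˣ := MonoidHom.mk' χ hmul
    obtain ⟨D, hD, h⟩ := exists_eq_quadChar χ' (isOpen_of_ker_le (p := p) (E := E) fun σ hσ ↦ by
      refine (Int.units_eq_one_or _).resolve_right fun h ↦ ?_
      obtain ⟨v, hv⟩ := exists_ne (0 : Torsion p E)
      have h1 := hχ σ v
      rw [hσ, Module.End.one_apply, Module.End.one_apply, show χ σ = -1 from h, Units.val_neg,
        Units.val_one, Int.cast_neg, Int.cast_one, neg_one_smul, eq_neg_iff_add_eq_zero,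
        ← two_smul (ZMod p)] at h1
      exact smul_ne_zero (two_ne_zero_zmod hp) (rep_apply_ne_zero (s i) hv) h1)
    exact ⟨D, hD, h ▸ hχ⟩
  choose D hD using key
  exact ⟨D, hD⟩

variable (hp : p ≠ 2) (hρ : IsAbsolutelyIrreducible (galoisRep p E))
  (hs : KleinGenerators (galoisRep p E) s)
  (hD : ∀ i, D i ≠ 0 ∧ TwistCommutes (galoisRep p E) (quadChar (D i)) (galoisRep p E (s i)))

include hρ hs hD

lemma KleinGenerators.not_isSquare (i : Fin 3) : ¬ IsSquare (D i) := by
  intro h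
  refine hs.not_isScalar i (hρ.exists_eq_smul_one _ fun σ v ↦ ?_)
  have h1 := (hD i).2 σ v
  rwa [isSquare_iff_forall_quadChar.mp h σ, Units.val_one, Int.cast_one, one_smul] at h1

lemma KleinGenerators.not_isSquare_mul {i j : Fin 3} (hij : i ≠ j) : ¬ IsSquare (D i * D j) := by
  intro h
  have h1 := (isSquare_mul_iff_quadChar_eq (hD i).1 (hD j).1).mp h
  obtain ⟨c, hc⟩ := eq_smul_of_twistCommutes hρ (h1 ▸ (hD i).2) (hD j).2
    fun v hv ↦ rep_apply_ne_zero (s j) hv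
  refine hs.not_isScalar_mul_inv i j hij ⟨c, fun v ↦ ?_⟩
  rw [map_mul, Module.End.mul_apply, hc, ← Module.End.mul_apply, ← map_mul, mul_inv_cancel, map_one,
    Module.End.one_apply]

-- ρ(s i) commutes with itself. This pins down which of the three elements the character of D i
-- kills.
omit hρ hs in
include hp in
lemma quadChar_self_eq_one (i : Fin 3) : quadChar (D i) (s i) = 1 := by
  refine (Int.units_eq_one_or _).resolve_right fun h ↦ ?_
  obtain ⟨v, hv⟩ := exists_ne (0 : Torsion p E)
  have h1 := (hD i).2 (s i) v
  rw [h, Units.val_neg,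
    Units.val_one, Int.cast_neg, Int.cast_one, neg_one_smul, eq_neg_iff_add_eq_zero,
    ← two_smul (ZMod p)] at h1
  exact smul_ne_zero (two_ne_zero_zmod hp) (rep_apply_ne_zero _ (rep_apply_ne_zero _ hv)) h1

omit hρ hs in
include hp in
lemma quadChar_eq_one_of_isScalar (i : Fin 3) {σ : Gal(AlgebraicClosure K/K)}
    (hσ : IsScalar (galoisRep p E σ)) : quadChar (D i) σ = 1 :=
  (Int.units_eq_one_or _).resolve_right fun h ↦
    not_isScalar_of_twistCommutes (a := rho p E (s i)) hp finrank_torsion (hD i).2 h hσ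

include hp

lemma KleinGenerators.quadChar_eq {e : K} (he : ¬ IsSquare e)
    (hsc : ∀ σ, IsScalar (galoisRep p E σ) → quadChar e σ = 1) {i : Fin 3}
    (hi : quadChar e (s i) = 1) : quadChar e = quadChar (D i) := by
  obtain ⟨τ, hτ⟩ := exists_quadChar_eq_neg_one he
  obtain ⟨τ', hτ'⟩ := exists_quadChar_eq_neg_one (hs.not_isSquare hρ hD i)
  exact hs.eq_of_eq_one (quadChar_mul_apply (ne_zero_of_not_isSquare he)) hsc hτ
    (quadChar_mul_apply (hD i).1) (fun σ ↦ quadChar_eq_one_of_isScalar hp hD i) hτ' hi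
    (quadChar_self_eq_one hp hD i)

lemma KleinGenerators.exists_quadChar_eq {e : K} (he : ¬ IsSquare e)
    (hsc : ∀ σ, IsScalar (galoisRep p E σ) → quadChar e σ = 1) :
    ∃ i, quadChar e = quadChar (D i) :=
  (hs.exists_eq_one (quadChar_mul_apply (ne_zero_of_not_isSquare he))).imp fun _ hi ↦
    hs.quadChar_eq hp hρ hD he hsc hi

/-- The operator A of φ forces the character of e to be trivial on scalar elements, so it is that of
some D i. By uniqueness A = c ρ(s i), hence det A is det ρ(s i) modulo squares, and the character of
p* tests whether that is a square. -/
lemma KleinGenerators.exists_of_torsionIso {e : K} (he : ¬ IsSquare e)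
    (φ : TorsionIso p E (quadraticTwist E e)) : ∃ i, quadChar e = quadChar (D i) ∧
      (IsSymplectic φ ↔ quadChar (pStar p : K) (s i) = 1) ∧
      (IsAntisymplectic φ ↔ ¬ IsSymplectic φ) := by
  obtain ⟨A, hA, h1, h2⟩ := φ.exists_twistCommutes hp (ne_zero_of_not_isSquare he)
  obtain ⟨i, hi⟩ := hs.exists_quadChar_eq hp hρ hD he fun σ hσ ↦
    (Int.units_eq_one_or _).resolve_right fun h ↦ not_isScalar_of_twistCommutes
      (a := LinearMap.GeneralLinearGroup.ofLinearEquiv A) hp finrank_torsion hA h hσ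
  refine ⟨i, hi, ?_, by rw [h1, h2]⟩
  obtain ⟨c, hc⟩ := eq_smul_of_twistCommutes hρ hA (hi ▸ (hD i).2)
    fun v hv ↦ rep_apply_ne_zero (s i) hv
  have h3 : A.toLinearMap = c • galoisRep p E (s i) := LinearMap.ext hc
  have hdet : LinearMap.det (galoisRep p E (s i)) ≠ 0 := det_val_ne_zero (A := rho p E (s i))
  have hc0 : c ≠ 0 := by
    rintro rfl
    obtain ⟨v, hv⟩ := exists_ne (0 : Torsion p E)
    exact hv (A.map_eq_zero_iff.mp ((hc v).trans (zero_smul _ _)))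
  rw [h1, h3, LinearMap.det_smul, finrank_torsion, quadChar_pStar_eq_one_iff (E := E) hp,
    isSquare_mul_iff_of_ne_zero (pow_ne_zero 2 hc0) hdet]
  exact iff_of_eq (by simp [IsSquare.sq])

lemma KleinGenerators.congruent_iff {e : K} (he : ¬ IsSquare e) :
    Congruent p E (quadraticTwist E e) ↔ ∃ i, IsSquare (e * D i) := by
  have he0 := ne_zero_of_not_isSquare he
  constructor
  · rintro ⟨φ⟩
    obtain ⟨i, hi, -⟩ := hs.exists_of_torsionIso hp hρ hD he φ
    exact ⟨i, (isSquare_mul_iff_quadChar_eq he0 (hD i).1).mpr hi⟩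
  · rintro ⟨i, hi⟩
    rw [isSquare_mul_iff_quadChar_eq he0 (hD i).1] at hi
    exact congruent_of_twistCommutes he0
      (LinearMap.GeneralLinearGroup.toLinearEquiv (rho p E (s i))) (hi ▸ (hD i).2)

lemma KleinGenerators.isSymplectic_of_isSquare (hP : IsSquare (pStar p : K)) {e : K}
    (he : ¬ IsSquare e) (φ : TorsionIso p E (quadraticTwist E e)) :
    IsSymplectic φ ∧ ¬ IsAntisymplectic φ := by
  obtain ⟨i, -, h1, h2⟩ := hs.exists_of_torsionIso hp hρ hD he φ
  have h3 := h1.mpr (isSquare_iff_forall_quadChar.mp hP _)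
  exact ⟨h3, by rwa [h2, not_not]⟩

omit hρ hs hD in
lemma quadChar_pStar_of_isScalar {σ : Gal(AlgebraicClosure K/K)}
    (hσ : IsScalar (galoisRep p E σ)) : quadChar (pStar p : K) σ = 1 := by
  obtain ⟨c, hc⟩ := hσ
  rw [quadChar_pStar_eq_one_iff (E := E) hp,
    show galoisRep p E σ = c • LinearMap.id from LinearMap.ext hc, LinearMap.det_smul,
    finrank_torsion, LinearMap.det_id, mul_one]
  exact IsSquare.sq c

/-- A scalar on a plane has square determinant, so the character of p* factors through the
projective image and is one of the three. -/
lemma KleinGenerators.congruent_pStar (hP : ¬ IsSquare (pStar p : K)) :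
    Congruent p E (quadraticTwist E (pStar p : K)) := by
  rw [hs.congruent_iff hp hρ hD hP]
  obtain ⟨i, hi⟩ := hs.exists_quadChar_eq hp hρ hD hP
    fun σ ↦ quadChar_pStar_of_isScalar (E := E) hp
  exact ⟨i, (isSquare_mul_iff_quadChar_eq pStar_ne_zero (hD i).1).mpr hi⟩

/-- If e has the class of D i, then φ is symplectic exactly when the character of p* kills s i.
Among non-trivial characters of the Klein four-group only that of D i does so. -/
lemma KleinGenerators.isSymplectic_iff (hP : ¬ IsSquare (pStar p : K)) {e : K}
    (he : ¬ IsSquare e) (φ : TorsionIso p E (quadraticTwist E e)) :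
    (IsSymplectic φ ↔ IsSquare (e * (pStar p : K))) ∧ (IsAntisymplectic φ ↔ ¬ IsSymplectic φ) := by
  obtain ⟨i, hi, h1, h2⟩ := hs.exists_of_torsionIso hp hρ hD he φ
  refine ⟨?_, h2⟩
  rw [h1, isSquare_mul_iff_quadChar_eq (ne_zero_of_not_isSquare he) pStar_ne_zero, hi]
  constructor
  · exact fun h ↦ (hs.quadChar_eq hp hρ hD hP
      (fun σ ↦ quadChar_pStar_of_isScalar (E := E) hp) h).symm
  · exact fun h ↦ h ▸ quadChar_self_eq_one hp hD i

end KleinTwists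

end EllipticCongruence

end



noncomputable section

namespace EllipticCongruence

open WeierstrassCurve WeierstrassCurve.Affine Module

/-! ### The curves with `j = 0` and `p = 3` -/

section JZero

/-- For c₄ = 0 the curve becomes y² = x³ − c₆/864 after completing the square and the cube. The
point with x = 0 and y = η is a flex, hence 3-torsion; c₆ ≠ 0 ensures that it is not 2-torsion. -/
lemma exists_three_torsion {F : Type*} [Field F] [DecidableEq F] [IsAlgClosed F] [CharZero F]
    (W : WeierstrassCurve.Affine F) [W.IsElliptic] (h4 : W.c₄ = 0) :
    ∃ P : W.Point, P ≠ 0 ∧ 3 • P = 0 ∧ xCoord P = -W.b₂ / 12 := by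
  have hc6 : W.c₆ ≠ 0 := by
    intro h6
    have h := W.c_relation
    rw [h4, h6] at h
    have hΔ : W.Δ ≠ 0 := W.isUnit_Δ.ne_zero
    apply hΔ
    linear_combination h / 1728
  obtain ⟨η, hη⟩ := IsAlgClosed.exists_pow_nat_eq (-W.c₆ / 864) two_pos
  have hη0 : η ≠ 0 := by
    rintro rfl
    apply hc6
    linear_combination 864 * hη
  set x := -W.b₂ / 12 with hx
  set y := η - (W.a₁ * x + W.a₃) / 2 with hy
  have heq : W.Equation x y := by
    rw [equation_iff, hy]
    simp only [hx, WeierstrassCurve.c₄, WeierstrassCurve.c₆, WeierstrassCurve.b₂,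
      WeierstrassCurve.b₄, WeierstrassCurve.b₆] at hη h4 ⊢
    linear_combination hη
  have hns : W.Nonsingular x y := equation_iff_nonsingular.mp heq
  have hY : y - W.negY x y = 2 * η := by rw [negY, hy]; ring
  have hne : y ≠ W.negY x y := by
    rw [← sub_ne_zero, hY]
    exact mul_ne_zero two_ne_zero hη0
  have hnum : 3 * x ^ 2 + 2 * W.a₂ * x + W.a₄ - W.a₁ * y = -W.a₁ * η := by
    simp only [hy, hx, WeierstrassCurve.c₄, WeierstrassCurve.b₂, WeierstrassCurve.b₄] at h4 ⊢
    linear_combination -h4 / 48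
  have hslope : W.slope x x y y = -W.a₁ / 2 := by
    rw [slope_of_Y_ne rfl hne, hY, hnum]
    field_simp
  have hX : W.addX x x (W.slope x x y y) = x := by
    rw [hslope, addX, hx, WeierstrassCurve.b₂]
    ring
  let P : W.Point := .some x y hns
  have hP0 : P ≠ 0 := Point.some_ne_zero _
  have hadd : P + P ≠ 0 ∧ xCoord (P + P) = xCoord P := by
    have h := Point.add_self_of_Y_ne (h₁ := hns) hne
    change P + P = _ at h
    rw [h]
    exact ⟨Point.some_ne_zero _, hX⟩
  refine ⟨P, hP0, ?_, rfl⟩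
  rcases (xCoord_eq_iff hadd.1 hP0).mp hadd.2 with h | h
  · exact absurd (add_eq_left.mp h) hP0
  · rw [show 3 = 2 + 1 from rfl, succ_nsmul, two_nsmul, h, neg_add_cancel]

/-- The flex has its x-coordinate in K, so Galois sends it to itself or its negative and it spans a
stable line. -/
theorem j_ne_zero_of_isAbsolutelyIrreducible {K : Type*} [Field K] [CharZero K]
    [DecidableEq (AlgebraicClosure K)] {E : WeierstrassCurve K} [E.IsElliptic]
    [Fact (Nat.Prime 3)] (hρ : IsAbsolutelyIrreducible (galoisRep 3 E)) : E.j ≠ 0 := by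
  intro hj
  have hc4 : E.c₄ = 0 := (j_eq_zero_iff E).mp hj
  obtain ⟨P, hP0, hP3, hPx⟩ := exists_three_torsion
    (WeierstrassCurve.Affine.baseChange E (AlgebraicClosure K))
    ((E.map_c₄ (algebraMap K (AlgebraicClosure K))).trans (by rw [hc4, map_zero]))
  have hb : xCoord P = algebraMap K (AlgebraicClosure K) (-E.b₂ / 12) := by
    rw [hPx, map_div₀, map_neg, map_ofNat]
    exact congrArg (fun b ↦ -b / 12) (E.map_b₂ (algebraMap K (AlgebraicClosure K)))
  let Q : Torsion 3 E := ⟨P, AddSubgroup.torsionBy.nsmul_iff.mpr hP3⟩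
  refine hρ.not_stable_line finrank_torsion (v := Q) (fun h ↦ hP0 (congrArg Subtype.val h))
    fun σ ↦ ?_
  have h1 := (xCoord_eq_iff (map_point_ne_zero σ hP0) hP0).mp (by
    rw [xCoord_map, hb, AlgEquiv.commutes])
  rcases h1 with h1 | h1
  · exact ⟨1, Subtype.ext (by rw [one_smul]; exact h1)⟩
  · exact ⟨-1, Subtype.ext (by rw [neg_one_smul]; exact h1)⟩

end JZero

/-! ### The curves with `j = 1728` -/

section J1728

lemma c₆_eq_zero_iff {K : Type*} [Field K] [CharZero K] (E : WeierstrassCurve K) [E.IsElliptic] :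
    E.c₆ = 0 ↔ E.j = 1728 := by
  have h := E.c_relation
  have hΔ : E.Δ ≠ 0 := E.isUnit_Δ.ne_zero
  have hj : E.j * E.Δ = E.c₄ ^ 3 := by
    rw [j, ← E.coe_Δ', mul_right_comm, Units.inv_mul, one_mul]
  constructor
  · intro h6
    rw [h6] at h
    apply mul_right_cancel₀ hΔ
    linear_combination hj - h
  · intro h1
    rw [h1] at hj
    exact pow_eq_zero_iff two_ne_zero |>.mp (by linear_combination h - hj)

variable {K : Type*} [Field K] [CharZero K] [DecidableEq (AlgebraicClosure K)]
  {p : ℕ} [hpp : Fact p.Prime] {E : WeierstrassCurve K} [E.IsElliptic] {i : AlgebraicClosure K}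

variable (E) in
/-- Multiplication by the fourth root of unity `i` on a curve with `c₆ = 0`. -/
def quarticAut (hE : E.c₆ = 0) (hi : i ^ 2 = -1) :
    CoordChange (WeierstrassCurve.Affine.baseChange E (AlgebraicClosure K))
      (WeierstrassCurve.Affine.baseChange E (AlgebraicClosure K)) where
  -- In the coordinates x + b₂/12 and y + (a₁x + a₃)/2 the map is (x, y) ↦ (−x, iy); the values of
  -- r, s, t undo this shift.
  α := -1
  β := i
  r := -algebraMap K _ E.b₂ / 6
  s := (i + 1) * algebraMap K _ E.a₁ / 2
  t := (i - 1) * algebraMap K _ E.a₃ / 2 + algebraMap K _ (E.a₁ * E.b₂) / 12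
  α_ne_zero := neg_ne_zero.mpr one_ne_zero
  β_ne_zero := by rintro rfl; simp at hi
  equation_iff x y := by
    have h6 := congrArg (algebraMap K (AlgebraicClosure K)) hE
    rw [equation_baseChange_iff, equation_baseChange_iff]
    simp only [WeierstrassCurve.b₂, WeierstrassCurve.c₆, WeierstrassCurve.b₄, WeierstrassCurve.b₆,
      map_add, map_mul, map_pow, map_neg, map_ofNat, map_sub, map_zero] at h6 ⊢
    constructor
    · intro h
      linear_combination -h + h6 / 432 +
        (y + (algebraMap K _ E.a₁ * x + algebraMap K _ E.a₃) / 2) ^ 2 * hi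
    · intro h
      linear_combination -h + h6 / 432 +
        (y + (algebraMap K _ E.a₁ * x + algebraMap K _ E.a₃) / 2) ^ 2 * hi

variable (hE : E.c₆ = 0) (hi : i ^ 2 = -1)

lemma map_quarticAut (σ : Gal(AlgebraicClosure K/K)) {i' : AlgebraicClosure K} (hi' : i' ^ 2 = -1)
    (h : σ i = i') (X : GeomPoint E) :
    Point.map (W' := E) σ.toAlgHom ((quarticAut E hE hi).map X) =
      (quarticAut E hE hi').map (Point.map (W' := E) σ.toAlgHom X) := by
  by_cases hX : X = 0
  · rw [hX, _root_.map_zero, CoordChange.map_zero, CoordChange.map_zero, _root_.map_zero]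
  obtain ⟨h1, h2, h3⟩ := (quarticAut E hE hi).map_spec hX
  obtain ⟨h4, h5, h6⟩ := (quarticAut E hE hi').map_spec (map_point_ne_zero σ hX)
  refine ext_coord (map_point_ne_zero σ h1) h4 ?_ ?_
  · rw [xCoord_map, h2, h5, xCoord_map]
    simp [quarticAut, map_ofNat σ 6]
  · rw [yCoord_map, h3, h6, xCoord_map, yCoord_map]
    simp [quarticAut, h, map_ofNat σ 2, map_ofNat σ 12]

lemma quarticAut_neg (hi' : (-i) ^ 2 = -1) (X : GeomPoint E) :
    (quarticAut E hE hi').map X = (quarticAut E hE hi).map (-X) := by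
  by_cases hX : X = 0
  · rw [hX, neg_zero, CoordChange.map_zero, CoordChange.map_zero]
  obtain ⟨h1, h2, h3⟩ := (quarticAut E hE hi').map_spec hX
  obtain ⟨h4, h5, h6⟩ := (quarticAut E hE hi).map_spec (neg_point_ne_zero hX)
  refine ext_coord h1 h4 ?_ ?_
  · rw [h2, h5, xCoord_neg]; simp only [quarticAut]
  · rw [h3, h6, xCoord_neg, yCoord_neg' hX]; simp only [quarticAut]; ring

/-- The action of a fourth root of unity on the `p`-torsion points of a curve with `c₆ = 0`. -/
def quarticTorsion (p : ℕ) [Fact p.Prime] : Torsion p E ≃ₗ[ZMod p] Torsion p E :=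
  let Ψ := (quarticAut E hE hi).iso.addEquiv
  let Θ : Torsion p E ≃+ Torsion p E :=
    { toFun := fun P ↦ ⟨Ψ P, AddSubgroup.torsionBy.nsmul_iff.mpr (by
        rw [← map_nsmul, P.nsmul_eq_zero, _root_.map_zero])⟩
      invFun := fun P ↦ ⟨Ψ.symm P, AddSubgroup.torsionBy.nsmul_iff.mpr (by
        rw [← map_nsmul, P.nsmul_eq_zero, _root_.map_zero])⟩
      left_inv := fun P ↦ Subtype.ext (Ψ.symm_apply_apply _)
      right_inv := fun P ↦ Subtype.ext (Ψ.apply_symm_apply _)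
      map_add' := fun P Q ↦ Subtype.ext (_root_.map_add Ψ _ _) }
  { Θ with map_smul' := fun c P ↦ ZMod.map_smul Θ c P }

lemma det_quarticTorsion (hp : p ≠ 2) :
    LinearMap.det (quarticTorsion hE hi p).toLinearMap = 1 := by
  refine det_eq_of_torsionPairing hp fun P Q ↦ ?_
  rw [ZMod.val_one, pow_one]
  exact (quarticAut E hE hi).weilPairing_map (hpp.out.odd_of_ne_two hp)
    P.nsmul_eq_zero Q.nsmul_eq_zero

lemma quarticAut_quarticAut (X : GeomPoint E) :
    (quarticAut E hE hi).map ((quarticAut E hE hi).map X) = -X := by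
  by_cases hX : X = 0
  · rw [hX, neg_zero, CoordChange.map_zero, CoordChange.map_zero]
  obtain ⟨h1, h2, h3⟩ := (quarticAut E hE hi).map_spec hX
  obtain ⟨h4, h5, h6⟩ := (quarticAut E hE hi).map_spec h1
  refine ext_coord h4 (neg_point_ne_zero hX) ?_ ?_
  · rw [h5, h2, xCoord_neg]; simp only [quarticAut]; ring
  · rw [h6, h3, h2, yCoord_neg' hX]; simp only [quarticAut, map_mul]
    linear_combination (yCoord X + (algebraMap K _ E.a₁ * xCoord X + algebraMap K _ E.a₃) / 2) * hi

lemma twistCommutes_quarticTorsion :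
    TwistCommutes (galoisRep p E) (quadChar (-1)) (quarticTorsion hE hi p).toLinearMap := by
  intro σ P
  have hi1 : i ^ 2 = algebraMap K _ (-1) := by rw [hi, _root_.map_neg, _root_.map_one]
  have hσ := quadChar_spec hi1 σ
  rcases Int.units_eq_one_or (quadChar (-1) σ) with h | h
  · rw [h, Units.val_one, Int.cast_one, one_mul] at hσ
    rw [h, Units.val_one, Int.cast_one, one_smul]
    exact Subtype.ext (map_quarticAut hE hi σ hi hσ P.1).symm
  · rw [h, Units.val_neg, Units.val_one, Int.cast_neg, Int.cast_one, neg_one_mul] at hσ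
    rw [h, Units.val_neg, Units.val_one, Int.cast_neg, Int.cast_one, neg_smul, one_smul,
      eq_comm, neg_eq_iff_eq_neg, ← _root_.map_neg]
    have hi' : (-i) ^ 2 = -1 := by rw [neg_sq, hi]
    refine Subtype.ext ((map_quarticAut hE hi σ hi' hσ P.1).trans ?_)
    exact quarticAut_neg hE hi hi' _

-- If −1 were a square, the automorphism of order four would commute with Galois and be a scalar c
-- on E[p]. Its determinant gives c² = 1, but its square is −1.
include hE in
lemma not_isSquare_neg_one (hp : p ≠ 2) (hρ : IsAbsolutelyIrreducible (galoisRep p E)) :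
    ¬ IsSquare (-1 : K) := by
  obtain ⟨i, hi⟩ := IsAlgClosed.exists_pow_nat_eq (-1 : AlgebraicClosure K) two_pos
  intro hsq
  obtain ⟨c, hc⟩ := hρ.exists_eq_smul_one (quarticTorsion hE hi p).toLinearMap fun σ v ↦ by
    have h := twistCommutes_quarticTorsion (p := p) hE hi σ v
    rwa [isSquare_iff_forall_quadChar.mp hsq σ, Units.val_one, Int.cast_one, one_smul] at h
  have hdet := det_quarticTorsion (p := p) hE hi hp
  rw [show (quarticTorsion hE hi p).toLinearMap = c • LinearMap.id from LinearMap.ext hc,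
    LinearMap.det_smul, finrank_torsion, LinearMap.det_id, mul_one] at hdet
  obtain ⟨v, hv⟩ := exists_ne (0 : Torsion p E)
  have h2 : quarticTorsion hE hi p (quarticTorsion hE hi p v) = -v :=
    Subtype.ext (quarticAut_quarticAut hE hi v.1)
  have hc' : ∀ v, quarticTorsion hE hi p v = c • v := hc
  rw [hc', hc', smul_smul, ← sq, hdet, one_smul, eq_neg_iff_add_eq_zero, ← two_smul (ZMod p)] at h2
  exact smul_ne_zero (two_ne_zero_zmod hp) hv h2

include hE in
lemma congruent_neg_one : Congruent p E (quadraticTwist E (-1)) := by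
  obtain ⟨i, hi⟩ := IsAlgClosed.exists_pow_nat_eq (-1 : AlgebraicClosure K) two_pos
  exact congruent_of_twistCommutes (neg_ne_zero.mpr one_ne_zero) (quarticTorsion hE hi p)
    (twistCommutes_quarticTorsion hE hi)

end J1728

/-! ### Isomorphisms between quadratic twists -/

section IsomorphicTwists

variable {K : Type*} [Field K] [CharZero K] {E : WeierstrassCurve K}

lemma quadraticTwist_c₆ (d : K) : (quadraticTwist E d).c₆ = d ^ 3 * E.c₆ := by
  simp only [quadraticTwist, WeierstrassCurve.b₂, WeierstrassCurve.c₆, WeierstrassCurve.b₄,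
    WeierstrassCurve.b₆]
  ring

lemma isSquare_mul_of_cube {d e u : K} (he : e ≠ 0) (hu : u ≠ 0) (h : u ^ 6 * d ^ 3 = e ^ 3) :
    IsSquare (d * e) := by
  have hd : d ≠ 0 := by
    rintro rfl
    exact he (pow_eq_zero_iff three_ne_zero |>.mp (by rw [← h]; ring))
  refine ⟨e ^ 2 / (u ^ 3 * d), ?_⟩
  field_simp
  linear_combination h

/-- A twist by d multiplies c₆ by d³, and a change of variables multiplies it by a sixth power.
Hence (e/d)³ is a sixth power, and e/d is a square. -/
lemma isSquare_mul_of_isomorphicOver (h6 : E.c₆ ≠ 0) {d e : K} (he : e ≠ 0)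
    (h : IsomorphicOver (quadraticTwist E d) (quadraticTwist E e)) : IsSquare (d * e) := by
  obtain ⟨C, hC⟩ := h
  have h1 := congrArg WeierstrassCurve.c₆ hC
  rw [variableChange_c₆, quadraticTwist_c₆, quadraticTwist_c₆, ← mul_assoc] at h1
  exact isSquare_mul_of_cube he (Units.ne_zero _) (mul_right_cancel₀ h6 h1)

lemma isSquare_of_isomorphicOver (h6 : E.c₆ ≠ 0) {e : K} (he : e ≠ 0)
    (h : IsomorphicOver E (quadraticTwist E e)) : IsSquare e := by
  obtain ⟨C, hC⟩ := h
  have h1 := congrArg WeierstrassCurve.c₆ hC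
  rw [variableChange_c₆, quadraticTwist_c₆] at h1
  have h2 := isSquare_mul_of_cube (d := 1) he (Units.ne_zero C.u⁻¹) (by
    rw [one_pow, mul_one]; exact mul_right_cancel₀ h6 h1)
  rwa [one_mul] at h2

end IsomorphicTwists

end EllipticCongruence

end

open EllipticCongruence
theorem theorem2p6 {K : Type*} [Field K] [NumberField K] [DecidableEq (AlgebraicClosure K)]
    (p : ℕ) [Fact p.Prime] (hp : p ≠ 2)
    (E : WeierstrassCurve K) [E.IsElliptic]
    (d : K) (hd : ¬ IsSquare d)
    (hcong : Congruent p E (quadraticTwist E d))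
    (hirr : IsAbsolutelyIrreducible (galoisRep p E)) :
    (p = 3 → E.j ≠ 0) ∧
    -- the Cartan subgroup associated to `K(√d)/K`, and the type of the congruence
    ((∃! C, IsAssociatedCartan p E d C) ∧
      ∀ C, IsAssociatedCartan p E d C → ∀ φ : TorsionIso p E (quadraticTwist E d),
        (IsSymplectic φ ↔
          (IsSplitCartan C ∧ p % 4 = 1) ∨ (IsNonsplitCartan C ∧ p % 4 = 3)) ∧
        (IsAntisymplectic φ ↔ ¬ IsSymplectic φ)) ∧
    -- projective image `C₂ × C₂`
    (IsKleinFour (projectiveImage p E) →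
      (∃ D : Fin 3 → K, (∀ i, ¬ IsSquare (D i)) ∧ (∀ i j, i ≠ j → ¬ IsSquare (D i * D j)) ∧
        (∀ e : K, ¬ IsSquare e →
          (Congruent p E (quadraticTwist E e) ↔ ∃ i, IsSquare (e * D i))) ∧
        (E.j ≠ 1728 → (∀ i, ¬ IsomorphicOver E (quadraticTwist E (D i))) ∧
          ∀ i j, i ≠ j → ¬ IsomorphicOver (quadraticTwist E (D i)) (quadraticTwist E (D j))) ∧
        (E.j = 1728 → ∃ i, IsSquare (-D i))) ∧
      (IsSquare (pStar p : K) →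
        ∀ e : K, ¬ IsSquare e → ∀ φ : TorsionIso p E (quadraticTwist E e),
          IsSymplectic φ ∧ ¬ IsAntisymplectic φ) ∧
      (¬ IsSquare (pStar p : K) →
        Congruent p E (quadraticTwist E (pStar p : K)) ∧
        ∀ e : K, ¬ IsSquare e → ∀ φ : TorsionIso p E (quadraticTwist E e),
          (IsSquare (e * (pStar p : K)) → IsSymplectic φ ∧ ¬ IsAntisymplectic φ) ∧
          (¬ IsSquare (e * (pStar p : K)) → IsAntisymplectic φ ∧ ¬ IsSymplectic φ))) := by
  refine ⟨?_, associatedCartan_of_congruent hp hirr hd hcong, fun hK ↦ ?_⟩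
  · rintro rfl
    exact j_ne_zero_of_isAbsolutelyIrreducible hirr
  obtain ⟨s, hs⟩ := exists_kleinGenerators finrank_torsion hirr hK
  obtain ⟨D, hD⟩ := exists_twistCommutes_quadChar hp hs
  refine ⟨⟨D, hs.not_isSquare hirr hD, fun i j ↦ hs.not_isSquare_mul hirr hD,
    fun e he ↦ hs.congruent_iff hp hirr hD he, fun hj ↦ ?_, fun hj ↦ ?_⟩,
    fun hP e he φ ↦ hs.isSymplectic_of_isSquare hp hirr hD hP he φ,
    fun hP ↦ ⟨hs.congruent_pStar hp hirr hD hP, fun e he φ ↦ ?_⟩⟩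
  · have h6 : E.c₆ ≠ 0 := fun h ↦ hj ((c₆_eq_zero_iff E).mp h)
    exact ⟨fun i h ↦ hs.not_isSquare hirr hD i (isSquare_of_isomorphicOver h6 (hD i).1 h),
      fun i j hij h ↦ hs.not_isSquare_mul hirr hD hij
        (isSquare_mul_of_isomorphicOver h6 (hD j).1 h)⟩
  · have h6 := (c₆_eq_zero_iff E).mpr hj
    -- The twist by −1 is congruent to E and −1 is not a square, so its class must be among the
    -- three.
    simpa only [neg_one_mul] using
      (hs.congruent_iff hp hirr hD (not_isSquare_neg_one h6 hp hirr)).mp (congruent_neg_one h6)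
  · obtain ⟨h1, h2⟩ := hs.isSymplectic_iff hp hirr hD hP he φ
    rw [h2, not_not, h1]
    exact ⟨fun h ↦ ⟨h, h⟩, fun h ↦ ⟨h, h⟩⟩
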